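/- **Setting.** Greek indices run over $\{0,1,2,3\}$, repeated indices are summed, $x=(t,x^1,x^2,x^3)\in\mathbb R^4$, $m=\mathrm{diag}(-1,1,1,1)$, $r=|(x^1,x^2,x^3)|$, $V_T=[0,T)\times\mathbb R^3$ with $0<T<\infty$. Let $g=m+h$ be a Lorentzian metric on $V_T$ satisfying the wave coordinates condition $g^{\alpha\beta}\Gamma^{\lambda}_{\alpha\beta}=0$, let $A=A_\alpha dx^\alpha$ be an $\mathfrak{su}(2)$-valued 1-form, $\Phi$ a $\mathbb C^2$-valued function on $V_T$ and $V:[0,\infty)\to\mathbb R$. Fix an inner product on $\mathfrak{su}(2)$ with $\langle f,[k,l]\rangle=\langle[f,k],l\rangle$. Let $\sigma_1,\sigma_2,\sigma_3$ be the Pauli matrices, $S^a=\sqrt{-1}\sigma_a/2$, $T_1=S^1$, $T_2=-S^2$, $T_3=S^3$, $A_\alpha=A^a_\alpha T_a$, $A\cdot\sigma:=A^a\sigma_a$, and $$\tilde F_{\alpha\beta}=\partial_\alpha A_\beta-\partial_\beta A_\alpha+[A_\alpha,A_\beta],\qquad \hat\nabla_\alpha\Phi=\partial_\alpha\Phi-\tfrac{\sqrt{-1}}2A_\alpha\cdot\sigma\,\Phi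 .$$ Put $P_{\mu\nu}[u]=u^{\alpha\alpha'}u^{\beta\beta'}(\frac14\partial_\mu h_{\beta\beta'}\partial_\nu h_{\alpha\alpha'}-\frac12\partial_\nu h_{\alpha\beta}\partial_\mu h_{\alpha'\beta'})$ and $$\begin{aligned}Q_{\mu\nu}[u]=u^{\alpha\alpha'}u^{\beta\beta'}\{&\partial_\alpha h_{\beta\mu}\partial_{\alpha'}h_{\beta'\nu}-(\partial_\alpha h_{\beta\mu}\partial_{\beta'}h_{\alpha'\nu}-\partial_{\beta'}h_{\beta\mu}\partial_\alpha h_{\alpha'\nu})\\&+(\partial_\mu h_{\alpha'\beta'}\partial_\alpha h_{\beta\nu}-\partial_\alpha h_{\alpha'\beta'}\partial_\mu h_{\beta\nu})+(\partial_\nu h_{\alpha'\beta'}\partial_\alpha h_{\beta\mu}-\partial_\alpha h_{\alpha'\beta'}\partial_\nu h_{\beta\mu})\\&+\tfrac12(\partial_{\beta'}h_{\alpha\alpha'}\partial_\mu h_{\beta\nu}-\partial_\mu h_{\alpha\alpha'}\partial_{\beta'}h_{\beta\nu})+\tfrac12(\partial_{\beta'}h_{\alpha\alpha'}\partial_\nu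 h_{\beta\mu}-\partial_\nu h_{\alpha\alpha'}\partial_{\beta'}h_{\beta\mu})\}.\end{aligned}$$ With $h^{\alpha\beta}=m^{\alpha\alpha'}m^{\beta\beta'}h_{\alpha'\beta'}$, let $O^{\alpha\beta}$, $O^{\alpha\beta\rho\sigma}$, $O_{\mu\nu}^{\alpha\rho\beta\sigma}$ be the remainders of the first order expansions in $h$ of $g^{\alpha\beta}$, $g^{\alpha\beta}g^{\rho\sigma}$, $g_{\mu\nu}g^{\alpha\rho}g^{\beta\sigma}$ (so $g^{\alpha\beta}=m^{\alpha\beta}-h^{\alpha\beta}+O^{\alpha\beta}$, etc.), and let $G_{\mu\nu}=P_{\mu\nu}[g^{-1}]+Q_{\mu\nu}[g^{-1}]-P_{\mu\nu}[m^{-1}]-Q_{\mu\nu}[m^{-1}]$. The inhomogeneous terms of the reduced Einstein-Yang-Mills-Higgs system for $(h,A,\Phi)$ are $$\begin{aligned}F_{\mu\nu}=\;&P_{\mu\nu}[m^{-1}]+Q_{\mu\nu}[m^{-1}]+G_{\mu\nu}-(h_{\mu\nu}+m_{\mu\nu})V(|\Phi|^2)+2(h^{\alpha\beta}-m^{\alpha\beta}-O^{\alpha\beta})\langle\tilde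 F_{\alpha\mu},\tilde F_{\beta\nu}\rangle\\&+\tfrac12\{m^{\alpha\rho}m^{\beta\sigma}(h_{\mu\nu}+m_{\mu\nu})-h^{\alpha\rho}m^{\beta\sigma}m_{\mu\nu}-m^{\alpha\rho}h^{\beta\sigma}m_{\mu\nu}+O_{\mu\nu}^{\alpha\rho\beta\sigma}\}\langle\tilde F_{\alpha\beta},\tilde F_{\rho\sigma}\rangle\\&-(\hat\nabla_\mu\Phi)^\dagger\hat\nabla_\nu\Phi-(\hat\nabla_\nu\Phi)^\dagger\hat\nabla_\mu\Phi,\end{aligned}$$ $$\begin{aligned}J_\beta=\;&\{-m^{\alpha\theta}h^{\mu\lambda}-h^{\alpha\theta}m^{\mu\lambda}+m^{\alpha\theta}m^{\mu\lambda}+O^{\alpha\theta\mu\lambda}\}\partial_\beta h_{\theta\mu}\partial_\lambda A_\alpha\\&+\tfrac12\{-m^{\alpha\lambda}h^{\theta\mu}-h^{\alpha\lambda}m^{\theta\mu}+m^{\alpha\lambda}m^{\theta\mu}+O^{\alpha\lambda\theta\mu}\}(\partial_\lambda h_{\mu\beta}+\partial_\beta h_{\mu\lambda}-\partial_\mu h_{\lambda\beta})(\partial_\alpha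 A_\theta-\partial_\theta A_\alpha)\\&-(m^{\alpha\lambda}-h^{\alpha\lambda}+O^{\alpha\lambda})\{[A_\alpha,\partial_\lambda A_\beta]-[A_\lambda,\partial_\beta A_\alpha]+[A_\lambda,\partial_\alpha A_\beta]+[A_\lambda,[A_\alpha,A_\beta]]\}\\&+\{\Phi^\dagger S^a\hat\nabla_\beta\Phi-(\hat\nabla_\beta\Phi)^\dagger S^a\Phi\}T_a,\end{aligned}$$ $$W=(m^{\lambda\mu}-h^{\lambda\mu}+O^{\lambda\mu})\{\tfrac{\sqrt{-1}}2A_\mu\cdot\sigma\,\partial_\lambda\Phi+\tfrac{\sqrt{-1}}2A_\lambda\cdot\sigma\,\partial_\mu\Phi+\tfrac14(A_\lambda\cdot\sigma)(A_\mu\cdot\sigma)\Phi\}+V'(|\Phi|^2)\Phi .$$ Let $\mathfrak L=\{\partial_\alpha,\ \Omega_{\alpha\beta}=-x_\alpha\partial_\beta+x_\beta\partial_\alpha,\ \tilde S=t\partial_t+r\partial_r\}$ with $x_\alpha=m_{\alpha\beta}x^\beta$. A multi-index $I$ of length $|I|=k$ is a sequence of $k$ elements of $\mathfrak L$; $Z^I$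 is their product, acting on components. Norms are the Euclidean ones over all components (with $\langle\cdot,\cdot\rangle$ on $\mathfrak{su}(2)$ and $|\Phi|^2=\Phi^\dagger\Phi$). At points with $r\ne0$ let $\partial_r=\omega^i\partial_i$, $\omega_i=x_i/r$, $L=\partial_t+\partial_r$, $\underline L=\partial_t-\partial_r$, $\tilde S_1,\tilde S_2$ an orthonormal frame tangent to the spheres; $\mathcal T=\{L,\tilde S_1,\tilde S_2\}$, $\mathcal U=\{\underline L,L,\tilde S_1,\tilde S_2\}$, $\mathcal L=\{L\}$; $\bar\partial_0=L$, $\bar\partial_i=\partial_i-\omega_i\partial_r$, $|\bar\partial p|^2=\sum_{\mu,\nu,\beta}(\bar\partial_\beta p_{\mu\nu})^2$, and, with $eu^{VV'}$ the inverse of the Euclidean metric in the frame $\{\underline L,L,\tilde S_1,\tilde S_2\}$, $$|\partial p|^2_{\mathcal V\mathcal W}=\sum_{V,V'\in\mathcal V}\sum_{W,W'\in\mathcal W}\sum_\gamma eu^{VV'}eu^{WW'}\,(V^\alpha W^\beta\partial_\gamma p_{\alpha\beta})(V'^{\alpha}W'^{\beta}\partial_\gamma p_{\alpha\beta}).$$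 **Proposition.** Let $n\ge0$ and $\tilde C<1$. There is a constant $C$, depending only on $n$, $\tilde C$ and the inner product, such that the following holds for all $T,h,A,\Phi,V$ as above with $h,A,\Phi$ of class $C^{n+1}$ on $V_T$ and $V$ of class $C^{n+1}$ on $[0,\infty)$, every multi-index $I$ with $|I|=n$, and every point of $V_T$ at which $|Z^Jh|\le\tilde C$ for all $|J|\le n$. At that point (for the first estimate: if $r\neq0$ there) $$\begin{aligned} |Z^IF|\le C\Big\{&\sum_{|J|+|K|\le|I|}\big(|\partial Z^Jh|_{\mathcal{TU}}|\partial Z^Kh|_{\mathcal{TU}}+|\bar\partial Z^Jh||\partial Z^Kh|\big)+\sum_{|J|+|K|\le|I|-1}|\partial Z^Jh|_{\mathcal{LT}}|\partial Z^Kh|\\ &+\sum_{|J|+|K|\le|I|-2}|\partial Z^Jh||\partial Z^Kh|+\sum_{|J_1|+|J_2|+|J_3|\le|I|}|Z^{J_3}h||\partial Z^{J_2}h||\partial Z^{J_1}h|+\sum_{|J_1|+|J_2|\le|I|}|\partial Z^{J_1}A||\partial Z^{J_2}A|\\ &+\sum_{|J_1|+|J_2|+|J_3|\le|I|}|\partial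 Z^{J_1}A||Z^{J_2}A||Z^{J_3}A|+\sum_{|I_1|+\cdots+|I_{2s}|=|I|}|V^{(s)}(|\Phi|^2)|\prod_{i=1}^{2s}|Z^{I_i}\Phi|\\ &+\sum_{|J_1|+\cdots+|J_4|\le|I|}|Z^{J_1}A||Z^{J_2}A||Z^{J_3}A||Z^{J_4}A|+\sum_{|J_1|+|I_1|+\cdots+|I_{2s}|=|I|}|Z^{J_1}h||V^{(s)}(|\Phi|^2)|\prod_{i=1}^{2s}|Z^{I_i}\Phi|\\ &+\sum_{|J_1|+|J_2|\le|I|}|\partial Z^{J_1}\Phi||\partial Z^{J_2}\Phi|+\sum_{|J_1|+|J_2|+|J_3|\le|I|}|Z^{J_1}A||Z^{J_2}\Phi||\partial Z^{J_3}\Phi|\\ &+\sum_{|J_1|+\cdots+|J_4|=|I|}|Z^{J_1}A||Z^{J_2}A||Z^{J_3}\Phi||Z^{J_4}\Phi|\Big\}, \end{aligned}$$ $$\begin{aligned} |Z^IJ|\le C\Big\{&\sum_{|I_1|+|I_2|\le|I|}|\partial Z^{I_1}h||\partial Z^{I_2}A|+\sum_{|I_1|+|I_2|\le|I|}|Z^{I_1}A||\partial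 Z^{I_2}A|+\sum_{|I_1|+|I_2|+|I_3|\le|I|}|Z^{I_1}A||Z^{I_2}A||Z^{I_3}A|\\ &+\sum_{|I_1|+|I_2|\le|I|}|Z^{I_1}\Phi||\partial Z^{I_2}\Phi|+\sum_{|I_1|+|I_2|+|I_3|=|I|}|Z^{I_1}\Phi||Z^{I_2}\Phi||Z^{I_3}A|\Big\}, \end{aligned}$$ $$\begin{aligned}|Z^IW|\le C\Big\{&\sum_{|I_1|+|I_2|\le|I|}|Z^{I_1}A||\partial Z^{I_2}\Phi|+\sum_{|I_1|+|I_2|+|I_3|\le|I|}|Z^{I_1}A||Z^{I_2}A||Z^{I_3}\Phi|\\&+\sum_{|I_1|+\cdots+|I_{2s+1}|=|I|}|V^{(s+1)}(|\Phi|^2)|\prod_{i=1}^{2s+1}|Z^{I_i}\Phi|\Big\}.\end{aligned}$$ In the sums with $V$, $s$ also runs over $0\le s\le|I|$; all other sums run over all multi-indices of the indicated lengths. -/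

import Mathlib

open scoped Matrix

attribute [local instance 100] LieRing.ofAssociativeRing

noncomputable section

namespace EYMH

/-! ### Space-time, coordinate derivatives, the Minkowski metric -/

/-- `ℝ⁴` with coordinates `x 0 = t` and `x 1, x 2, x 3`. -/
abbrev Spacetime := EuclideanSpace ℝ (Fin 4)

/-- The slab `V_T = [0,T) × ℝ³`. -/
def slab (T : ℝ) : Set Spacetime := {x | 0 ≤ x 0 ∧ x 0 < T}

/-- The coordinate vector `∂_α`. -/
def e (α : Fin 4) : Spacetime := EuclideanSpace.single α 1

/-- The partial derivative `∂_α f` of a function given on the domain `D`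
(one-sided at boundary points of `D`). -/
def pd {E : Type*} [NormedAddCommGroup E] [NormedSpace ℝ E] (D : Set Spacetime) (α : Fin 4)
    (f : Spacetime → E) (x : Spacetime) : E :=
  fderivWithin ℝ f D x (e α)

/-- The Minkowski metric `m = diag(-1,1,1,1)`. -/
def mink : Matrix (Fin 4) (Fin 4) ℝ := Matrix.diagonal ![-1, 1, 1, 1]

theorem mink_mul_mink : mink * mink = 1 := by
  rw [mink, Matrix.diagonal_mul_diagonal, ← Matrix.diagonal_one]
  congr 1
  funext i
  fin_cases i <;> simp

theorem mink_inv : mink⁻¹ = mink := Matrix.inv_eq_left_inv mink_mul_mink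

/-- The lowered coordinates `x_α = m_{αβ} x^β`. -/
def lower (x : Spacetime) (α : Fin 4) : ℝ := ∑ β, mink α β * x β

/-! ### The commuting vector fields and their products -/

/-- Labels of the vector fields of the family `{∂_α, Ω_{αβ}, S}`. -/
inductive VField
  | d (α : Fin 4)
  | Om (α β : Fin 4)
  | S
  deriving DecidableEq, Fintype

/-- The vector fields `∂_α`, `Ω_{αβ} = -x_α ∂_β + x_β ∂_α` and
`S = t ∂_t + r ∂_r = x^α ∂_α`. -/
def VField.vec : VField → Spacetime → Spacetime
  | .d α, _ => e α
  | .Om α β, x => -(lower x α) • e β + lower x β • e α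
  | .S, x => x

/-- A multi-index is a finite sequence of vector fields; its length is `|I|`. -/
abbrev MultiIndex := List VField

/-- `Z^I f = Z^{ι₁} (⋯ (Z^{ι_k} f))` for `I = (ι₁, …, ι_k)`. -/
def ZI {E : Type*} [NormedAddCommGroup E] [NormedSpace ℝ E] (D : Set Spacetime) :
    MultiIndex → (Spacetime → E) → Spacetime → E
  | [], f => f
  | ι :: I, f => fun x => fderivWithin ℝ (ZI D I f) D x (ι.vec x)

/-- The finite set of multi-indices of length at most `n`. -/
def multiIndices (n : ℕ) : Finset MultiIndex :=
  (Finset.range (n + 1)).biUnion fun k =>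
    (Finset.univ : Finset (Fin k → VField)).image List.ofFn

theorem mem_multiIndices {n : ℕ} {J : MultiIndex} : J ∈ multiIndices n ↔ J.length ≤ n := by
  simp only [multiIndices, Finset.mem_biUnion, Finset.mem_range, Finset.mem_image,
    Finset.mem_univ, true_and]
  constructor
  · rintro ⟨k, hk, f, rfl⟩
    simp only [List.length_ofFn]
    omega
  · intro h
    exact ⟨J.length, by omega, J.get, List.ofFn_get J⟩

/-- All `l`-tuples of multi-indices with `|J_1| + ⋯ + |J_l| = n`. -/
def tuplesEq (l n : ℕ) : Finset (Fin l → MultiIndex) :=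
  (Fintype.piFinset fun _ => multiIndices n).filter fun J => ∑ i, (J i).length = n

/-- All `l`-tuples of multi-indices with `|J_1| + ⋯ + |J_l| ≤ n - c`, the difference being taken
in the integers (so there are none if `n < c`). -/
def tuplesLE (l n c : ℕ) : Finset (Fin l → MultiIndex) :=
  (Fintype.piFinset fun _ => multiIndices n).filter fun J => ∑ i, (J i).length + c ≤ n

theorem mem_tuplesEq {l n : ℕ} {J : Fin l → MultiIndex} :
    J ∈ tuplesEq l n ↔ ∑ i, (J i).length = n := by
  simp only [tuplesEq, Finset.mem_filter, Fintype.mem_piFinset, mem_multiIndices,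
    and_iff_right_iff_imp]
  intro h i
  rw [← h]
  exact Finset.single_le_sum (f := fun i => (J i).length) (fun _ _ => Nat.zero_le _)
    (Finset.mem_univ i)

theorem mem_tuplesLE {l n c : ℕ} {J : Fin l → MultiIndex} :
    J ∈ tuplesLE l n c ↔ ∑ i, (J i).length + c ≤ n := by
  simp only [tuplesLE, Finset.mem_filter, Fintype.mem_piFinset, mem_multiIndices,
    and_iff_right_iff_imp]
  intro h i
  have := Finset.single_le_sum (f := fun i => (J i).length) (fun _ _ => Nat.zero_le _)
    (Finset.mem_univ i)
  omega

/-! ### The Lie algebra `𝔰𝔲(2)` and the Higgs doublet -/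

/-- `𝔰𝔲(2)`: the traceless anti-Hermitian `2 × 2` matrices, with the commutator as bracket. -/
def su2 : LieSubalgebra ℝ (Matrix (Fin 2) (Fin 2) ℂ) where
  carrier := {X | Xᴴ = -X ∧ X.trace = 0}
  add_mem' := by
    rintro X Y ⟨h1, h2⟩ ⟨h3, h4⟩
    refine ⟨?_, ?_⟩
    · rw [Matrix.conjTranspose_add, h1, h3]; abel
    · rw [Matrix.trace_add, h2, h4, add_zero]
  zero_mem' := by simp
  smul_mem' := by
    rintro c X ⟨h1, h2⟩
    refine ⟨?_, ?_⟩
    · rw [Matrix.conjTranspose_smul, h1, star_trivial, smul_neg]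
    · rw [Matrix.trace_smul, h2, smul_zero]
  lie_mem' := by
    rintro X Y ⟨h1, h2⟩ ⟨h3, h4⟩
    refine ⟨?_, ?_⟩
    · rw [Ring.lie_def, Matrix.conjTranspose_sub, Matrix.conjTranspose_mul,
        Matrix.conjTranspose_mul, h1, h3]
      simp
    · rw [Ring.lie_def, Matrix.trace_sub, Matrix.trace_mul_comm, sub_self]

/-- `𝔰𝔲(2)` as a (finite-dimensional) normed space; the norm only serves to differentiate. -/
instance : NormedAddCommGroup su2 :=
  letI := Matrix.normedAddCommGroup (m := Fin 2) (n := Fin 2) (α := ℂ)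
  NormedAddCommGroup.induced su2 (Matrix (Fin 2) (Fin 2) ℂ) su2.toSubmodule.subtype
    Subtype.val_injective

instance : NormedSpace ℝ su2 :=
  letI := Matrix.normedAddCommGroup (m := Fin 2) (n := Fin 2) (α := ℂ)
  letI := Matrix.normedSpace (R := ℝ) (m := Fin 2) (n := Fin 2) (α := ℂ)
  NormedSpace.induced ℝ su2 (Matrix (Fin 2) (Fin 2) ℂ) su2.toSubmodule.subtype

/-- The topology of `𝔰𝔲(2)` is the one of its norm (it is also the subspace topology). -/
instance : TopologicalSpace su2 :=
  (inferInstance : NormedAddCommGroup su2).toMetricSpace.toUniformSpace.toTopologicalSpace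

/-- An inner product `⟨·,·⟩` on `𝔰𝔲(2)` with `⟨f,[k,l]⟩ = ⟨[f,k],l⟩`. -/
structure InvariantInner where
  ip : su2 →ₗ[ℝ] su2 →ₗ[ℝ] ℝ
  symm : ∀ f k, ip f k = ip k f
  pos : ∀ f, f ≠ 0 → 0 < ip f f
  invariant : ∀ f k l, ip f ⁅k, l⁆ = ip ⁅f, k⁆ l

/-- The Pauli matrices `σ_1, σ_2, σ_3` (indexed by `0, 1, 2`). -/
def pauli : Fin 3 → Matrix (Fin 2) (Fin 2) ℂ :=
  ![!![0, 1; 1, 0], !![0, -Complex.I; Complex.I, 0], !![1, 0; 0, -1]]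

/-- `S^I = √-1 σ_I / 2`. -/
def spin (I : Fin 3) : Matrix (Fin 2) (Fin 2) ℂ := (Complex.I / 2) • pauli I

/-- The basis `T_1 = √-1 σ_1/2`, `T_2 = -√-1 σ_2/2`, `T_3 = √-1 σ_3/2` of `𝔰𝔲(2)`. -/
def basisT (I : Fin 3) : su2 :=
  ⟨(![1, -1, 1] I : ℝ) • spin I, by
    constructor
    · ext i j
      fin_cases I <;> fin_cases i <;> fin_cases j <;>
        simp [spin, pauli, Matrix.conjTranspose_apply] <;> ring
    · fin_cases I <;> simp [spin, pauli, Matrix.trace_fin_two]⟩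

/-- The coordinates `A^I` of `A = A^I T_I`. -/
def coordT (A : su2) : Fin 3 → ℝ :=
  ![2 * (A.1 0 1).im, 2 * (A.1 1 0).re, 2 * (A.1 0 0).im]

theorem sum_coordT (A : su2) : ∑ I, coordT A I • basisT I = A := by
  obtain ⟨A, h1, h2⟩ := A
  have h00 := congrFun (congrFun h1 0) 0
  have h01 := congrFun (congrFun h1 0) 1
  rw [Matrix.trace_fin_two] at h2
  simp only [Matrix.conjTranspose_apply, Matrix.neg_apply, Complex.ext_iff, Complex.neg_re,
    Complex.neg_im, Complex.star_def, Complex.conj_re, Complex.conj_im, Complex.add_re,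
    Complex.add_im, Complex.zero_re, Complex.zero_im] at h00 h01 h2
  apply Subtype.ext
  rw [Fin.sum_univ_three]
  change coordT _ 0 • (basisT 0).1 + coordT _ 1 • (basisT 1).1 + coordT _ 2 • (basisT 2).1 = A
  ext i j
  fin_cases i <;> fin_cases j <;> apply Complex.ext <;>
    simp [coordT, basisT, spin, pauli] <;> linarith

/-- The Higgs doublets: `ℂ²` with `|Φ|² = Φ†Φ`, where `Φ†Ψ = inner ℂ Φ Ψ`. -/
abbrev Doublet := EuclideanSpace ℂ (Fin 2)

/-- The action of a `2 × 2` matrix on a doublet. -/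
def act (M : Matrix (Fin 2) (Fin 2) ℂ) (v : Doublet) : Doublet := WithLp.toLp 2 (M *ᵥ v.ofLp)

/-- `A^I σ_I Φ` for `A = A^I T_I`. -/
def sigmaAct (A : su2) (v : Doublet) : Doublet := ∑ I, (coordT A I : ℂ) • act (pauli I) v

/-! ### The metric `g = m + h` -/

/-- The matrix `g_{μν} = m_{μν} + h_{μν}` at `x`. -/
def gMat (h : Fin 4 → Fin 4 → Spacetime → ℝ) (x : Spacetime) : Matrix (Fin 4) (Fin 4) ℝ :=
  Matrix.of fun μ ν => mink μ ν + h μ ν x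

/-- A symmetric bilinear form of signature `(-,+,+,+)`. -/
def IsLorentzian (g : Matrix (Fin 4) (Fin 4) ℝ) : Prop :=
  ∃ P : Matrix (Fin 4) (Fin 4) ℝ, IsUnit P.det ∧ g = Pᵀ * mink * P

/-- `g^{αβ}`. -/
def gUp (h : Fin 4 → Fin 4 → Spacetime → ℝ) (x : Spacetime) (α β : Fin 4) : ℝ :=
  (gMat h x)⁻¹ α β

/-- `m^{αβ}`. -/
def mUp (α β : Fin 4) : ℝ := mink⁻¹ α β

/-- `h^{αβ} = m^{αα'} m^{ββ'} h_{α'β'}`. -/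
def hUp (h : Fin 4 → Fin 4 → Spacetime → ℝ) (x : Spacetime) (α β : Fin 4) : ℝ :=
  ∑ α', ∑ β', mUp α α' * mUp β β' * h α' β' x

/-- The Christoffel symbols
`Γ^l_{αβ} = ½ g^{lδ} (∂_α g_{βδ} + ∂_β g_{αδ} - ∂_δ g_{αβ})`. -/
def christoffel (D : Set Spacetime) (h : Fin 4 → Fin 4 → Spacetime → ℝ)
    (l α β : Fin 4) (x : Spacetime) : ℝ :=
  (1 / 2) * ∑ δ, gUp h x l δ *
    (pd D α (fun y => gMat h y β δ) x + pd D β (fun y => gMat h y α δ) x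
      - pd D δ (fun y => gMat h y α β) x)

/-- The wave coordinates condition `g^{αβ} Γ^l_{αβ} = 0` on `D`. -/
def WaveCoordinates (D : Set Spacetime) (h : Fin 4 → Fin 4 → Spacetime → ℝ) : Prop :=
  ∀ x ∈ D, ∀ l, ∑ α, ∑ β, gUp h x α β * christoffel D h l α β x = 0

/-- `O^{αβ}(h²)`, the remainder in `g^{αβ} = m^{αβ} - h^{αβ} + O^{αβ}(h²)`. -/
def O2 (h : Fin 4 → Fin 4 → Spacetime → ℝ) (x : Spacetime) (α β : Fin 4) : ℝ :=
  gUp h x α β - (mUp α β - hUp h x α β)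

/-- `O^{αβρσ}(h²)`, the remainder in
`g^{αβ} g^{ρσ} = -m^{αβ} h^{ρσ} - h^{αβ} m^{ρσ} + m^{αβ} m^{ρσ} + O^{αβρσ}(h²)`. -/
def O4 (h : Fin 4 → Fin 4 → Spacetime → ℝ) (x : Spacetime) (α β ρ σ : Fin 4) : ℝ :=
  gUp h x α β * gUp h x ρ σ
    - (-(mUp α β * hUp h x ρ σ) - hUp h x α β * mUp ρ σ + mUp α β * mUp ρ σ)

/-- `O^{αρβσ}_{μν}(h²)`, the remainder in the expansion of `g_{μν} g^{αρ} g^{βσ}` to first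
order in `h`. -/
def O6 (h : Fin 4 → Fin 4 → Spacetime → ℝ) (x : Spacetime) (μ ν α ρ β σ : Fin 4) : ℝ :=
  gMat h x μ ν * gUp h x α ρ * gUp h x β σ
    - (mUp α ρ * mUp β σ * h μ ν x + mUp α ρ * mUp β σ * mink μ ν
      - hUp h x α ρ * mUp β σ * mink μ ν - mUp α ρ * hUp h x β σ * mink μ ν)

/-- The form `P(∂_μ h, ∂_ν h)`, contracted with the inverse metric `u`; here `p β μ ν` stands for
`∂_β h_{μν}`. -/
def Pform (u : Fin 4 → Fin 4 → ℝ) (p : Fin 4 → Fin 4 → Fin 4 → ℝ) (μ ν : Fin 4) : ℝ :=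
  ∑ α, ∑ α', ∑ β, ∑ β', u α α' * u β β' *
    ((1 / 4) * (p μ β β' * p ν α α') - (1 / 2) * (p ν α β * p μ α' β'))

/-- The form `Q_{μν}(∂h, ∂h)`, contracted with the inverse metric `u`; here `p β μ ν` stands for
`∂_β h_{μν}`. -/
def Qform (u : Fin 4 → Fin 4 → ℝ) (p : Fin 4 → Fin 4 → Fin 4 → ℝ) (μ ν : Fin 4) : ℝ :=
  ∑ α, ∑ α', ∑ β, ∑ β', u α α' * u β β' *
    (p α β μ * p α' β' ν
      - (p α β μ * p β' α' ν - p β' β μ * p α α' ν)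
      + (p μ α' β' * p α β ν - p α α' β' * p μ β ν)
      + (p ν α' β' * p α β μ - p α α' β' * p ν β μ)
      + (1 / 2) * (p β' α α' * p μ β ν - p μ α α' * p β' β ν)
      + (1 / 2) * (p β' α α' * p ν β μ - p ν α α' * p β' β μ))

/-- `∂_β h_{μν}` at `x`. -/
def dh (D : Set Spacetime) (h : Fin 4 → Fin 4 → Spacetime → ℝ) (x : Spacetime)
    (β μ ν : Fin 4) : ℝ :=
  pd D β (h μ ν) x

/-- `G_{μν}(h)(∂h,∂h)`: the difference between `P + Q` contracted with `g^{αβ}` and with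
`m^{αβ}`. -/
def Gform (D : Set Spacetime) (h : Fin 4 → Fin 4 → Spacetime → ℝ) (μ ν : Fin 4)
    (x : Spacetime) : ℝ :=
  (Pform (gUp h x) (dh D h x) μ ν + Qform (gUp h x) (dh D h x) μ ν)
    - (Pform mUp (dh D h x) μ ν + Qform mUp (dh D h x) μ ν)

/-! ### The inhomogeneous terms of the reduced system -/

/-- `∂_α A_β - ∂_β A_α + [A_α, A_β]`. -/
def curv (D : Set Spacetime) (A : Fin 4 → Spacetime → su2) (α β : Fin 4) (x : Spacetime) : su2 :=
  pd D α (A β) x - pd D β (A α) x + ⁅A α x, A β x⁆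

/-- `∂_α Φ - √-1 A^I_α σ_I Φ / 2`. -/
def covD (D : Set Spacetime) (A : Fin 4 → Spacetime → su2) (Φ : Spacetime → Doublet)
    (α : Fin 4) (x : Spacetime) : Doublet :=
  pd D α Φ x - (Complex.I / 2) • sigmaAct (A α x) (Φ x)

/-- The derivative `V^{(s)}` of the potential, a function on `[0,∞)`. -/
def Vder (V : ℝ → ℝ) (s : ℕ) (y : ℝ) : ℝ := iteratedDerivWithin s V (Set.Ici 0) y

/-- The inhomogeneous term `F_{μν}` of the equation for `h_{μν}`. (The sum of the two Higgs terms
is real.) -/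
def termF (B : InvariantInner) (V : ℝ → ℝ) (D : Set Spacetime)
    (h : Fin 4 → Fin 4 → Spacetime → ℝ) (A : Fin 4 → Spacetime → su2) (Φ : Spacetime → Doublet)
    (μ ν : Fin 4) (x : Spacetime) : ℝ :=
  Pform mUp (dh D h x) μ ν + Qform mUp (dh D h x) μ ν + Gform D h μ ν x
    - (h μ ν x + mink μ ν) * V (‖Φ x‖ ^ 2)
    + 2 * ∑ α, ∑ β, (hUp h x α β - mUp α β) * B.ip (curv D A α μ x) (curv D A β ν x)
    - 2 * ∑ α, ∑ β, O2 h x α β * B.ip (curv D A α μ x) (curv D A β ν x)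
    + (1 / 2) * ∑ α, ∑ ρ, ∑ β, ∑ σ,
        (mUp α ρ * mUp β σ * h μ ν x + mUp α ρ * mUp β σ * mink μ ν
          - hUp h x α ρ * mUp β σ * mink μ ν - mUp α ρ * hUp h x β σ * mink μ ν
          + O6 h x μ ν α ρ β σ)
        * B.ip (curv D A α β x) (curv D A ρ σ x)
    - (inner ℂ (covD D A Φ μ x) (covD D A Φ ν x)
        + inner ℂ (covD D A Φ ν x) (covD D A Φ μ x)).re

/-- The current `Φ†S(D_βΦ) - (D_βΦ)†SΦ = {Φ†S^I D_βΦ - (D_βΦ)†S^I Φ} T_I`; the expression in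
braces is real. -/
def current (D : Set Spacetime) (A : Fin 4 → Spacetime → su2) (Φ : Spacetime → Doublet)
    (β : Fin 4) (x : Spacetime) : su2 :=
  ∑ I, (inner ℂ (Φ x) (act (spin I) (covD D A Φ β x))
    - inner ℂ (covD D A Φ β x) (act (spin I) (Φ x))).re • basisT I

/-- The inhomogeneous term `J_β` of the equation for `A_β`. -/
def termJ (D : Set Spacetime) (h : Fin 4 → Fin 4 → Spacetime → ℝ)
    (A : Fin 4 → Spacetime → su2) (Φ : Spacetime → Doublet)
    (β : Fin 4) (x : Spacetime) : su2 :=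
  (∑ α, ∑ θ, ∑ μ, ∑ l,
      ((-(mUp α θ * hUp h x μ l) - hUp h x α θ * mUp μ l + mUp α θ * mUp μ l
        + O4 h x α θ μ l) * pd D β (h θ μ) x) • pd D l (A α) x)
    + (1 / 2 : ℝ) • (∑ α, ∑ l, ∑ θ, ∑ μ,
      ((-(mUp α l * hUp h x θ μ) - hUp h x α l * mUp θ μ + mUp α l * mUp θ μ
        + O4 h x α l θ μ)
        * (pd D l (h μ β) x + pd D β (h μ l) x - pd D μ (h l β) x))
        • (pd D α (A θ) x - pd D θ (A α) x))
    - (∑ α, ∑ l, (mUp α l - hUp h x α l + O2 h x α l) • ⁅A α x, pd D l (A β) x⁆)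
    + (∑ α, ∑ l, (mUp α l - hUp h x α l + O2 h x α l) •
        (⁅A l x, pd D β (A α) x⁆ - ⁅A l x, pd D α (A β) x⁆ - ⁅A l x, ⁅A α x, A β x⁆⁆))
    + current D A Φ β x

/-- The inhomogeneous term `W` of the equation for `Φ`. -/
def termW (V : ℝ → ℝ) (D : Set Spacetime) (h : Fin 4 → Fin 4 → Spacetime → ℝ)
    (A : Fin 4 → Spacetime → su2) (Φ : Spacetime → Doublet) (x : Spacetime) : Doublet :=
  (Complex.I / 2) • (∑ l, ∑ μ, (mUp l μ - hUp h x l μ + O2 h x l μ) •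
      sigmaAct (A μ x) (pd D l Φ x))
    + (Complex.I / 2) • (∑ l, ∑ μ, (mUp l μ - hUp h x l μ + O2 h x l μ) •
      sigmaAct (A l x) (pd D μ Φ x))
    + (1 / 4 : ℝ) • (∑ l, ∑ μ, (mUp l μ - hUp h x l μ + O2 h x l μ) •
      sigmaAct (A l x) (sigmaAct (A μ x) (Φ x)))
    + Vder V 1 (‖Φ x‖ ^ 2) • Φ x

/-! ### The null frame and the pointwise norms -/

/-- `r = |(x¹,x²,x³)|`. -/
def rad (x : Spacetime) : ℝ := Real.sqrt (x 1 ^ 2 + x 2 ^ 2 + x 3 ^ 2)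

/-- `∂_r = ω^i ∂_i`, `ω_i = x_i / r` (for `r ≠ 0`). -/
def dr (x : Spacetime) : Spacetime := ∑ i : Fin 3, (x i.succ / rad x) • e i.succ

/-- The vectors `∂̄_0 = L = ∂_t + ∂_r` and `∂̄_i = ∂_i - ω_i ∂_r` at `x`. -/
def dbarVec (x : Spacetime) : Fin 4 → Spacetime :=
  Fin.cons (e 0 + dr x) fun i => e i.succ - (x i.succ / rad x) • dr x

/-- Labels of the null frame `{L̲, L, S₁, S₂}`. -/
inductive FrameLabel
  | Lbar
  | L
  | S1
  | S2
  deriving DecidableEq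

/-- `S₁, S₂` form an orthonormal basis of the tangent space at `x` to the sphere of radius `r`
in the time slice through `x`. -/
def IsSphereFrame (x S₁ S₂ : Spacetime) : Prop :=
  S₁ 0 = 0 ∧ S₂ 0 = 0 ∧ inner ℝ S₁ (dr x) = 0 ∧ inner ℝ S₂ (dr x) = 0 ∧
    inner ℝ S₁ S₁ = 1 ∧ inner ℝ S₂ S₂ = 1 ∧ inner ℝ S₁ S₂ = 0

/-- The null frame `L̲ = ∂_t - ∂_r`, `L = ∂_t + ∂_r`, `S₁`, `S₂` at `x`. -/
def frameVec (x S₁ S₂ : Spacetime) : FrameLabel → Spacetime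
  | .Lbar => e 0 - dr x
  | .L => e 0 + dr x
  | .S1 => S₁
  | .S2 => S₂

/-- The inverse `eu^{VV'}` of the Euclidean metric in the null frame. -/
def euInv (V V' : FrameLabel) : ℝ :=
  if V = V' then (if V = .Lbar ∨ V = .L then 1 / 2 else 1) else 0

/-- `𝒯 = {L, S₁, S₂}`. -/
def famT : Finset FrameLabel := {.L, .S1, .S2}

/-- `𝒰 = {L̲, L, S₁, S₂}`. -/
def famU : Finset FrameLabel := {.Lbar, .L, .S1, .S2}

/-- `ℒ = {L}`. -/
def famL : Finset FrameLabel := {.L}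

/-- `|p|_{𝒱𝒲}` for the 3-tensor with components `p α₁ α₂ α₃`: the first two slots are evaluated
on the families `𝒱` and `𝒲`, the last one on all coordinate vectors. -/
def frameNorm (x S₁ S₂ : Spacetime) (𝒱 𝒲 : Finset FrameLabel)
    (p : Fin 4 → Fin 4 → Fin 4 → ℝ) : ℝ :=
  Real.sqrt (∑ V ∈ 𝒱, ∑ V' ∈ 𝒱, ∑ W ∈ 𝒲, ∑ W' ∈ 𝒲, ∑ γ, euInv V V' * euInv W W' *
    (∑ α, ∑ β, frameVec x S₁ S₂ V α * frameVec x S₁ S₂ W β * p α β γ) *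
    (∑ α, ∑ β, frameVec x S₁ S₂ V' α * frameVec x S₁ S₂ W' β * p α β γ))

section norms

/-- `|p|` for a 2-tensor field `p`, at `x`. -/
def normT (p : Fin 4 → Fin 4 → Spacetime → ℝ) (x : Spacetime) : ℝ :=
  Real.sqrt (∑ μ, ∑ ν, p μ ν x ^ 2)

/-- `|∂p|` for a 2-tensor field `p`, at `x`. -/
def normDT (D : Set Spacetime) (p : Fin 4 → Fin 4 → Spacetime → ℝ) (x : Spacetime) : ℝ :=
  Real.sqrt (∑ μ, ∑ ν, ∑ β, pd D β (p μ ν) x ^ 2)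

/-- `|∂̄p|` for a 2-tensor field `p`, at `x`. -/
def normDbarT (D : Set Spacetime) (p : Fin 4 → Fin 4 → Spacetime → ℝ) (x : Spacetime) : ℝ :=
  Real.sqrt (∑ μ, ∑ ν, ∑ β, fderivWithin ℝ (p μ ν) D x (dbarVec x β) ^ 2)

/-- `|∂p|_{𝒱𝒲}` for a 2-tensor field `p`, at `x`. -/
def normDTframe (D : Set Spacetime) (S₁ S₂ : Spacetime) (𝒱 𝒲 : Finset FrameLabel)
    (p : Fin 4 → Fin 4 → Spacetime → ℝ) (x : Spacetime) : ℝ :=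
  frameNorm x S₁ S₂ 𝒱 𝒲 fun μ ν β => pd D β (p μ ν) x

/-- `|a|` for an `𝔰𝔲(2)`-valued 1-form `a`, at `x`. -/
def normA (B : InvariantInner) (a : Fin 4 → Spacetime → su2) (x : Spacetime) : ℝ :=
  Real.sqrt (∑ α, B.ip (a α x) (a α x))

/-- `|∂a|` for an `𝔰𝔲(2)`-valued 1-form `a`, at `x`. -/
def normDA (B : InvariantInner) (D : Set Spacetime) (a : Fin 4 → Spacetime → su2)
    (x : Spacetime) : ℝ :=
  Real.sqrt (∑ α, ∑ β, B.ip (pd D β (a α) x) (pd D β (a α) x))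

/-- `|∂Φ|`, at `x`. -/
def normDPhi (D : Set Spacetime) (Φ : Spacetime → Doublet) (x : Spacetime) : ℝ :=
  Real.sqrt (∑ β, ‖pd D β Φ x‖ ^ 2)

end norms

/-- `Z^I` of a 2-tensor field, applied to its components. -/
def ZT (D : Set Spacetime) (I : MultiIndex) (p : Fin 4 → Fin 4 → Spacetime → ℝ) :
    Fin 4 → Fin 4 → Spacetime → ℝ :=
  fun μ ν => ZI D I (p μ ν)

/-- `Z^I` of an `𝔰𝔲(2)`-valued 1-form, applied to its components. -/
def ZA (D : Set Spacetime) (I : MultiIndex) (a : Fin 4 → Spacetime → su2) :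
    Fin 4 → Spacetime → su2 :=
  fun α => ZI D I (a α)

end EYMH

end

/-!
# Estimates of the inhomogeneous terms of the reduced Einstein-Yang-Mills-Higgs system

Each of the three terms is a sum of products of components of `h`, `A`, `Φ`, their first
derivatives, the inverse metric and derivatives of the potential. The product and chain rules
distribute `Z^I` over the factors, and the vector fields are affine, so that commuting `Z^I` with
`∂_α` only produces terms `∂ Z^J` with `|J| < |I|` (`ZI_fderivWithin`). This already gives the
estimates of `J` and `W`, since `g⁻¹` and its derivatives are bounded where `|Z^J h| ≤ C̃ < 1`
(`abs_gUp_le`, `maj_gUp`).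

The bookkeeping is done with generating series. `Maj P n f a` says that `|Z^J f|` is bounded by the
coefficient of `X^|J|` in the series `a`, uniformly over a family of fields and points; products of
functions correspond to products of series (`Maj.bilin`), the commutators of `Z^I` with `∂_α` to
the factor `∑ X^k` (`DMaj.maj`), and sums over tuples of multi-indices are the coefficients of such
products (`coeff_prod_ser`, `coeff_X_pow_mul_geom_mul_prod_ser`). The family is that of all
admissible fields and points (`Sol`), which makes the constant depend on `n`, `C̃` and the inner
product only.

The estimate of `F` also needs the structure of its quadratic part `P + Q` at the Minkowski metric.

* `Q` is a combination of null forms (`Qform_eq_nullForm`). In a null form the product of two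
  derivatives along `L̲` has coefficient `m(L, L) = 0`, and this persists after commutation since the
  vector fields are conformal Killing fields of `m` (`IsNullSymbol.comm`, `maj_nullForm`).
* In `P`, expanded in the null frame, the component `L̲L̲` of one factor only meets the component
  `LL` of the other one; all other products are of the form `𝒯𝒰` times `𝒯𝒰` (`maj_Pform`).
* `∂h_{LL}` is controlled by the wave coordinates condition contracted with `L` (`dmaj_LL`): modulo
  quadratic terms it expresses `∂_{L̲} h_{LL}` by tangential derivatives. A single commutator maps
  `L` to a vector without `L̲` component, again by conformality, so the terms with one vector field
  less only involve `h_{L𝒯}` or tangential derivatives; the terms with two vector fields less are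
  not restricted. This accounts for the sums over `|J| + |K| ≤ |I| - 1` and `|I| - 2`.

For `h_{VW}` with `V, W` in the frame, the frame vectors are frozen at the point of evaluation, so
that no derivative falls on them.
-/

noncomputable section

namespace EYMH

open scoped NNReal PowerSeries

section calculus

variable {E F G : Type*} [NormedAddCommGroup E] [NormedSpace ℝ E] [NormedAddCommGroup F]
  [NormedSpace ℝ F] [NormedAddCommGroup G] [NormedSpace ℝ G] {D : Set Spacetime}

/-! ### The slab as a domain of differentiation -/

theorem convex_slab (T : ℝ) : Convex ℝ (slab T) := by
  intro x hx y hy a b ha hb hab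
  simp only [slab, Set.mem_ofPred_eq, PiLp.add_apply, PiLp.smul_apply, smul_eq_mul] at *
  constructor
  · have := mul_nonneg ha hx.1
    have := mul_nonneg hb hy.1
    linarith
  · rcases ha.eq_or_lt with rfl | ha'
    · have : b = 1 := by linarith
      subst this; linarith [hy.2]
    · have h1 := mul_lt_mul_of_pos_left hx.2 ha'
      have h2 := mul_le_mul_of_nonneg_left hy.2.le hb
      have : a * T + b * T = T := by rw [← add_mul, hab, one_mul]
      linarith

theorem interior_slab_nonempty {T : ℝ} (hT : 0 < T) : (interior (slab T)).Nonempty := by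
  have hO : IsOpen {x : Spacetime | 0 < x 0 ∧ x 0 < T} :=
    (isOpen_lt continuous_const (g := fun x : Spacetime => x 0) (by fun_prop)).inter
      (isOpen_lt (f := fun x : Spacetime => x 0) (by fun_prop) continuous_const)
  refine ⟨EuclideanSpace.single 0 (T / 2), ?_⟩
  refine interior_maximal (t := {x : Spacetime | 0 < x 0 ∧ x 0 < T}) ?_ hO ?_
  · exact fun x hx => ⟨hx.1.le, hx.2⟩
  · simp only [Set.mem_ofPred_eq, PiLp.single_apply, if_true]
    constructor <;> linarith

theorem uniqueDiffOn_slab {T : ℝ} (hT : 0 < T) : UniqueDiffOn ℝ (slab T) :=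
  uniqueDiffOn_convex (convex_slab T) (interior_slab_nonempty hT)

theorem slab_subset_closure_interior {T : ℝ} (hT : 0 < T) :
    slab T ⊆ closure (interior (slab T)) := by
  rw [(convex_slab T).closure_interior_eq_closure_of_nonempty_interior
    (interior_slab_nonempty hT)]
  exact subset_closure

/-! ### Calculus of the products `Z^I` -/

/-- The covector `v ↦ v_α = m_{αβ} v^β`. -/
def lowerCLM (α : Fin 4) : Spacetime →L[ℝ] ℝ :=
  ∑ β, mink α β • (EuclideanSpace.proj β : Spacetime →L[ℝ] ℝ)

theorem lowerCLM_apply (α : Fin 4) (v : Spacetime) : lowerCLM α v = lower v α := by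
  simp [lowerCLM, lower]

/-- The linear part of the affine vector field `ι`. -/
def VField.lin : VField → Spacetime →L[ℝ] Spacetime
  | .d _ => 0
  | .Om α β => -(lowerCLM α).smulRight (e β) + (lowerCLM β).smulRight (e α)
  | .S => ContinuousLinearMap.id ℝ Spacetime

theorem VField.hasFDerivAt_vec (ι : VField) (x : Spacetime) : HasFDerivAt ι.vec ι.lin x := by
  cases ι with
  | d α => exact hasFDerivAt_const _ _
  | Om α β =>
    have : (VField.Om α β).vec = (VField.Om α β).lin := by
      funext y
      simp [VField.vec, VField.lin, lowerCLM_apply]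
    rw [this]
    exact (VField.Om α β).lin.hasFDerivAt
  | S => exact hasFDerivAt_id x

theorem VField.contDiff_vec (ι : VField) {n : WithTop ℕ∞} : ContDiff ℝ n ι.vec := by
  cases ι with
  | d α => exact contDiff_const
  | Om α β =>
    have : (VField.Om α β).vec = (VField.Om α β).lin := by
      funext y
      simp [VField.vec, VField.lin, lowerCLM_apply]
    rw [this]
    exact ContinuousLinearMap.contDiff _
  | S => exact contDiff_id

theorem ZI_congr {f g : Spacetime → E} (hfg : Set.EqOn f g D) (I : MultiIndex) :
    Set.EqOn (ZI D I f) (ZI D I g) D := by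
  induction I with
  | nil => exact hfg
  | cons ι I ih =>
    intro x hx
    simp only [ZI]
    rw [fderivWithin_congr ih (ih hx)]

/-- The first order derivative of `f` along the vector field `ι`. -/
def Z1 (D : Set Spacetime) (ι : VField) (f : Spacetime → E) : Spacetime → E :=
  fun x => fderivWithin ℝ f D x (ι.vec x)

/-- `Z^I` peeled off at the innermost vector field, the form in which the product rule is used in
inductions. -/
theorem ZI_append_singleton (I : MultiIndex) (ι : VField) (f : Spacetime → E) :
    ZI D (I ++ [ι]) f = ZI D I (Z1 D ι f) := by
  induction I with
  | nil => rfl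
  | cons κ I ih => simp only [List.cons_append, ZI, ih]

theorem contDiffOn_Z1 (hD : UniqueDiffOn ℝ D) {k : ℕ} {f : Spacetime → E}
    (hf : ContDiffOn ℝ (k + 1 : ℕ) f D) (ι : VField) : ContDiffOn ℝ k (Z1 D ι f) D :=
  (hf.fderivWithin hD (by push_cast; rfl)).clm_apply ι.contDiff_vec.contDiffOn

theorem contDiffOn_ZI (hD : UniqueDiffOn ℝ D) {k : ℕ} (I : MultiIndex) {f : Spacetime → E}
    (hf : ContDiffOn ℝ (k + I.length : ℕ) f D) : ContDiffOn ℝ k (ZI D I f) D := by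
  induction I generalizing k with
  | nil => exact hf
  | cons ι I ih =>
    refine contDiffOn_Z1 hD (ih ?_) ι
    convert hf using 2
    simp only [List.length_cons]; ring

theorem ZI_clm (hD : UniqueDiffOn ℝ D) (l : E →L[ℝ] F) (I : MultiIndex) {f : Spacetime → E}
    (hf : ContDiffOn ℝ I.length f D) :
    Set.EqOn (ZI D I (fun y => l (f y))) (fun y => l (ZI D I f y)) D := by
  induction I with
  | nil => exact fun _ _ => rfl
  | cons ι I ih =>
    intro x hx
    have h1 : ContDiffOn ℝ I.length f D := hf.of_le (by simp)
    have h2 : ContDiffOn ℝ (1 : ℕ) (ZI D I f) D :=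
      contDiffOn_ZI hD I (hf.of_le (by simp [add_comm]))
    simp only [ZI]
    rw [fderivWithin_congr (ih h1) (ih h1 hx)]
    have h3 := l.hasFDerivAt.comp_hasFDerivWithinAt x
      ((h2.differentiableOn (by simp)) x hx).hasFDerivWithinAt
    have h4 := h3.fderivWithin (hD x hx)
    simp only [Function.comp_def] at h4
    rw [h4]
    rfl

theorem ZI_add (hD : UniqueDiffOn ℝ D) (I : MultiIndex) {f g : Spacetime → E}
    (hf : ContDiffOn ℝ I.length f D) (hg : ContDiffOn ℝ I.length g D) :
    Set.EqOn (ZI D I (fun y => f y + g y)) (fun y => ZI D I f y + ZI D I g y) D := by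
  intro x hx
  have h1 := ZI_clm hD (ContinuousLinearMap.fst ℝ E E) I (hf.prodMk hg) hx
  have h2 := ZI_clm hD (ContinuousLinearMap.snd ℝ E E) I (hf.prodMk hg) hx
  have h3 := ZI_clm hD (ContinuousLinearMap.fst ℝ E E + ContinuousLinearMap.snd ℝ E E) I
    (hf.prodMk hg) hx
  simp only [add_apply, ContinuousLinearMap.coe_fst',
    ContinuousLinearMap.coe_snd'] at h1 h2 h3
  exact h3.trans (by rw [← h1, ← h2])

theorem ZI_const (c : E) {I : MultiIndex} (hI : I ≠ []) (x : Spacetime) :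
    ZI D I (fun _ => c) x = 0 := by
  induction I generalizing x with
  | nil => exact absurd rfl hI
  | cons ι I ih =>
    simp only [ZI]
    by_cases h : I = []
    · subst h
      simp only [ZI]
      rw [fderivWithin_fun_const]; rfl
    · have : ZI D I (fun _ => c) = fun _ => 0 := funext fun y => ih h y
      rw [this, fderivWithin_fun_const]; rfl

theorem Z1_bilin (hD : UniqueDiffOn ℝ D) (b : E →L[ℝ] F →L[ℝ] G) (ι : VField)
    {f : Spacetime → E} {g : Spacetime → F} (hf : DifferentiableOn ℝ f D)
    (hg : DifferentiableOn ℝ g D) :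
    Set.EqOn (Z1 D ι (fun y => b (f y) (g y)))
      (fun y => b (Z1 D ι f y) (g y) + b (f y) (Z1 D ι g y)) D := by
  intro x hx
  simp only [Z1]
  rw [b.fderivWithin_of_bilinear (hf x hx) (hg x hx) (hD x hx)]
  simp [add_comm]

/-- The commutation relation `[Z, ∂_v] = -∂_{Av}`, `A` the linear part of the vector field. -/
theorem Z1_fderivWithin (hD : UniqueDiffOn ℝ D) (hD' : D ⊆ closure (interior D)) (ι : VField)
    {f : Spacetime → E} (hf : ContDiffOn ℝ 2 f D) (v : Spacetime) :
    Set.EqOn (Z1 D ι (fun y => fderivWithin ℝ f D y v))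
      (fun y => fderivWithin ℝ (Z1 D ι f) D y v - fderivWithin ℝ f D y (ι.lin v)) D := by
  intro x hx
  have h1 : DifferentiableWithinAt ℝ (fderivWithin ℝ f D) D x :=
    ((hf.fderivWithin hD (m := 1) (by norm_num)).differentiableOn (by simp)) x hx
  -- one-sided second derivatives at boundary points are symmetric because `D` lies in the
  -- closure of its interior
  have hs := (hf x hx).isSymmSndFDerivWithinAt (by simp) hD (hD' hx) hx
  have hZ : Z1 D ι f = fun y => fderivWithin ℝ f D y (ι.vec y) := rfl
  simp only [hZ]
  simp only [Z1]
  rw [fderivWithin_clm_apply (hD x hx) h1 (differentiableWithinAt_const v),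
    fderivWithin_clm_apply (hD x hx) h1
      (ι.hasFDerivAt_vec x).differentiableAt.differentiableWithinAt,
    (ι.hasFDerivAt_vec x).hasFDerivWithinAt.fderivWithin (hD x hx), fderivWithin_fun_const]
  simp [hs.eq (ι.vec x) v]

/-- The lower order terms of `Z^I ∂_v f = ∂_v Z^I f + ∑ ∂_{N v} Z^J f`: the list of the pairs
`(N, J)`. -/
def commTerms : MultiIndex → List ((Spacetime →L[ℝ] Spacetime) × MultiIndex)
  | [] => []
  | ι :: I => (-ι.lin, I) ::
      (commTerms I).flatMap fun p => [(p.1, ι :: p.2), (-(ι.lin ∘L p.1), p.2)]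

/-- The terms of order `|I| - 1` come from a single commutator, so there `N` is the linear part of
one of the vector fields. -/
theorem mem_commTerms {I : MultiIndex} {p} (hp : p ∈ commTerms I) :
    ((∃ ι : VField, p.1 = -ι.lin) ∧ p.2.length + 1 = I.length) ∨ p.2.length + 2 ≤ I.length := by
  induction I generalizing p with
  | nil => simp [commTerms] at hp
  | cons ι I ih =>
    simp only [commTerms, List.mem_cons, List.mem_flatMap, List.not_mem_nil, or_false] at hp
    rcases hp with rfl | ⟨q, hq, rfl | rfl⟩
    · exact Or.inl ⟨⟨ι, rfl⟩, rfl⟩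
    · rcases ih hq with ⟨h1, h2⟩ | h2
      · exact Or.inl ⟨h1, by simp [h2]⟩
      · exact Or.inr (by simp only [List.length_cons]; omega)
    · right
      rcases ih hq with ⟨h1, h2⟩ | h2 <;> simp only [List.length_cons] <;> omega

theorem commTerms_length_lt {I : MultiIndex} {p} (hp : p ∈ commTerms I) :
    p.2.length + 1 ≤ I.length := by
  rcases mem_commTerms hp with h | h <;> omega

/-- The exact expansion `Z^I ∂_v f = ∂_v Z^I f + ∑ ∂_{N v} Z^J f` over `commTerms I`. -/
theorem ZI_fderivWithin (hD : UniqueDiffOn ℝ D) (hD' : D ⊆ closure (interior D))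
    (I : MultiIndex) {f : Spacetime → E} (hf : ContDiffOn ℝ (I.length + 1 : ℕ) f D)
    (v : Spacetime) :
    Set.EqOn (ZI D I (fun y => fderivWithin ℝ f D y v))
      (fun y => fderivWithin ℝ (ZI D I f) D y v
        + ((commTerms I).map fun p => fderivWithin ℝ (ZI D p.2 f) D y (p.1 v)).sum) D := by
  induction I with
  | nil => intro x hx; simp [commTerms, ZI]
  | cons ι I ih =>
    intro x hx
    have hf' : ContDiffOn ℝ (I.length + 1 : ℕ) f D := hf.of_le (by simp)
    have key : ∀ (J : MultiIndex) (w : Spacetime), J.length ≤ I.length →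
        DifferentiableWithinAt ℝ (fun y => fderivWithin ℝ (ZI D J f) D y w) D x ∧
        Z1 D ι (fun y => fderivWithin ℝ (ZI D J f) D y w) x =
          fderivWithin ℝ (ZI D (ι :: J) f) D x w - fderivWithin ℝ (ZI D J f) D x (ι.lin w) := by
      intro J w hJ
      have h2 : ContDiffOn ℝ (2 : ℕ) (ZI D J f) D :=
        contDiffOn_ZI hD J (hf.of_le (by simp only [List.length_cons]; exact_mod_cast (by omega)))
      refine ⟨?_, Z1_fderivWithin hD hD' ι (by exact_mod_cast h2) w hx⟩
      exact (((h2.fderivWithin hD (m := 1) (by norm_num)).differentiableOn (by simp)) x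
        hx).clm_apply (differentiableWithinAt_const w)
    have hsum : ∀ l : List ((Spacetime →L[ℝ] Spacetime) × MultiIndex),
        (∀ p ∈ l, p.2.length ≤ I.length) →
        DifferentiableWithinAt ℝ
          (fun y => (l.map fun p => fderivWithin ℝ (ZI D p.2 f) D y (p.1 v)).sum) D x ∧
        Z1 D ι (fun y => (l.map fun p => fderivWithin ℝ (ZI D p.2 f) D y (p.1 v)).sum) x =
          ((l.flatMap fun p => [(p.1, ι :: p.2), (-(ι.lin ∘L p.1), p.2)]).map
            fun p => fderivWithin ℝ (ZI D p.2 f) D x (p.1 v)).sum := by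
      intro l
      induction l with
      | nil => intro _; simp [Z1, differentiableWithinAt_const]
      | cons p l ihl =>
        intro hl
        obtain ⟨h1, h2⟩ := ihl fun q hq => hl q (List.mem_cons_of_mem _ hq)
        obtain ⟨h3, h4⟩ := key p.2 (p.1 v) (hl p List.mem_cons_self)
        simp only [List.map_cons, List.sum_cons, List.flatMap_cons, List.map_append,
          List.sum_append]
        refine ⟨h3.add h1, ?_⟩
        simp only [Z1] at h2 h4 ⊢
        rw [fderivWithin_fun_add (hD x hx) h3 h1, add_apply, h2, h4]
        simp [sub_eq_add_neg]
    obtain ⟨h1, h2⟩ := key I v le_rfl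
    obtain ⟨h3, h4⟩ := hsum (commTerms I) fun p hp => by have := commTerms_length_lt hp; omega
    simp only [Z1] at h2 h4
    simp only [ZI]
    rw [fderivWithin_congr (ih hf') (ih hf' hx), fderivWithin_fun_add (hD x hx) h1 h3,
      add_apply, h2, h4]
    simp only [commTerms, List.map_cons, List.sum_cons, ZI, neg_apply, map_neg]
    abel

end calculus

section bounds

variable {E F G : Type*} [NormedAddCommGroup E] [NormedSpace ℝ E] [NormedAddCommGroup F]
  [NormedSpace ℝ F] [NormedAddCommGroup G] [NormedSpace ℝ G] {D : Set Spacetime}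

/-! ### Generating series of bounds -/

section series

variable {κ : Type*}

/-- `Below n a b`: the coefficients of the series `a i` up to degree `n` are bounded by those of
`b i`, up to a constant that does not depend on `i`. -/
def Below (n : ℕ) (a b : κ → ℝ≥0⟦X⟧) : Prop :=
  ∃ C : ℝ≥0, ∀ i, ∀ k ≤ n, PowerSeries.coeff k (a i) ≤ C * PowerSeries.coeff k (b i)

/-- The geometric series `∑ X^k`; multiplication by it turns the condition
`|J_1| + ⋯ + |J_l| = k` into `|J_1| + ⋯ + |J_l| ≤ k`. -/
def geom : κ → ℝ≥0⟦X⟧ := fun _ => PowerSeries.mk fun _ => 1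

/-- The monomial `X`, as a constant family. -/
def serX : κ → ℝ≥0⟦X⟧ := fun _ => PowerSeries.X

/-- The series with the first coefficient removed and the other ones shifted down. -/
def shift (a : ℝ≥0⟦X⟧) : ℝ≥0⟦X⟧ := PowerSeries.mk fun k => PowerSeries.coeff (k + 1) a

/-- The generating series `∑ φ(J) X^|J|` over the multi-indices of length at most `n`. Negative
values of `φ` are replaced by zero. -/
def ser (n : ℕ) (φ : MultiIndex → ℝ) : ℝ≥0⟦X⟧ :=
  ∑ J ∈ multiIndices n, PowerSeries.monomial J.length (φ J).toNNReal

variable {n : ℕ} {a a' b b' c : κ → ℝ≥0⟦X⟧}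

theorem coeff_mul_le_coeff_mul {a a' b b' : ℝ≥0⟦X⟧} {n : ℕ} {C C' : ℝ≥0}
    (h : ∀ k ≤ n, PowerSeries.coeff k a ≤ C * PowerSeries.coeff k a')
    (h' : ∀ k ≤ n, PowerSeries.coeff k b ≤ C' * PowerSeries.coeff k b') :
    ∀ k ≤ n, PowerSeries.coeff k (a * b) ≤ C * C' * PowerSeries.coeff k (a' * b') := by
  intro k hk
  rw [PowerSeries.coeff_mul, PowerSeries.coeff_mul, Finset.mul_sum]
  refine Finset.sum_le_sum fun p hp => ?_
  have hp' := Finset.HasAntidiagonal.mem_antidiagonal.mp hp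
  calc _ ≤ (C * PowerSeries.coeff p.1 a') * (C' * PowerSeries.coeff p.2 b') :=
        mul_le_mul' (h _ (by omega)) (h' _ (by omega))
    _ = _ := by ring

theorem Below.refl (a : κ → ℝ≥0⟦X⟧) : Below n a a := ⟨1, fun i k _ => by simp⟩

theorem Below.trans (h : Below n a b) (h' : Below n b c) : Below n a c := by
  obtain ⟨C, hC⟩ := h
  obtain ⟨C', hC'⟩ := h'
  refine ⟨C * C', fun i k hk => (hC i k hk).trans ?_⟩
  rw [mul_assoc]
  gcongr
  exact hC' i k hk

theorem Below.mul (h : Below n a a') (h' : Below n b b') : Below n (a * b) (a' * b') := by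
  obtain ⟨C, hC⟩ := h
  obtain ⟨C', hC'⟩ := h'
  exact ⟨C * C', fun i => coeff_mul_le_coeff_mul (hC i) (hC' i)⟩

theorem Below.mul_left (c : κ → ℝ≥0⟦X⟧) (h : Below n a b) : Below n (c * a) (c * b) :=
  (Below.refl c).mul h

theorem Below.add (h : Below n a c) (h' : Below n b c) : Below n (a + b) c := by
  obtain ⟨C, hC⟩ := h
  obtain ⟨C', hC'⟩ := h'
  refine ⟨C + C', fun i k hk => ?_⟩
  simp only [Pi.add_apply, map_add, add_mul]
  exact add_le_add (hC i k hk) (hC' i k hk)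

theorem Below.of_add_eq (c : κ → ℝ≥0⟦X⟧) (h : a + c = b) : Below n a b :=
  ⟨1, fun i k _ => by rw [← h]; simp⟩

theorem coeff_geom_mul (i : κ) (k : ℕ) :
    PowerSeries.coeff k ((geom * a : κ → ℝ≥0⟦X⟧) i) =
      ∑ j ∈ Finset.range (k + 1), PowerSeries.coeff j (a i) := by
  rw [mul_comm, Pi.mul_apply, PowerSeries.coeff_mul,
    Finset.Nat.sum_antidiagonal_eq_sum_range_succ_mk]
  simp [geom]

theorem coeff_le_coeff_geom_mul (i : κ) {j k : ℕ} (hjk : j ≤ k) :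
    PowerSeries.coeff j (a i) ≤ PowerSeries.coeff k ((geom * a : κ → ℝ≥0⟦X⟧) i) := by
  rw [coeff_geom_mul]
  exact Finset.single_le_sum (f := fun j => PowerSeries.coeff j (a i)) (fun _ _ => zero_le)
    (Finset.mem_range.mpr (by omega))

theorem below_geom_mul (a : κ → ℝ≥0⟦X⟧) : Below n a (geom * a) :=
  ⟨1, fun i k _ => by rw [one_mul]; exact coeff_le_coeff_geom_mul i le_rfl⟩

theorem below_one_geom : Below n (1 : κ → ℝ≥0⟦X⟧) geom := by
  simpa using below_geom_mul (n := n) (1 : κ → ℝ≥0⟦X⟧)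

theorem below_geom_sq : Below n (geom * geom : κ → ℝ≥0⟦X⟧) geom := by
  refine ⟨n + 1, fun i k hk => ?_⟩
  rw [coeff_geom_mul]
  simp only [geom, PowerSeries.coeff_mk, Finset.sum_const, Finset.card_range, mul_one,
    nsmul_eq_mul]
  exact_mod_cast Nat.succ_le_succ hk

theorem below_geom_pow (l : ℕ) : Below n (geom ^ l : κ → ℝ≥0⟦X⟧) geom := by
  induction l with
  | zero => simpa using below_one_geom
  | succ l ih =>
    rw [pow_succ]
    exact (ih.mul (Below.refl _)).trans below_geom_sq

/-- Powers of the geometric series are absorbed. -/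
theorem below_geom_pow_mul (l : ℕ) (a : κ → ℝ≥0⟦X⟧) : Below n (geom ^ l * a) (geom * a) :=
  (below_geom_pow l).mul (Below.refl a)

theorem coeff_X_mul_shift_le (a : ℝ≥0⟦X⟧) (k : ℕ) :
    PowerSeries.coeff k (PowerSeries.X * shift a) ≤ PowerSeries.coeff k a := by
  cases k with
  | zero => simp
  | succ k => rw [PowerSeries.coeff_succ_X_mul]; simp [shift]

theorem coeff_shift_mul_le (a b : ℝ≥0⟦X⟧) (k : ℕ) :
    PowerSeries.coeff k (shift a * b) ≤ PowerSeries.coeff (k + 1) (a * b) := by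
  rw [← PowerSeries.coeff_succ_X_mul, ← mul_assoc]
  simpa using coeff_mul_le_coeff_mul (n := k + 1) (C := 1) (C' := 1)
    (fun j _ => by simpa using coeff_X_mul_shift_le a j) (b := b) (b' := b)
    (fun j _ => by simp) (k + 1) le_rfl

theorem coeff_mul_shift_le (a b : ℝ≥0⟦X⟧) (k : ℕ) :
    PowerSeries.coeff k (a * shift b) ≤ PowerSeries.coeff (k + 1) (a * b) := by
  rw [mul_comm, mul_comm a]
  exact coeff_shift_mul_le b a k

theorem le_coeff_ser {φ : MultiIndex → ℝ} {J : MultiIndex} (hJ : J.length ≤ n) :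
    (φ J).toNNReal ≤ PowerSeries.coeff J.length (ser n φ) := by
  rw [ser, map_sum]
  refine le_trans ?_ (Finset.single_le_sum (fun _ _ => zero_le) (mem_multiIndices.mpr hJ))
  simp

theorem coeff_ser_le {φ : MultiIndex → ℝ} {C : ℝ≥0} (hφ : ∀ J, J.length ≤ n → φ J ≤ C) (k : ℕ) :
    PowerSeries.coeff k (ser n φ) ≤ (multiIndices n).card * C := by
  rw [ser, map_sum, ← nsmul_eq_mul]
  refine Finset.sum_le_card_nsmul _ _ _ fun J hJ => ?_
  rw [PowerSeries.coeff_monomial]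
  split_ifs
  · exact Real.toNNReal_le_iff_le_coe.mpr (hφ J (mem_multiIndices.mp hJ))
  · exact zero_le

theorem prod_ser (n : ℕ) {l : ℕ} (φ : Fin l → MultiIndex → ℝ) :
    ∏ j, ser n (φ j) = ∑ K ∈ Fintype.piFinset fun _ : Fin l => multiIndices n,
      PowerSeries.monomial (∑ j, (K j).length) (∏ j, (φ j (K j)).toNNReal) := by
  simp only [ser]
  rw [Finset.prod_univ_sum]
  refine Finset.sum_congr rfl fun K _ => ?_
  rw [PowerSeries.prod_monomial]

/-- The sums over tuples of multi-indices of prescribed total length are coefficients of products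
of generating series. -/
theorem coeff_prod_ser {l : ℕ} {φ : Fin l → MultiIndex → ℝ} (hφ : ∀ j J, 0 ≤ φ j J) :
    ((PowerSeries.coeff n (∏ j, ser n (φ j)) : ℝ≥0) : ℝ) =
      ∑ K ∈ tuplesEq l n, ∏ j, φ j (K j) := by
  rw [prod_ser, map_sum, tuplesEq, Finset.sum_filter, NNReal.coe_sum]
  refine Finset.sum_congr rfl fun K _ => ?_
  rw [PowerSeries.coeff_monomial]
  simp only [eq_comm (a := n)]
  split_ifs
  · rw [NNReal.coe_prod]
    exact Finset.prod_congr rfl fun j _ => Real.coe_toNNReal _ (hφ j _)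
  · rfl

theorem coeff_X_pow_mul_geom_mul_prod_ser (c : ℕ) {l : ℕ} {φ : Fin l → MultiIndex → ℝ}
    (hφ : ∀ j J, 0 ≤ φ j J) (i : κ) :
    ((PowerSeries.coeff n (PowerSeries.X ^ c * (geom i * ∏ j, ser n (φ j))) : ℝ≥0) : ℝ) =
      ∑ K ∈ tuplesLE l n c, ∏ j, φ j (K j) := by
  rw [PowerSeries.coeff_X_pow_mul', tuplesLE]
  by_cases hc : c ≤ n
  · rw [if_pos hc]
    have := coeff_geom_mul (a := fun _ : κ => ∏ j, ser n (φ j)) i (n - c)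
    rw [Pi.mul_apply] at this
    rw [this, prod_ser]
    simp only [map_sum]
    rw [Finset.sum_comm, Finset.sum_filter, NNReal.coe_sum]
    refine Finset.sum_congr rfl fun K _ => ?_
    simp only [PowerSeries.coeff_monomial, Finset.sum_ite_eq', Finset.mem_range]
    have h1 : ∑ j, (K j).length < n - c + 1 ↔ ∑ j, (K j).length + c ≤ n := by omega
    simp only [h1]
    split_ifs
    · rw [NNReal.coe_prod]
      exact Finset.prod_congr rfl fun j _ => Real.coe_toNNReal _ (hφ j _)
    · rfl
  · rw [if_neg hc, Finset.filter_false_of_mem (fun K _ => by omega)]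
    rfl

end series

/-! ### Uniform bounds of families of functions at a point -/

section majorants

/-- A family of domains, each with a point in it. A bound with a constant that does not depend on
the fields is a bound that is uniform over the family of all admissible fields and points. -/
structure PointFamily (κ : Type*) where
  dom : κ → Set Spacetime
  pt : κ → Spacetime
  uniqueDiff : ∀ i, UniqueDiffOn ℝ (dom i)
  subset_closure : ∀ i, dom i ⊆ closure (interior (dom i))
  mem : ∀ i, pt i ∈ dom i

variable {κ : Type*} {P : PointFamily κ} {n : ℕ} {a b c : κ → ℝ≥0⟦X⟧}

/-- `Maj P n f a`: the functions `f i` are of class `C^n`, and `|Z^J f i|` at the point of the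
family is bounded by the coefficient of `X^|J|` in `a i`, up to a constant that depends neither
on `i` nor on `J`, for `|J| ≤ n`. -/
def Maj (P : PointFamily κ) (n : ℕ) (f : κ → Spacetime → E) (a : κ → ℝ≥0⟦X⟧) : Prop :=
  (∀ i, ContDiffOn ℝ n (f i) (P.dom i)) ∧ ∃ C : ℝ≥0, ∀ i (J : MultiIndex), J.length ≤ n →
    ‖ZI (P.dom i) J (f i) (P.pt i)‖₊ ≤ C * PowerSeries.coeff J.length (a i)

/-- `DMaj P n f a`: as `Maj`, for the first derivatives `∂ Z^J f i` of functions of class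
`C^{n+1}`. -/
def DMaj (P : PointFamily κ) (n : ℕ) (f : κ → Spacetime → E) (a : κ → ℝ≥0⟦X⟧) : Prop :=
  (∀ i, ContDiffOn ℝ (n + 1 : ℕ) (f i) (P.dom i)) ∧ ∃ C : ℝ≥0, ∀ i (J : MultiIndex),
    J.length ≤ n → ∀ γ, ‖fderivWithin ℝ (ZI (P.dom i) J (f i)) (P.dom i) (P.pt i) (e γ)‖₊ ≤
      C * PowerSeries.coeff J.length (a i)

theorem Maj.mono {f : κ → Spacetime → E} (h : Maj P n f a) (hab : Below n a b) : Maj P n f b := by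
  obtain ⟨h1, C, hC⟩ := h
  obtain ⟨C', hC'⟩ := hab
  refine ⟨h1, C * C', fun i J hJ => (hC i J hJ).trans ?_⟩
  rw [mul_assoc]
  gcongr
  exact hC' i _ hJ

theorem Maj.of_le {m : ℕ} {f : κ → Spacetime → E} (hm : m ≤ n) (h : Maj P n f a) :
    Maj P m f a := by
  obtain ⟨h1, C, hC⟩ := h
  exact ⟨fun i => (h1 i).of_le (by exact_mod_cast hm), C, fun i J hJ => hC i J (hJ.trans hm)⟩

theorem Maj.congr {f g : κ → Spacetime → E} (h : Maj P n f a)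
    (hfg : ∀ i, Set.EqOn (g i) (f i) (P.dom i)) : Maj P n g a := by
  obtain ⟨h1, C, hC⟩ := h
  refine ⟨fun i => (h1 i).congr (hfg i), C, fun i J hJ => ?_⟩
  rw [ZI_congr (hfg i) J (P.mem i)]
  exact hC i J hJ

theorem Maj.clm {f : κ → Spacetime → E} (h : Maj P n f a) {l : κ → E →L[ℝ] F}
    (hl : ∃ C : ℝ≥0, ∀ i, ‖l i‖₊ ≤ C) : Maj P n (fun i y => l i (f i y)) a := by
  obtain ⟨h1, C, hC⟩ := h
  obtain ⟨C', hC'⟩ := hl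
  refine ⟨fun i => (l i).contDiff.comp_contDiffOn (h1 i), C' * C, fun i J hJ => ?_⟩
  rw [ZI_clm (P.uniqueDiff i) (l i) J ((h1 i).of_le (by exact_mod_cast hJ)) (P.mem i), mul_assoc]
  exact ((l i).le_opNNNorm _).trans (mul_le_mul' (hC' i) (hC i J hJ))

theorem Maj.add {f g : κ → Spacetime → E} (h : Maj P n f a) (h' : Maj P n g a) :
    Maj P n (fun i y => f i y + g i y) a := by
  obtain ⟨h1, C, hC⟩ := h
  obtain ⟨h1', C', hC'⟩ := h'
  refine ⟨fun i => (h1 i).add (h1' i), C + C', fun i J hJ => ?_⟩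
  rw [ZI_add (P.uniqueDiff i) J ((h1 i).of_le (by exact_mod_cast hJ))
    ((h1' i).of_le (by exact_mod_cast hJ)) (P.mem i), add_mul]
  exact (nnnorm_add_le _ _).trans (add_le_add (hC i J hJ) (hC' i J hJ))

theorem Maj.neg {f : κ → Spacetime → E} (h : Maj P n f a) : Maj P n (fun i y => -f i y) a :=
  h.clm (l := fun _ => -ContinuousLinearMap.id ℝ E) ⟨_, fun _ => le_rfl⟩

theorem Maj.sub {f g : κ → Spacetime → E} (h : Maj P n f a) (h' : Maj P n g a) :
    Maj P n (fun i y => f i y - g i y) a := by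
  simpa only [sub_eq_add_neg] using h.add h'.neg

theorem Maj.const_smul {f : κ → Spacetime → E} (h : Maj P n f a) (r : ℝ) :
    Maj P n (fun i y => r • f i y) a :=
  h.clm (l := fun _ => r • ContinuousLinearMap.id ℝ E) ⟨_, fun _ => le_rfl⟩

theorem Maj.const_mul {f : κ → Spacetime → ℝ} (h : Maj P n f a) (r : ℝ) :
    Maj P n (fun i y => r * f i y) a :=
  h.const_smul r

theorem Maj.const (c : E) : Maj P n (fun _ _ => c) 1 := by
  refine ⟨fun i => contDiffOn_const, ‖c‖₊, fun i J _ => ?_⟩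
  by_cases hJ : J = []
  · subst hJ; simp [ZI]
  · rw [ZI_const c hJ]; simp

theorem Maj.sum {σ : Type*} (s : Finset σ) {f : σ → κ → Spacetime → E}
    (h : ∀ j ∈ s, Maj P n (f j) a) : Maj P n (fun i y => ∑ j ∈ s, f j i y) a := by
  classical
  induction s using Finset.induction_on with
  | empty =>
    have := (Maj.const (P := P) (n := n) (0 : E)).1
    refine ⟨by simpa using this, 0, fun i J _ => ?_⟩
    simp only [Finset.sum_empty]
    by_cases hJ : J = []
    · subst hJ; simp [ZI]
    · rw [ZI_const 0 hJ]; simp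
  | insert j s hj ih =>
    simp only [Finset.sum_insert hj]
    exact (h j (Finset.mem_insert_self j s)).add
      (ih fun i hi => h i (Finset.mem_insert_of_mem hi))

/-- The product rule at a point, in terms of generating series. -/
theorem nnnorm_ZI_bilin_le (hD : UniqueDiffOn ℝ D) {x : Spacetime} (hx : x ∈ D)
    (B : E →L[ℝ] F →L[ℝ] G) (I : MultiIndex) {f : Spacetime → E} {g : Spacetime → F}
    (hf : ContDiffOn ℝ I.length f D) (hg : ContDiffOn ℝ I.length g D) {a b : ℝ≥0⟦X⟧}
    (ha : ∀ J : MultiIndex, J.length ≤ I.length →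
      ‖ZI D J f x‖₊ ≤ PowerSeries.coeff J.length a)
    (hb : ∀ J : MultiIndex, J.length ≤ I.length →
      ‖ZI D J g x‖₊ ≤ PowerSeries.coeff J.length b) :
    ‖ZI D I (fun y => B (f y) (g y)) x‖₊ ≤
      2 ^ I.length * ‖B‖₊ * PowerSeries.coeff I.length (a * b) := by
  induction I using List.reverseRecOn generalizing f g a b with
  | nil =>
    have h1 := ha [] le_rfl
    have h2 := hb [] le_rfl
    simp only [ZI, List.length_nil, pow_zero, one_mul] at h1 h2 ⊢
    rw [PowerSeries.coeff_mul, Finset.Nat.antidiagonal_zero, Finset.sum_singleton, ← mul_assoc]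
    exact ((B.le_opNorm₂ (f x) (g x) : ‖_‖₊ ≤ ‖B‖₊ * ‖f x‖₊ * ‖g x‖₊)).trans
      (mul_le_mul' (mul_le_mul' le_rfl h1) h2)
  | append_singleton I ι ih =>
    simp only [List.length_append, List.length_singleton] at hf hg ha hb ⊢
    have hf1 : ContDiffOn ℝ I.length f D := hf.of_le (by simp)
    have hg1 : ContDiffOn ℝ I.length g D := hg.of_le (by simp)
    have hf2 := contDiffOn_Z1 hD hf ι
    have hg2 := contDiffOn_Z1 hD hg ι
    rw [ZI_append_singleton, ZI_congr (Z1_bilin hD B ι (hf.differentiableOn (by simp))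
      (hg.differentiableOn (by simp))) I hx, ZI_add hD I
      (f := fun y => B (Z1 D ι f y) (g y)) (g := fun y => B (f y) (Z1 D ι g y))
      (B.isBoundedBilinearMap.contDiff.comp_contDiffOn (hf2.prodMk hg1))
      (B.isBoundedBilinearMap.contDiff.comp_contDiffOn (hf1.prodMk hg2)) hx]
    have h1 := ih hf2 hg1 (a := shift a) (b := b)
      (fun J hJ => by
        rw [← ZI_append_singleton]
        simpa [shift] using ha (J ++ [ι]) (by simpa using hJ))
      (fun J hJ => hb J (by omega))
    have h2 := ih hf1 hg2 (a := a) (b := shift b) (fun J hJ => ha J (by omega))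
      (fun J hJ => by
        rw [← ZI_append_singleton]
        simpa [shift] using hb (J ++ [ι]) (by simpa using hJ))
    calc _ ≤ _ := nnnorm_add_le _ _
      _ ≤ _ := add_le_add h1 h2
      _ ≤ 2 ^ I.length * ‖B‖₊ * PowerSeries.coeff (I.length + 1) (a * b) +
          2 ^ I.length * ‖B‖₊ * PowerSeries.coeff (I.length + 1) (a * b) := by
        gcongr
        · exact coeff_shift_mul_le _ _ _
        · exact coeff_mul_shift_le _ _ _
      _ = _ := by ring

theorem Maj.bilin (B : E →L[ℝ] F →L[ℝ] G) {f : κ → Spacetime → E} {g : κ → Spacetime → F}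
    (hf : Maj P n f a) (hg : Maj P n g b) :
    Maj P n (fun i y => B (f i y) (g i y)) (a * b) := by
  obtain ⟨h1, C, hC⟩ := hf
  obtain ⟨h1', C', hC'⟩ := hg
  refine ⟨fun i => B.isBoundedBilinearMap.contDiff.comp_contDiffOn ((h1 i).prodMk (h1' i)),
    2 ^ n * ‖B‖₊ * (C * C'), fun i J hJ => ?_⟩
  have h2 := nnnorm_ZI_bilin_le (P.uniqueDiff i) (P.mem i) B J
    ((h1 i).of_le (by exact_mod_cast hJ)) ((h1' i).of_le (by exact_mod_cast hJ))
    (a := PowerSeries.C C * a i) (b := PowerSeries.C C' * b i)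
    (fun K hK => by simpa using hC i K (hK.trans hJ))
    (fun K hK => by simpa using hC' i K (hK.trans hJ))
  refine h2.trans ?_
  have h3 : PowerSeries.C C * a i * (PowerSeries.C C' * b i)
      = PowerSeries.C (C * C') * (a i * b i) := by rw [map_mul]; ring
  rw [h3, PowerSeries.coeff_C_mul, ← mul_assoc]
  simp only [Pi.mul_apply]
  gcongr
  · exact one_le_two

theorem Maj.mul {f g : κ → Spacetime → ℝ} (hf : Maj P n f a) (hg : Maj P n g b) :
    Maj P n (fun i y => f i y * g i y) (a * b) :=
  Maj.bilin (ContinuousLinearMap.mul ℝ ℝ) hf hg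

theorem Maj.smul {f : κ → Spacetime → ℝ} {g : κ → Spacetime → E} (hf : Maj P n f a)
    (hg : Maj P n g b) : Maj P n (fun i y => f i y • g i y) (a * b) :=
  Maj.bilin (ContinuousLinearMap.lsmul ℝ ℝ) hf hg

/-- Multiplication by bounded constants. -/
theorem Maj.family_mul {f : κ → Spacetime → ℝ} (hf : Maj P n f a) {r : κ → ℝ}
    (hr : ∃ C : ℝ≥0, ∀ i, ‖r i‖₊ ≤ C) : Maj P n (fun i y => r i * f i y) a := by
  obtain ⟨C, hC⟩ := hr
  refine hf.clm (l := fun i => r i • ContinuousLinearMap.id ℝ ℝ) ⟨C, fun i => ?_⟩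
  rw [nnnorm_smul]
  calc ‖r i‖₊ * ‖ContinuousLinearMap.id ℝ ℝ‖₊ ≤ C * 1 :=
        mul_le_mul' (hC i) ContinuousLinearMap.norm_id_le
    _ = C := mul_one C

/-- Bounds of order `n + 1` follow from bounds of order `n` of the derivatives along the vector
fields; the factor `X` accounts for the additional vector field. -/
theorem Maj.succ {f : κ → Spacetime → E} (hf : ∀ i, ContDiffOn ℝ (n + 1 : ℕ) (f i) (P.dom i))
    (h0 : ∃ C : ℝ≥0, ∀ i, ‖f i (P.pt i)‖₊ ≤ C * PowerSeries.coeff 0 (a i))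
    (h : ∀ ι : VField, ∃ b, Maj P n (fun i => Z1 (P.dom i) ι (f i)) b ∧
      Below (n + 1) (serX * b) a) : Maj P (n + 1) f a := by
  obtain ⟨C0, h0⟩ := h0
  choose b hb using h
  choose hb1 C hC using fun ι => (hb ι).1
  choose C' hC' using fun ι => (hb ι).2
  refine ⟨hf, C0 + ∑ ι, C ι * C' ι, fun i J hJ => ?_⟩
  rcases List.eq_nil_or_concat J with rfl | ⟨K, ι, rfl⟩
  · refine (h0 i).trans ?_
    rw [add_mul]
    exact le_self_add
  · simp only [List.concat_eq_append, List.length_append, List.length_singleton] at hJ ⊢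
    have h1 := hC ι i K (by omega)
    have h2 := hC' ι i (K.length + 1) hJ
    rw [ZI_append_singleton]
    have h3 : PowerSeries.coeff (K.length + 1) ((serX * b ι : κ → ℝ≥0⟦X⟧) i) =
        PowerSeries.coeff K.length (b ι i) := by
      simp [serX, PowerSeries.coeff_succ_X_mul]
    rw [h3] at h2
    refine h1.trans ((mul_le_mul_right h2 (C ι)).trans ?_)
    rw [← mul_assoc]
    gcongr
    exact (Finset.single_le_sum (f := fun ι => C ι * C' ι) (fun _ _ => zero_le)
      (Finset.mem_univ ι)).trans le_add_self

theorem abs_apply_le_norm (v : Spacetime) (γ : Fin 4) : ‖v γ‖₊ ≤ ‖v‖₊ :=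
  PiLp.norm_apply_le v γ

theorem sum_smul_e (v : Spacetime) : ∑ γ, v γ • e γ = v := by
  ext i
  simp [e, Pi.single_apply]

theorem nnnorm_clm_apply_le {l : Spacetime →L[ℝ] E} {C : ℝ≥0} (hl : ∀ γ, ‖l (e γ)‖₊ ≤ C)
    (v : Spacetime) : ‖l v‖₊ ≤ 4 * ‖v‖₊ * C := by
  conv_lhs => rw [← sum_smul_e v, map_sum]
  refine (nnnorm_sum_le _ _).trans ((Finset.sum_le_card_nsmul _ _ (‖v‖₊ * C) fun γ _ => ?_).trans
    (le_of_eq ?_))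
  · rw [map_smul, nnnorm_smul]
    exact mul_le_mul' (abs_apply_le_norm v γ) (hl γ)
  · simp [mul_assoc]

/-- Commuting `Z^J` with a derivative in a constant direction only produces terms of lower
order. -/
theorem DMaj.maj {f : κ → Spacetime → E} (h : DMaj P n f b) {v : κ → Spacetime}
    (hv : ∃ C : ℝ≥0, ∀ i, ‖v i‖₊ ≤ C) :
    Maj P n (fun i y => fderivWithin ℝ (f i) (P.dom i) y (v i)) (geom * b) := by
  obtain ⟨h1, C, hC⟩ := h
  obtain ⟨M, hM⟩ := hv
  refine ⟨fun i => ((h1 i).fderivWithin (P.uniqueDiff i) (by push_cast; rfl)).clm_apply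
    contDiffOn_const, ∑ J ∈ multiIndices n,
      (4 * M * C + ((commTerms J).map fun p => 4 * (‖p.1‖₊ * M) * C).sum), fun i J hJ => ?_⟩
  rw [ZI_fderivWithin (P.uniqueDiff i) (P.subset_closure i) J
    ((h1 i).of_le (by exact_mod_cast Nat.succ_le_succ hJ)) (v i) (P.mem i)]
  have h2 : ∀ K : MultiIndex, K.length ≤ J.length → ∀ (w : Spacetime) (m : ℝ≥0), ‖w‖₊ ≤ m →
      ‖fderivWithin ℝ (ZI (P.dom i) K (f i)) (P.dom i) (P.pt i) w‖₊ ≤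
        4 * m * C * PowerSeries.coeff J.length ((geom * b : κ → ℝ≥0⟦X⟧) i) := by
    intro K hK w m hw
    refine (nnnorm_clm_apply_le (hC i K (hK.trans hJ)) w).trans ?_
    rw [← mul_assoc]
    gcongr
    exact coeff_le_coeff_geom_mul i hK
  refine (nnnorm_add_le _ _).trans ?_
  have h3 : ∀ l : List ((Spacetime →L[ℝ] Spacetime) × MultiIndex),
      (∀ p ∈ l, p.2.length ≤ J.length) →
      ‖(l.map fun p => fderivWithin ℝ (ZI (P.dom i) p.2 (f i)) (P.dom i) (P.pt i)
        (p.1 (v i))).sum‖₊ ≤ (l.map fun p => 4 * (‖p.1‖₊ * M) * C).sum *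
          PowerSeries.coeff J.length ((geom * b : κ → ℝ≥0⟦X⟧) i) := by
    intro l
    induction l with
    | nil => simp
    | cons p l ih =>
      intro hl
      simp only [List.map_cons, List.sum_cons, add_mul]
      refine (nnnorm_add_le _ _).trans (add_le_add ?_
        (ih fun q hq => hl q (List.mem_cons_of_mem _ hq)))
      exact h2 p.2 (hl p List.mem_cons_self) _ _
        ((p.1.le_opNNNorm _).trans (mul_le_mul' le_rfl (hM i)))
  refine (add_le_add (h2 J le_rfl _ _ (hM i)) (h3 (commTerms J) fun p hp => by
    have := commTerms_length_lt hp; omega)).trans ?_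
  rw [← add_mul]
  gcongr
  exact Finset.single_le_sum (f := fun J => (4 * M * C
    + ((commTerms J).map fun p => 4 * (‖p.1‖₊ * M) * C).sum)) (fun _ _ => zero_le)
    (mem_multiIndices.mpr hJ)

theorem DMaj.pd {f : κ → Spacetime → E} (h : DMaj P n f b) (γ : Fin 4) :
    Maj P n (fun i => pd (P.dom i) γ (f i)) (geom * b) :=
  h.maj (v := fun _ => e γ) ⟨_, fun _ => le_rfl⟩

end majorants

end bounds

/-! ### The bilinear operations of the system and equivalence of norms on `𝔰𝔲(2)` -/

instance : FiniteDimensional ℝ su2 :=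
  FiniteDimensional.of_injective su2.toSubmodule.subtype Subtype.val_injective

/-- The bracket of `𝔰𝔲(2)` as a continuous bilinear map. -/
def lieCLM : su2 →L[ℝ] su2 →L[ℝ] su2 :=
  (LinearMap.mk₂ ℝ (fun a b : su2 => ⁅a, b⁆) add_lie smul_lie lie_add
    (fun c a b => lie_smul c a b)).toContinuousBilinearMap

/-- The invariant inner product as a continuous bilinear map. -/
def InvariantInner.clm (B : InvariantInner) : su2 →L[ℝ] su2 →L[ℝ] ℝ :=
  B.ip.toContinuousBilinearMap

theorem InvariantInner.clm_apply (B : InvariantInner) (a b : su2) : B.clm a b = B.ip a b := rfl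

theorem coordT_add (a b : su2) (j : Fin 3) : coordT (a + b) j = coordT a j + coordT b j := by
  fin_cases j <;> simp [coordT] <;> ring

theorem coordT_smul (c : ℝ) (a : su2) (j : Fin 3) : coordT (c • a) j = c * coordT a j := by
  fin_cases j <;> simp [coordT] <;> ring

theorem act_add (M : Matrix (Fin 2) (Fin 2) ℂ) (v w : Doublet) :
    act M (v + w) = act M v + act M w := by
  rw [act, WithLp.ofLp_add, Matrix.mulVec_add, WithLp.toLp_add]; rfl

theorem act_smul (M : Matrix (Fin 2) (Fin 2) ℂ) (c : ℝ) (v : Doublet) :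
    act M (c • v) = c • act M v := by
  rw [act, WithLp.ofLp_smul, Matrix.mulVec_smul, WithLp.toLp_smul]; rfl

/-- The action of a matrix on doublets as a continuous linear map. -/
def actCLM (M : Matrix (Fin 2) (Fin 2) ℂ) : Doublet →L[ℝ] Doublet :=
  LinearMap.toContinuousLinearMap
    { toFun := act M, map_add' := act_add M, map_smul' := act_smul M }

/-- Multiplication by a complex number as a continuous real linear map. -/
def smulCLM (z : ℂ) : Doublet →L[ℝ] Doublet :=
  LinearMap.toContinuousLinearMap
    { toFun := fun v => z • v, map_add' := smul_add z, map_smul' := fun c v => smul_comm z c v }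

/-- `(A, Φ) ↦ A^I σ_I Φ` as a continuous real bilinear map. -/
def sigmaCLM : su2 →L[ℝ] Doublet →L[ℝ] Doublet :=
  (LinearMap.mk₂ ℝ sigmaAct
    (fun a b v => by
      simp only [sigmaAct, coordT_add, Complex.ofReal_add, add_smul, Finset.sum_add_distrib])
    (fun c a v => by
      simp only [sigmaAct, coordT_smul, Complex.ofReal_mul, mul_smul, Finset.smul_sum,
        Complex.coe_smul])
    (fun a v w => by simp only [sigmaAct, act_add, smul_add, Finset.sum_add_distrib])
    (fun c a v => by
      simp only [sigmaAct, act_smul, Finset.smul_sum]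
      exact Finset.sum_congr rfl fun j _ => smul_comm _ _ _)).toContinuousBilinearMap

/-- `(Φ, Ψ) ↦ Re Φ†Ψ` as a continuous real bilinear map. -/
def reInnerCLM : Doublet →L[ℝ] Doublet →L[ℝ] ℝ :=
  (LinearMap.mk₂ ℝ (fun v w : Doublet => (inner ℂ v w).re)
    (fun a b v => by simp)
    (fun c a v => by
      rw [← Complex.coe_smul, inner_smul_left]; simp)
    (fun a v w => by simp)
    (fun c a v => by
      rw [← Complex.coe_smul, inner_smul_right]; simp)).toContinuousBilinearMap

theorem InvariantInner.nonneg (B : InvariantInner) (f : su2) : 0 ≤ B.ip f f := by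
  by_cases hf : f = 0
  · simp [hf]
  · exact (B.pos f hf).le

theorem InvariantInner.exists_sqrt_le (B : InvariantInner) :
    ∃ C : ℝ, 0 < C ∧ ∀ f : su2, Real.sqrt (B.ip f f) ≤ C * ‖f‖ := by
  refine ⟨Real.sqrt ‖B.clm‖ + 1, by positivity, fun f => ?_⟩
  rw [Real.sqrt_le_left (by positivity)]
  have h1 := (le_abs_self _).trans (B.clm.le_opNorm₂ f f)
  have h2 := Real.sq_sqrt (norm_nonneg B.clm)
  rw [B.clm_apply] at h1
  nlinarith [Real.sqrt_nonneg ‖B.clm‖, norm_nonneg f,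
    mul_nonneg (Real.sqrt_nonneg ‖B.clm‖) (sq_nonneg ‖f‖), sq_nonneg ‖f‖]

/-- On the finite-dimensional space `𝔰𝔲(2)` the norm of the inner product dominates the chosen
norm. -/
theorem InvariantInner.exists_norm_le (B : InvariantInner) :
    ∃ C : ℝ, 0 < C ∧ ∀ f : su2, ‖f‖ ≤ C * Real.sqrt (B.ip f f) := by
  have hc : ContinuousOn (fun f : su2 => B.clm f f) (Metric.sphere 0 1) := by fun_prop
  obtain hne | hne := (Metric.sphere (0 : su2) 1).eq_empty_or_nonempty
  · refine ⟨1, one_pos, fun f => ?_⟩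
    by_cases hf : f = 0
    · simp [hf]
    · have : ‖f‖⁻¹ • f ∈ Metric.sphere (0 : su2) 1 := by
        simp [norm_smul, hf]
      rw [hne] at this
      exact this.elim
  · obtain ⟨f0, hf0, hmin⟩ := (isCompact_sphere (0 : su2) 1).exists_isMinOn hne hc
    have hpos : 0 < B.ip f0 f0 := B.pos f0 fun h => by simp [h] at hf0
    refine ⟨(Real.sqrt (B.ip f0 f0))⁻¹, by positivity, fun f => ?_⟩
    rw [inv_mul_eq_div, le_div_iff₀ (Real.sqrt_pos.mpr hpos)]
    by_cases hf : f = 0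
    · simp [hf]
    · have h1 : ‖f‖⁻¹ • f ∈ Metric.sphere (0 : su2) 1 := by simp [norm_smul, hf]
      have h2 : B.ip f0 f0 ≤ B.ip (‖f‖⁻¹ • f) (‖f‖⁻¹ • f) := hmin h1
      simp only [map_smul, LinearMap.smul_apply, smul_eq_mul] at h2
      have h3 : 0 < ‖f‖ := norm_pos_iff.mpr hf
      apply Real.le_sqrt_of_sq_le
      rw [mul_pow, Real.sq_sqrt hpos.le]
      calc ‖f‖ ^ 2 * B.ip f0 f0 ≤ ‖f‖ ^ 2 * (‖f‖⁻¹ * (‖f‖⁻¹ * B.ip f f)) := by gcongr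
        _ = B.ip f f := by field_simp

/-! ### The inverse metric -/

section metric

variable {κ : Type*} {P : PointFamily κ} {n : ℕ} {h : κ → Fin 4 → Fin 4 → Spacetime → ℝ}
  {H : κ → ℝ≥0⟦X⟧}

theorem IsLorentzian.isUnit_det {g : Matrix (Fin 4) (Fin 4) ℝ} (hg : IsLorentzian g) :
    IsUnit g.det := by
  obtain ⟨Q, hQ, rfl⟩ := hg
  rw [Matrix.det_mul, Matrix.det_mul, Matrix.det_transpose]
  have : IsUnit mink.det := by
    rw [← Matrix.isUnit_iff_isUnit_det]
    exact IsUnit.of_mul_eq_one _ mink_mul_mink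
  exact (hQ.mul this).mul hQ

theorem mink_transpose : minkᵀ = mink := by rw [mink, Matrix.diagonal_transpose]

theorem IsLorentzian.transpose_eq {g : Matrix (Fin 4) (Fin 4) ℝ} (hg : IsLorentzian g) :
    gᵀ = g := by
  obtain ⟨Q, -, rfl⟩ := hg
  simp only [Matrix.transpose_mul, Matrix.transpose_transpose, mink_transpose, Matrix.mul_assoc]

theorem mink_symm (μ ν : Fin 4) : mink μ ν = mink ν μ :=
  congrFun (congrFun mink_transpose ν) μ

theorem IsLorentzian.symm {k : Fin 4 → Fin 4 → Spacetime → ℝ} {x : Spacetime}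
    (hg : IsLorentzian (gMat k x)) (μ ν : Fin 4) : k μ ν x = k ν μ x := by
  have h1 := congrFun (congrFun hg.transpose_eq ν) μ
  simp only [Matrix.transpose_apply, gMat, Matrix.of_apply, mink_symm μ ν] at h1
  linarith

theorem mUp_eq (α β : Fin 4) : mUp α β = mink α β := by rw [mUp, mink_inv]

variable {D : Set Spacetime}

theorem contDiffOn_det {m : ℕ} {M : Spacetime → Matrix (Fin 4) (Fin 4) ℝ}
    (hM : ∀ α β, ContDiffOn ℝ m (fun y => M y α β) D) :
    ContDiffOn ℝ m (fun y => (M y).det) D := by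
  simp only [Matrix.det_apply]
  exact ContDiffOn.sum fun σ _ => (contDiffOn_prod fun j _ => hM _ _).const_smul _

theorem contDiffOn_gUp {m : ℕ} {k : Fin 4 → Fin 4 → Spacetime → ℝ}
    (hk : ∀ α β, ContDiffOn ℝ m (k α β) D) (hdet : ∀ y ∈ D, IsUnit (gMat k y).det)
    (α β : Fin 4) : ContDiffOn ℝ m (fun y => gUp k y α β) D := by
  have hM : ∀ α β, ContDiffOn ℝ m (fun y => gMat k y α β) D := fun α β => by
    simp only [gMat, Matrix.of_apply]
    exact contDiffOn_const.add (hk α β)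
  have h1 : (fun y => gUp k y α β) = fun y => ((gMat k y).det)⁻¹ * (gMat k y).adjugate α β := by
    funext y
    simp [gUp, Matrix.inv_def]
  rw [h1]
  refine ((contDiffOn_det hM).inv fun y hy => (hdet y hy).ne_zero).mul ?_
  simp only [Matrix.adjugate_apply]
  refine contDiffOn_det fun γ δ => ?_
  by_cases hγ : γ = β
  · subst hγ
    simp only [Matrix.updateRow_self]
    exact contDiffOn_const
  · simp only [Matrix.updateRow_ne hγ]
    exact hM γ δ

/-- The derivative of the inverse metric is `-g⁻¹ (∂g) g⁻¹`. -/
theorem Z1_gUp (hD : UniqueDiffOn ℝ D) {k : Fin 4 → Fin 4 → Spacetime → ℝ}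
    (hk : ∀ α β, ContDiffOn ℝ (1 : ℕ) (k α β) D) (hdet : ∀ y ∈ D, IsUnit (gMat k y).det)
    (ι : VField) (α β : Fin 4) :
    Set.EqOn (Z1 D ι fun y => gUp k y α β)
      (fun y => -∑ γ, ∑ δ, gUp k y α γ * Z1 D ι (k γ δ) y * gUp k y δ β) D := by
  intro x hx
  have hkd : ∀ α β, DifferentiableWithinAt ℝ (k α β) D x := fun α β =>
    (hk α β).differentiableOn (by simp) x hx
  have hgd : ∀ α β, DifferentiableWithinAt ℝ (fun y => gUp k y α β) D x := fun α β =>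
    (contDiffOn_gUp hk hdet α β).differentiableOn (by simp) x hx
  have hMd : ∀ α β, DifferentiableWithinAt ℝ (fun y => gMat k y α β) D x := fun α β => by
    simp only [gMat, Matrix.of_apply]
    exact (differentiableWithinAt_const _).add (hkd α β)
  have hM : ∀ α β, fderivWithin ℝ (fun y => gMat k y α β) D x = fderivWithin ℝ (k α β) D x := by
    intro α β
    simp only [gMat, Matrix.of_apply]
    rw [fderivWithin_const_add]
  let v := ι.vec x
  let dG : Matrix (Fin 4) (Fin 4) ℝ := Matrix.of fun γ δ => fderivWithin ℝ (k γ δ) D x v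
  let dU : Matrix (Fin 4) (Fin 4) ℝ :=
    Matrix.of fun γ δ => fderivWithin ℝ (fun y => gUp k y γ δ) D x v
  have hprod : dG * (gMat k x)⁻¹ + gMat k x * dU = 0 := by
    ext γ δ
    have h1 : Set.EqOn (fun y => ∑ ε, gMat k y γ ε * gUp k y ε δ)
        (fun _ => (1 : Matrix (Fin 4) (Fin 4) ℝ) γ δ) D := by
      intro y hy
      rw [← Matrix.mul_nonsing_inv _ (hdet y hy), Matrix.mul_apply]
      rfl
    have h2 := fderivWithin_congr (𝕜 := ℝ) h1 (h1 hx)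
    rw [fderivWithin_fun_const,
      fderivWithin_fun_sum (hD x hx) fun ε _ => (hMd γ ε).fun_mul (hgd ε δ)] at h2
    have h3 := congrArg (fun l => l v) h2
    simp only [fderivWithin_fun_mul (hD x hx) (hMd γ _) (hgd _ δ), hM,
      sum_apply, add_apply,
      smul_apply, smul_eq_mul] at h3
    rw [Matrix.add_apply, Matrix.mul_apply, Matrix.mul_apply, ← Finset.sum_add_distrib]
    refine Eq.trans (Finset.sum_congr rfl fun ε _ => ?_) h3
    simp only [dG, dU, Matrix.of_apply, gUp]
    ring
  have hU : dU = -((gMat k x)⁻¹ * dG * (gMat k x)⁻¹) := by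
    have h1 : (gMat k x)⁻¹ * (gMat k x * dU) = dU := by
      rw [← Matrix.mul_assoc, Matrix.nonsing_inv_mul _ (hdet x hx), Matrix.one_mul]
    rw [← h1, eq_neg_of_add_eq_zero_right hprod, Matrix.mul_neg, Matrix.mul_assoc]
  have h4 := congrFun (congrFun hU α) β
  rw [Matrix.neg_apply, Matrix.mul_assoc, Matrix.mul_apply] at h4
  refine h4.trans (congrArg _ (Finset.sum_congr rfl fun γ _ => ?_))
  rw [Matrix.mul_apply, Finset.mul_sum]
  refine Finset.sum_congr rfl fun δ _ => ?_
  simp only [dG, Matrix.of_apply, gUp, Z1, v]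
  ring

/-- The derivatives of the inverse metric of order at most `n` are bounded once those of `h` and
the inverse metric itself are: induction with `∂g⁻¹ = -g⁻¹ (∂g) g⁻¹`. -/
theorem maj_gUp (hh : ∀ μ ν, Maj P n (fun i => h i μ ν) geom)
    (hdet : ∀ i, ∀ y ∈ P.dom i, IsUnit (gMat (h i) y).det)
    (hpt : ∃ C : ℝ≥0, ∀ i α β, ‖gUp (h i) (P.pt i) α β‖₊ ≤ C) (α β : Fin 4) :
    Maj P n (fun i y => gUp (h i) y α β) geom := by
  obtain ⟨C, hC⟩ := hpt
  have key : ∀ m ≤ n, ∀ α β, Maj P m (fun i y => gUp (h i) y α β) geom := by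
    intro m
    induction m with
    | zero =>
      intro hm α β
      refine ⟨fun i => contDiffOn_gUp (fun μ ν => ((hh μ ν).of_le hm).1 i) (hdet i) α β, C,
        fun i J hJ => ?_⟩
      obtain rfl : J = [] := List.length_eq_zero_iff.mp (by omega)
      simpa [ZI, geom] using hC i α β
    | succ m ih =>
      intro hm α β
      refine Maj.succ (fun i => contDiffOn_gUp (fun μ ν => ((hh μ ν).of_le hm).1 i) (hdet i) α β)
        ⟨C, fun i => by simpa [geom] using hC i α β⟩ fun ι => ?_
      have ih' := ih (by omega)
      have h1 : ∀ γ δ, Maj P m (fun i => Z1 (P.dom i) ι (h i γ δ)) geom := by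
        intro γ δ
        obtain ⟨h2, C', hC'⟩ := hh γ δ
        refine ⟨fun i => contDiffOn_Z1 (P.uniqueDiff i)
          ((h2 i).of_le (by exact_mod_cast hm)) ι, C', fun i J hJ => ?_⟩
        rw [← ZI_append_singleton]
        simpa [geom] using hC' i (J ++ [ι]) (by simp; omega)
      refine ⟨geom, ?_, ?_⟩
      · refine (Maj.congr (f := fun i y =>
          -∑ γ, ∑ δ, gUp (h i) y α γ * Z1 (P.dom i) ι (h i γ δ) y * gUp (h i) y δ β)
          (a := geom ^ 3) ?_ fun i => Z1_gUp (P.uniqueDiff i)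
            (fun μ ν => ((hh μ ν).1 i).of_le (by exact_mod_cast (by omega))) (hdet i) ι α β).mono
          (below_geom_pow 3)
        refine (Maj.sum _ fun γ _ => Maj.sum _ fun δ _ => ?_).neg
        have := ((ih' α γ).mul (h1 γ δ)).mul (ih' δ β)
        convert this using 1
        ring
      · refine ⟨1, fun i k _ => ?_⟩
        simp only [Pi.mul_apply, serX]
        cases k with
        | zero => simp
        | succ k => rw [PowerSeries.coeff_succ_X_mul]; simp [geom]
  exact key n le_rfl α β

/-- If `|h| ≤ Ct < 1` in the Euclidean norm, then `g⁻¹ = (m + h)⁻¹` is bounded by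
`1 / (1 - Ct)`: since `m` is an isometry, `g⁻¹ e = m e - m h (g⁻¹ e)`. -/
theorem abs_gUp_le {k : Fin 4 → Fin 4 → Spacetime → ℝ} {x : Spacetime} {Ct : ℝ} (hCt : Ct < 1)
    (hk : normT k x ≤ Ct) (hdet : IsUnit (gMat k x).det) (α β : Fin 4) :
    |gUp k x α β| ≤ 1 / (1 - Ct) := by
  let v : Spacetime := WithLp.toLp 2 fun γ => gUp k x γ β
  have h1 : ∀ γ, ∑ δ, gMat k x γ δ * v δ = (1 : Matrix (Fin 4) (Fin 4) ℝ) γ β := fun γ => by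
    rw [← Matrix.mul_nonsing_inv _ hdet, Matrix.mul_apply]; rfl
  let w : Spacetime := WithLp.toLp 2 fun γ => ∑ δ, k γ δ x * v δ
  have hw : ‖w‖ ≤ Ct * ‖v‖ := by
    refine le_trans ?_ (mul_le_mul_of_nonneg_right hk (norm_nonneg v))
    rw [EuclideanSpace.norm_eq w, EuclideanSpace.norm_eq v, normT, ← Real.sqrt_mul
      (Finset.sum_nonneg fun _ _ => Finset.sum_nonneg fun _ _ => sq_nonneg _)]
    apply Real.sqrt_le_sqrt
    rw [Finset.sum_mul]
    refine Finset.sum_le_sum fun γ _ => ?_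
    simp only [Real.norm_eq_abs, sq_abs]
    exact Finset.sum_mul_sq_le_sq_mul_sq Finset.univ (fun δ => k γ δ x) (fun δ => v δ)
  have h2 : ∀ γ, mink γ γ * v γ + w γ = (1 : Matrix (Fin 4) (Fin 4) ℝ) γ β := by
    intro γ
    rw [← h1 γ]
    simp only [gMat, Matrix.of_apply, add_mul, Finset.sum_add_distrib]
    congr 1
    rw [Finset.sum_eq_single γ]
    · intro δ _ hδ
      rw [mink, Matrix.diagonal_apply_ne _ (Ne.symm hδ), zero_mul]
    · simp
  have hm : ∀ γ, mink γ γ ^ 2 = 1 := by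
    intro γ; fin_cases γ <;> simp [mink]
  have h3 : ‖v‖ = ‖e β - w‖ := by
    rw [EuclideanSpace.norm_eq, EuclideanSpace.norm_eq]
    congr 1
    refine Finset.sum_congr rfl fun γ _ => ?_
    have h4 : (e β - w) γ = mink γ γ * v γ := by
      rw [PiLp.sub_apply, sub_eq_iff_eq_add, h2 γ]
      simp [e, Matrix.one_apply]
    rw [h4]
    simp only [Real.norm_eq_abs, sq_abs]
    rw [mul_pow, hm, one_mul]
  have h5 : ‖v‖ ≤ 1 + Ct * ‖v‖ := by
    calc ‖v‖ = ‖e β - w‖ := h3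
      _ ≤ ‖e β‖ + ‖w‖ := norm_sub_le _ _
      _ ≤ 1 + Ct * ‖v‖ := by
        gcongr
        simp [e]
  have h6 : |gUp k x α β| ≤ ‖v‖ := PiLp.norm_apply_le v α
  refine h6.trans ?_
  rw [le_div_iff₀ (by linarith)]
  linarith

/-- `g^{αβ} - m^{αβ} = -g^{αγ} h_{γδ} m^{δβ}` is of first order in `h`. -/
theorem gUp_sub_mUp {k : Fin 4 → Fin 4 → Spacetime → ℝ} {x : Spacetime}
    (hdet : IsUnit (gMat k x).det) (α β : Fin 4) :
    gUp k x α β - mUp α β = -∑ γ, ∑ δ, gUp k x α γ * k γ δ x * mink δ β := by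
  have hK : gMat k x = mink + Matrix.of fun γ δ => k γ δ x := rfl
  have h1 : (gMat k x)⁻¹ - mink
      = -((gMat k x)⁻¹ * (Matrix.of fun γ δ => k γ δ x) * mink) := by
    have h2 : (gMat k x)⁻¹ * (gMat k x) * mink = mink := by
      rw [Matrix.nonsing_inv_mul _ hdet, Matrix.one_mul]
    have h3 : (gMat k x)⁻¹ * (gMat k x) * mink = (gMat k x)⁻¹
        + (gMat k x)⁻¹ * (Matrix.of fun γ δ => k γ δ x) * mink := by
      conv_lhs => rw [Matrix.mul_assoc, hK, Matrix.add_mul, mink_mul_mink, ← hK, Matrix.mul_add,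
        Matrix.mul_one, ← Matrix.mul_assoc]
    exact sub_eq_of_eq_add (eq_neg_add_of_add_eq (by rw [add_comm, ← h3, h2]))
  have h4 := congrFun (congrFun h1 α) β
  rw [Matrix.neg_apply, Matrix.mul_assoc, Matrix.mul_apply, Matrix.sub_apply] at h4
  rw [mUp_eq]
  refine h4.trans (congrArg _ (Finset.sum_congr rfl fun γ _ => ?_))
  rw [Matrix.mul_apply, Finset.mul_sum]
  refine Finset.sum_congr rfl fun δ _ => ?_
  simp only [Matrix.of_apply, gUp]
  ring

theorem maj_gUp_sub_mUp (hh : ∀ μ ν, Maj P n (fun i => h i μ ν) H)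
    (hg : ∀ α β, Maj P n (fun i y => gUp (h i) y α β) geom)
    (hdet : ∀ i, ∀ y ∈ P.dom i, IsUnit (gMat (h i) y).det) (α β : Fin 4) :
    Maj P n (fun i y => gUp (h i) y α β - mUp α β) (geom * H) := by
  refine Maj.congr (f := fun i y => -∑ γ, ∑ δ, gUp (h i) y α γ * h i γ δ y * mink δ β) ?_
    fun i y hy => gUp_sub_mUp (hdet i y hy) α β
  refine (Maj.sum _ fun γ _ => Maj.sum _ fun δ _ => ?_).neg
  simpa only [mul_comm] using ((hg α γ).mul (hh γ δ)).const_mul (mink δ β)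

end metric

/-! ### The potential -/

section potential

variable {κ : Type*} {P : PointFamily κ} {n : ℕ} {V : κ → ℝ → ℝ} {u : κ → Spacetime → ℝ}
  {a : κ → ℝ≥0⟦X⟧}

theorem contDiffOn_Vder {W : ℝ → ℝ} {m s : ℕ} (hW : ContDiffOn ℝ (m + s : ℕ) W (Set.Ici 0)) :
    ContDiffOn ℝ m (Vder W s) (Set.Ici 0) := by
  induction s generalizing m with
  | zero =>
    have : Vder W 0 = W := by funext y; simp [Vder]
    rw [this]; simpa using hW
  | succ s ih =>
    have h1 : ContDiffOn ℝ (m + 1 : ℕ) (Vder W s) (Set.Ici 0) :=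
      ih (hW.of_le (by exact_mod_cast (by omega)))
    have h2 : Vder W (s + 1) = derivWithin (Vder W s) (Set.Ici 0) := by
      funext y
      rw [Vder, iteratedDerivWithin_succ]; rfl
    rw [h2]
    exact h1.derivWithin (uniqueDiffOn_Ici 0) (by push_cast; rfl)

theorem Z1_Vder {W : ℝ → ℝ} {s : ℕ} (hW : ContDiffOn ℝ (1 + s : ℕ) W (Set.Ici 0))
    {D : Set Spacetime} (hD : UniqueDiffOn ℝ D) {w : Spacetime → ℝ}
    (hw : ContDiffOn ℝ (1 : ℕ) w D) (hw0 : ∀ y ∈ D, 0 ≤ w y) (ι : VField) :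
    Set.EqOn (Z1 D ι fun y => Vder W s (w y))
      (fun y => Vder W (s + 1) (w y) * Z1 D ι w y) D := by
  intro x hx
  have h1 : DifferentiableWithinAt ℝ (Vder W s) (Set.Ici 0) (w x) :=
    (contDiffOn_Vder hW).differentiableOn (by simp) _ (hw0 x hx)
  have h2 := h1.hasDerivWithinAt.comp_hasFDerivWithinAt x
    ((hw.differentiableOn (by simp)) x hx).hasFDerivWithinAt (fun y hy => hw0 y hy)
  have h3 : Vder W (s + 1) (w x) = derivWithin (Vder W s) (Set.Ici 0) (w x) := by
    rw [Vder, iteratedDerivWithin_succ]; rfl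
  have h4 := h2.fderivWithin (hD x hx)
  simp only [Function.comp_def] at h4
  simp only [Z1]
  rw [h4, h3]
  simp

/-- The chain rule for `V^{(s)}(u)` in terms of generating series. Every vector field that hits
`V^{(s)}` produces one factor `Z u`, so that `j` of them give `V^{(s+j)}` times `a ^ j`. -/
theorem maj_Vder (hV : ∀ i, ContDiffOn ℝ (n + 1 : ℕ) (V i) (Set.Ici 0)) (hu : Maj P n u a)
    (hu0 : ∀ i, ∀ y ∈ P.dom i, 0 ≤ u i y) {m s : ℕ} (hm : m ≤ n) (hms : m + s ≤ n + 1) :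
    Maj P m (fun i y => Vder (V i) s (u i y)) (∑ j ∈ Finset.range (m + 1),
      (fun i => PowerSeries.C ‖Vder (V i) (s + j) (u i (P.pt i))‖₊) * a ^ j) := by
  have hreg : ∀ m s : ℕ, m ≤ n → m + s ≤ n + 1 → ∀ i,
      ContDiffOn ℝ m (fun y => Vder (V i) s (u i y)) (P.dom i) := fun m s hm hms i =>
    (contDiffOn_Vder (m := m) (s := s) ((hV i).of_le (by exact_mod_cast hms))).comp
      ((hu.1 i).of_le (by exact_mod_cast hm)) (fun y hy => hu0 i y hy)
  have h0 : ∀ (m s : ℕ) i, ‖Vder (V i) s (u i (P.pt i))‖₊ ≤ 1 * PowerSeries.coeff 0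
      ((∑ j ∈ Finset.range (m + 1),
        (fun i => PowerSeries.C ‖Vder (V i) (s + j) (u i (P.pt i))‖₊) * a ^ j) i) := by
    intro m s i
    rw [Finset.sum_range_succ', one_mul, Pi.add_apply, map_add]
    refine le_trans ?_ le_add_self
    simp
  induction m generalizing s with
  | zero =>
    refine ⟨hreg 0 s hm hms, 1, fun i J hJ => ?_⟩
    obtain rfl : J = [] := List.length_eq_zero_iff.mp (by omega)
    exact h0 0 s i
  | succ m ih =>
    refine Maj.succ (hreg (m + 1) s hm hms) ⟨1, h0 (m + 1) s⟩ fun ι => ?_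
    have h1 : Maj P m (fun i => Z1 (P.dom i) ι (u i)) (fun i => shift (a i)) := by
      obtain ⟨h2, C, hC⟩ := hu
      refine ⟨fun i => contDiffOn_Z1 (P.uniqueDiff i) ((h2 i).of_le (by exact_mod_cast hm)) ι, C,
        fun i J hJ => ?_⟩
      rw [← ZI_append_singleton]
      simpa [shift] using hC i (J ++ [ι]) (by simp; omega)
    refine ⟨_, Maj.congr ((ih (s := s + 1) (by omega) (by omega)).mul h1) fun i =>
      Z1_Vder ((hV i).of_le (by exact_mod_cast (by omega))) (P.uniqueDiff i)
        ((hu.1 i).of_le (by exact_mod_cast (by omega))) (hu0 i) ι, ?_⟩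
    have h2 : Below (m + 1) (serX * fun i => shift (a i)) a :=
      ⟨1, fun i k _ => by
        rw [one_mul]; exact coeff_X_mul_shift_le (a i) k⟩
    refine Below.trans (b := (∑ j ∈ Finset.range (m + 1), (fun i => PowerSeries.C
      ‖Vder (V i) (s + 1 + j) (u i (P.pt i))‖₊) * a ^ j) * a) ?_ ?_
    · rw [mul_left_comm]
      exact h2.mul_left _
    · rw [Finset.sum_range_succ' (n := m + 1)]
      refine Below.of_add_eq _ (congrArg (· + _) ?_)
      rw [Finset.sum_mul]
      refine Finset.sum_congr rfl fun j _ => ?_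
      rw [pow_succ, mul_assoc, show s + 1 + j = s + (j + 1) by ring]

end potential

/-! ### Algebra of the null frame -/

section frame

/-- The Minkowski inner product of two vectors. -/
def mform (v w : Spacetime) : ℝ := ∑ α, v α * lower w α

theorem lower_eq (w : Spacetime) (α : Fin 4) : lower w α = mink α α * w α := by
  rw [lower, Finset.sum_eq_single α]
  · intro β _ hβ
    rw [mink, Matrix.diagonal_apply_ne _ (Ne.symm hβ), zero_mul]
  · simp

theorem mform_eq (v w : Spacetime) :
    mform v w = -(v 0 * w 0) + v 1 * w 1 + v 2 * w 2 + v 3 * w 3 := by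
  simp [mform, lower_eq, Fin.sum_univ_four, mink]

theorem mform_e (v : Spacetime) (β : Fin 4) : mform (e β) v = lower v β := by
  rw [mform, Finset.sum_eq_single β]
  · simp [e]
  · intro γ _ hγ; simp [e, hγ]
  · simp

theorem abs_mform_le (v w : Spacetime) : |mform v w| ≤ 4 * (‖v‖ * ‖w‖) := by
  have h : ∀ α, |v α * lower w α| ≤ ‖v‖ * ‖w‖ := by
    intro α
    have h1 : |lower w α| = |w α| := by
      rw [lower_eq, abs_mul]
      fin_cases α <;> simp [mink]
    rw [abs_mul, h1]
    exact mul_le_mul (PiLp.norm_apply_le v α) (PiLp.norm_apply_le w α) (abs_nonneg _)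
      (norm_nonneg _)
  refine (Finset.abs_sum_le_sum_abs _ _).trans
    ((Finset.sum_le_card_nsmul _ _ _ fun α _ => h α).trans (le_of_eq ?_))
  simp

/-- The vector fields are conformally Killing: their linear parts preserve the null cone. -/
theorem mform_lin_self (ι : VField) {v : Spacetime} (hv : mform v v = 0) :
    mform (ι.lin v) v = 0 := by
  have hadd : ∀ a b : Spacetime, mform (a + b) v = mform a v + mform b v := fun a b => by
    simp [mform, add_mul, Finset.sum_add_distrib]
  have hsmul : ∀ (c : ℝ) (a : Spacetime), mform (c • a) v = c * mform a v := fun c a => by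
    simp [mform, Finset.mul_sum, mul_assoc]
  cases ι with
  | d α => simp [VField.lin, mform]
  | Om α β =>
    have : (VField.Om α β).lin v = (-lower v α) • e β + lower v β • e α := by
      simp [VField.lin, lowerCLM_apply]
    rw [this, hadd, hsmul, hsmul, mform_e, mform_e]
    ring
  | S => exact hv

theorem dr_zero (x : Spacetime) : dr x 0 = 0 := by
  simp [dr, e]

theorem dr_succ (x : Spacetime) (i : Fin 3) : dr x i.succ = x i.succ / rad x := by
  fin_cases i <;> simp [dr, e, Fin.sum_univ_three]

theorem dr_sq {x : Spacetime} (hr : rad x ≠ 0) : dr x 1 ^ 2 + dr x 2 ^ 2 + dr x 3 ^ 2 = 1 := by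
  have h1 := dr_succ x 0
  have h2 := dr_succ x 1
  have h3 := dr_succ x 2
  simp only [Fin.succ_zero_eq_one, Fin.succ_one_eq_two, show (2 : Fin 3).succ = 3 from rfl]
    at h1 h2 h3
  have h4 : rad x ^ 2 = x 1 ^ 2 + x 2 ^ 2 + x 3 ^ 2 := Real.sq_sqrt (by positivity)
  rw [h1, h2, h3]
  field_simp
  exact h4.symm

theorem inner_eq (v w : Spacetime) :
    inner ℝ v w = v 0 * w 0 + v 1 * w 1 + v 2 * w 2 + v 3 * w 3 := by
  simp [PiLp.inner_apply, Fin.sum_univ_four, mul_comm]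

theorem norm_dr {x : Spacetime} (hr : rad x ≠ 0) : ‖dr x‖ = 1 := by
  have h := real_inner_self_eq_norm_sq (dr x)
  rw [inner_eq, dr_zero] at h
  have h1 : ‖dr x‖ ^ 2 = 1 := by rw [← h, ← dr_sq hr]; ring
  exact (pow_eq_one_iff_of_nonneg (norm_nonneg _) two_ne_zero).mp h1

variable {x S₁ S₂ : Spacetime}

theorem norm_frameVec_le (hr : rad x ≠ 0) (hS : IsSphereFrame x S₁ S₂) (V : FrameLabel) :
    ‖frameVec x S₁ S₂ V‖ ≤ 2 := by
  have he : ‖e 0‖ = 1 := by simp [e]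
  obtain ⟨-, -, -, -, h1, h2, -⟩ := hS
  rw [real_inner_self_eq_norm_sq] at h1 h2
  cases V with
  | Lbar => exact (norm_sub_le _ _).trans (by rw [he, norm_dr hr]; norm_num)
  | L => exact (norm_add_le _ _).trans (by rw [he, norm_dr hr]; norm_num)
  | S1 => simp only [frameVec]; nlinarith [norm_nonneg S₁]
  | S2 => simp only [frameVec]; nlinarith [norm_nonneg S₂]

/-- The coefficients of the expansion `m⁻¹ = ∑ η_a X_a ⊗ Y_a` in the null frame. -/
def frameCoeff : Fin 4 → ℝ := ![-(1 / 2), -(1 / 2), 1, 1]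

/-- The first factors of the expansion `m⁻¹ = ∑ η_a X_a ⊗ Y_a` in the null frame. -/
def frameX : Fin 4 → FrameLabel := ![.L, .Lbar, .S1, .S2]

/-- The second factors of the expansion `m⁻¹ = ∑ η_a X_a ⊗ Y_a` in the null frame. -/
def frameY : Fin 4 → FrameLabel := ![.Lbar, .L, .S1, .S2]

/-- `m⁻¹ = -½ (L ⊗ L̲ + L̲ ⊗ L) + S₁ ⊗ S₁ + S₂ ⊗ S₂`. -/
theorem mUp_eq_frame (hr : rad x ≠ 0) (hS : IsSphereFrame x S₁ S₂) (α β : Fin 4) :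
    mUp α β = ∑ a, frameCoeff a *
      (frameVec x S₁ S₂ (frameX a) α * frameVec x S₁ S₂ (frameY a) β) := by
  obtain ⟨h1, h2, h3, h4, h5, h6, h7⟩ := hS
  rw [inner_eq] at h3 h4 h5 h6 h7
  have h8 := dr_sq hr
  have h9 := dr_zero x
  simp only [h1, h2, h9, zero_mul, zero_add] at h3 h4 h5 h6 h7
  -- the rows of `R` are the orthonormal basis `∂_t, ∂_r, S₁, S₂`, so its columns are orthonormal
  let R : Matrix (Fin 4) (Fin 4) ℝ := Matrix.of ![fun α => e 0 α, fun α => dr x α,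
    fun α => S₁ α, fun α => S₂ α]
  have hR : R * Rᵀ = 1 := by
    ext i j
    rw [Matrix.mul_apply, Fin.sum_univ_four]
    fin_cases i <;> fin_cases j <;> simp [R, e, h1, h2, h9] <;> linarith
  have hR' := mul_eq_one_comm.mp hR
  have h10 := congrFun (congrFun hR' α) β
  rw [Matrix.mul_apply, Fin.sum_univ_four] at h10
  have h11 : mUp α β = (1 : Matrix (Fin 4) (Fin 4) ℝ) α β - 2 * (e 0 α * e 0 β) := by
    rw [mUp_eq]
    fin_cases α <;> fin_cases β <;> simp [mink, e]; norm_num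
  rw [h11, ← h10]
  simp [R, Fin.sum_univ_four, frameCoeff, frameX, frameY, frameVec]
  ring

theorem sum_mUp_mul (hr : rad x ≠ 0) (hS : IsSphereFrame x S₁ S₂) (f : Fin 4 → Fin 4 → ℝ) :
    ∑ α, ∑ β, mUp α β * f α β = ∑ a, frameCoeff a * ∑ α, ∑ β,
      frameVec x S₁ S₂ (frameX a) α * frameVec x S₁ S₂ (frameY a) β * f α β := by
  simp only [mUp_eq_frame hr hS, Finset.sum_mul, Finset.mul_sum]
  rw [Finset.sum_congr rfl fun α _ => Finset.sum_comm, Finset.sum_comm]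
  simp only [mul_assoc]

theorem mUp_mul_lower (v : Spacetime) (α : Fin 4) : ∑ β, mUp α β * lower v β = v α := by
  rw [Finset.sum_eq_single α]
  · rw [mUp_eq, lower_eq]; fin_cases α <;> simp [mink]
  · intro β _ hβ
    rw [mUp_eq, mink, Matrix.diagonal_apply_ne _ (Ne.symm hβ), zero_mul]
  · simp

/-- The expansion of a vector in the null frame. -/
theorem frame_expansion (hr : rad x ≠ 0) (hS : IsSphereFrame x S₁ S₂) (v : Spacetime) :
    v = ∑ a, (frameCoeff a * mform (frameVec x S₁ S₂ (frameY a)) v) •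
      frameVec x S₁ S₂ (frameX a) := by
  ext α
  rw [← mUp_mul_lower v α]
  simp only [mUp_eq_frame hr hS, Finset.sum_mul, WithLp.ofLp_sum, Finset.sum_apply,
    PiLp.smul_apply, smul_eq_mul, mform, Finset.mul_sum]
  rw [Finset.sum_comm]
  exact Finset.sum_congr rfl fun a _ => Finset.sum_congr rfl fun β _ => by ring

theorem mform_L_self (hr : rad x ≠ 0) :
    mform (frameVec x S₁ S₂ .L) (frameVec x S₁ S₂ .L) = 0 := by
  have h8 := dr_sq hr
  have h9 := dr_zero x
  rw [mform_eq]
  simp [frameVec, e, h9]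
  nlinarith

/-- A linear functional that is small on the vectors `∂̄_β` is small on the vectors of the frame
tangent to the outgoing cone. -/
theorem abs_apply_tangent_le (hS : IsSphereFrame x S₁ S₂)
    (l : Spacetime →ₗ[ℝ] ℝ) {M : ℝ} (hl : ∀ β, |l (dbarVec x β)| ≤ M) {V : FrameLabel}
    (hV : V ≠ .Lbar) : |l (frameVec x S₁ S₂ V)| ≤ 3 * M := by
  have hM : 0 ≤ M := (abs_nonneg _).trans (hl 0)
  have key : ∀ S : Spacetime, S 0 = 0 → inner ℝ S (dr x) = 0 → inner ℝ S S = 1 →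
      |l S| ≤ 3 * M := by
    intro S h0 h1 h2
    rw [inner_eq] at h1 h2
    rw [h0, zero_mul, zero_add] at h1 h2
    have h3 : S = ∑ i : Fin 3, S i.succ • dbarVec x i.succ := by
      simp only [dbarVec, Fin.cons_succ, smul_sub, Finset.sum_sub_distrib, smul_smul,
        ← Finset.sum_smul, ← dr_succ]
      have h4 : ∑ i : Fin 3, S i.succ * dr x i.succ = 0 := by
        rw [Fin.sum_univ_three]; exact h1
      rw [h4, zero_smul, sub_zero]
      conv_lhs => rw [← sum_smul_e S, Fin.sum_univ_succ, h0, zero_smul, zero_add]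
    rw [h3, map_sum]
    refine (Finset.abs_sum_le_sum_abs _ _).trans
      ((Finset.sum_le_card_nsmul _ _ M fun i _ => ?_).trans (le_of_eq (by simp)))
    rw [map_smul, smul_eq_mul, abs_mul]
    have h5 : |S i.succ| ≤ 1 := by
      rw [abs_le_one_iff_mul_self_le_one]
      fin_cases i <;> simp <;>
        nlinarith [mul_self_nonneg (S 1), mul_self_nonneg (S 2), mul_self_nonneg (S 3)]
    calc _ ≤ 1 * M := mul_le_mul h5 (hl _) (abs_nonneg _) zero_le_one
      _ = M := one_mul M
  obtain ⟨h1, h2, h3, h4, h5, h6, -⟩ := hS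
  cases V with
  | Lbar => exact absurd rfl hV
  | L => exact (hl 0).trans (by linarith)
  | S1 => exact key S₁ h1 h3 h5
  | S2 => exact key S₂ h2 h4 h6

/-- The coefficient of `L̲` in the expansion of `v` in the null frame, which is `-½ m(L, v)`. -/
def theta (x v : Spacetime) : ℝ := -(1 / 2) * mform (e 0 + dr x) v

/-- Up to its part along `L̲`, a derivative is bounded by the tangential ones. -/
theorem abs_sub_theta_le (hr : rad x ≠ 0) (hS : IsSphereFrame x S₁ S₂)
    (l : Spacetime →ₗ[ℝ] ℝ) {M : ℝ} (hl : ∀ β, |l (dbarVec x β)| ≤ M) (v : Spacetime) :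
    |l v - theta x v * l (frameVec x S₁ S₂ .Lbar)| ≤ 72 * (‖v‖ * M) := by
  have hM : 0 ≤ M := (abs_nonneg _).trans (hl 0)
  have h1 := congrArg l (frame_expansion hr hS v)
  rw [map_sum, Fin.sum_univ_four] at h1
  simp only [map_smul, smul_eq_mul] at h1
  have h2 : ∀ V W, W ≠ FrameLabel.Lbar →
      |mform (frameVec x S₁ S₂ V) v * l (frameVec x S₁ S₂ W)| ≤ 24 * (‖v‖ * M) := by
    intro V W hW
    rw [abs_mul]
    have h3 := abs_mform_le (frameVec x S₁ S₂ V) v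
    have h4 : |mform (frameVec x S₁ S₂ V) v| ≤ 8 * ‖v‖ := h3.trans (by
      nlinarith [mul_le_mul_of_nonneg_right (norm_frameVec_le hr hS V) (norm_nonneg v)])
    calc _ ≤ (8 * ‖v‖) * (3 * M) :=
          mul_le_mul h4 (abs_apply_tangent_le hS l hl hW) (abs_nonneg _) (by positivity)
      _ = _ := by ring
  have h5 : l v - theta x v * l (frameVec x S₁ S₂ .Lbar) =
      -(1 / 2) * (mform (frameVec x S₁ S₂ .Lbar) v * l (frameVec x S₁ S₂ .L))
      + mform (frameVec x S₁ S₂ .S1) v * l (frameVec x S₁ S₂ .S1)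
      + mform (frameVec x S₁ S₂ .S2) v * l (frameVec x S₁ S₂ .S2) := by
    rw [h1]
    simp only [frameCoeff, frameX, frameY, theta, frameVec, Matrix.cons_val_zero,
      Matrix.cons_val_one, Matrix.cons_val]
    ring
  rw [h5]
  have a1 := abs_le.mp (h2 .Lbar .L (by simp))
  have a2 := abs_le.mp (h2 .S1 .S1 (by simp))
  have a3 := abs_le.mp (h2 .S2 .S2 (by simp))
  have : 0 ≤ ‖v‖ * M := by positivity
  rw [abs_le]
  constructor <;> linarith

end frame

/-! ### Null forms -/

section nullforms

/-- The symbols of null forms: matrices whose symmetric part is a multiple of `m⁻¹`. -/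
def IsNullSymbol (c : Fin 4 → Fin 4 → ℝ) : Prop :=
  ∃ t : ℝ, ∀ γ δ, c γ δ + c δ γ = t * mUp γ δ

/-- The bilinear form `c^{γδ} ∂_γ φ ∂_δ ψ`. -/
def nullForm (c : Fin 4 → Fin 4 → ℝ) (D : Set Spacetime) (φ ψ : Spacetime → ℝ)
    (y : Spacetime) : ℝ :=
  ∑ γ, ∑ δ, c γ δ * (fderivWithin ℝ φ D y (e γ) * fderivWithin ℝ ψ D y (e δ))

variable {D : Set Spacetime} {x S₁ S₂ : Spacetime}

theorem theta_e (x : Spacetime) (γ : Fin 4) :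
    theta x (e γ) = -(1 / 2) * lower (frameVec x 0 0 .L) γ := by
  have h : ∀ v w, mform v w = mform w v := fun v w => by rw [mform_eq, mform_eq]; ring
  rw [theta, h, mform_e]
  rfl

theorem norm_e (γ : Fin 4) : ‖e γ‖ = 1 := by simp [e]

theorem abs_theta_le (hr : rad x ≠ 0) (v : Spacetime) : |theta x v| ≤ 4 * ‖v‖ := by
  have h1 : ‖e 0 + dr x‖ ≤ 2 := (norm_add_le _ _).trans (by rw [norm_e, norm_dr hr]; norm_num)
  have h2 := abs_mform_le (e 0 + dr x) v
  have h3 := mul_le_mul_of_nonneg_right h1 (norm_nonneg v)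
  rw [theta, abs_mul]
  norm_num
  linarith

theorem abs_sum_sum_le {f : Fin 4 → Fin 4 → ℝ} {M : ℝ} (hf : ∀ γ δ, |f γ δ| ≤ M) :
    |∑ γ, ∑ δ, f γ δ| ≤ 16 * M := by
  have h1 : ∀ γ, |∑ δ, f γ δ| ≤ 4 * M := fun γ =>
    (Finset.abs_sum_le_sum_abs _ _).trans
      ((Finset.sum_le_card_nsmul _ _ _ fun δ _ => hf γ δ).trans (le_of_eq (by simp)))
  refine (Finset.abs_sum_le_sum_abs _ _).trans
    ((Finset.sum_le_card_nsmul _ _ _ fun γ _ => h1 γ).trans (le_of_eq ?_))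
  simp; ring

/-- The product of the two derivatives along `L̲` cancels in a null form. -/
theorem abs_nullSymbol_le (hr : rad x ≠ 0) (hS : IsSphereFrame x S₁ S₂)
    {c : Fin 4 → Fin 4 → ℝ} (hc : IsNullSymbol c) {M : ℝ} (hM : ∀ γ δ, |c γ δ| ≤ M)
    (l l' : Spacetime →ₗ[ℝ] ℝ) {a a' b b' : ℝ} (ha : ∀ γ, |l (e γ)| ≤ a)
    (ha' : ∀ β, |l (dbarVec x β)| ≤ a') (hb : ∀ γ, |l' (e γ)| ≤ b)
    (hb' : ∀ β, |l' (dbarVec x β)| ≤ b') :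
    |∑ γ, ∑ δ, c γ δ * (l (e γ) * l' (e δ))| ≤ 40000 * M * (a' * b + a * b') := by
  have hM0 : 0 ≤ M := (abs_nonneg _).trans (hM 0 0)
  have ha0 : 0 ≤ a := (abs_nonneg _).trans (ha 0)
  have ha0' : 0 ≤ a' := (abs_nonneg _).trans (ha' 0)
  have hb0 : 0 ≤ b := (abs_nonneg _).trans (hb 0)
  have hb0' : 0 ≤ b' := (abs_nonneg _).trans (hb' 0)
  set Λ := l (frameVec x S₁ S₂ .Lbar) with hΛ
  set Λ' := l' (frameVec x S₁ S₂ .Lbar) with hΛ'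
  have hΛ1 : |Λ| ≤ 8 * a := by
    have h1 : Λ = ∑ γ, (frameVec x S₁ S₂ .Lbar) γ * l (e γ) := by
      rw [hΛ]; conv_lhs => rw [← sum_smul_e (frameVec x S₁ S₂ .Lbar), map_sum]
      simp
    rw [h1]
    refine (Finset.abs_sum_le_sum_abs _ _).trans
      ((Finset.sum_le_card_nsmul _ _ (2 * a) fun γ _ => ?_).trans (le_of_eq (by simp; ring)))
    rw [abs_mul]
    exact mul_le_mul ((PiLp.norm_apply_le _ γ).trans (norm_frameVec_le hr hS _)) (ha γ)
      (abs_nonneg _) (by norm_num)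
  have hρ : ∀ γ, |l (e γ) - theta x (e γ) * Λ| ≤ 72 * a' := fun γ => by
    simpa [norm_e] using abs_sub_theta_le hr hS l ha' (e γ)
  have hρ' : ∀ γ, |l' (e γ) - theta x (e γ) * Λ'| ≤ 72 * b' := fun γ => by
    simpa [norm_e] using abs_sub_theta_le hr hS l' hb' (e γ)
  have hθ : ∀ γ, |theta x (e γ)| ≤ 4 := fun γ => by
    simpa [norm_e] using abs_theta_le hr (e γ)
  -- the product of the two derivatives along `L̲` drops out because `L` is null
  have hnull : ∑ γ, ∑ δ, c γ δ * (theta x (e γ) * theta x (e δ)) = 0 := by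
    obtain ⟨t, ht⟩ := hc
    have h1 : ∑ γ, ∑ δ, c γ δ * (theta x (e γ) * theta x (e δ))
        = ∑ γ, ∑ δ, c δ γ * (theta x (e γ) * theta x (e δ)) := by
      rw [Finset.sum_comm]
      exact Finset.sum_congr rfl fun γ _ => Finset.sum_congr rfl fun δ _ => by ring
    have h2 : ∑ γ, ∑ δ, (c γ δ + c δ γ) * (theta x (e γ) * theta x (e δ)) = 0 := by
      have h3 : ∀ γ, ∑ δ, (c γ δ + c δ γ) * (theta x (e γ) * theta x (e δ)) =
          t / 4 * (lower (frameVec x 0 0 .L) γ * (frameVec x 0 0 .L) γ) := by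
        intro γ
        rw [← mUp_mul_lower (frameVec x 0 0 .L) γ, Finset.mul_sum, Finset.mul_sum]
        refine Finset.sum_congr rfl fun δ _ => ?_
        rw [ht, theta_e, theta_e]
        ring
      rw [Finset.sum_congr rfl fun γ _ => h3 γ, ← Finset.mul_sum]
      have h4 := mform_L_self (S₁ := 0) (S₂ := 0) hr
      simp only [mform] at h4
      simp only [mul_comm (lower _ _), h4, mul_zero]
    simp only [add_mul, Finset.sum_add_distrib] at h2
    linarith
  have hsplit : ∑ γ, ∑ δ, c γ δ * (l (e γ) * l' (e δ)) =
      Λ * Λ' * (∑ γ, ∑ δ, c γ δ * (theta x (e γ) * theta x (e δ)))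
      + ∑ γ, ∑ δ, c γ δ * (theta x (e γ) * Λ * (l' (e δ) - theta x (e δ) * Λ')
        + (l (e γ) - theta x (e γ) * Λ) * l' (e δ)) := by
    rw [Finset.mul_sum, ← Finset.sum_add_distrib]
    refine Finset.sum_congr rfl fun γ _ => ?_
    rw [Finset.mul_sum, ← Finset.sum_add_distrib]
    exact Finset.sum_congr rfl fun δ _ => by ring
  rw [hsplit, hnull, mul_zero, zero_add]
  refine (abs_sum_sum_le (M := M * (4 * (8 * a) * (72 * b') + 72 * a' * b))
    fun γ δ => ?_).trans ?_
  · rw [abs_mul]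
    refine mul_le_mul (hM γ δ) ((abs_add_le _ _).trans (add_le_add ?_ ?_)) (abs_nonneg _) hM0
    · rw [abs_mul, abs_mul]
      exact mul_le_mul (mul_le_mul (hθ γ) hΛ1 (abs_nonneg _) (by norm_num)) (hρ' δ)
        (abs_nonneg _) (by positivity)
    · rw [abs_mul]
      exact mul_le_mul (hρ γ) (hb δ) (abs_nonneg _) (by positivity)
  · have h1 : 0 ≤ M * (a' * b) := by positivity
    have h2 : 0 ≤ M * (a * b') := by positivity
    nlinarith

/-- The symbol of the commutator of a null form with a vector field. -/
def commSymbol (ι : VField) (c : Fin 4 → Fin 4 → ℝ) (γ δ : Fin 4) : ℝ :=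
  ∑ ε, (c ε δ * ι.lin (e ε) γ + c γ ε * ι.lin (e ε) δ)

/-- The linear parts of the vector fields generate conformal maps of `m⁻¹`. -/
theorem exists_lin_conformal (ι : VField) : ∃ t : ℝ, ∀ γ δ,
    ∑ ε, (mUp ε δ * ι.lin (e ε) γ + mUp γ ε * ι.lin (e ε) δ) = t * mUp γ δ := by
  have hsum : ∀ γ δ, ∑ ε, (mUp ε δ * ι.lin (e ε) γ + mUp γ ε * ι.lin (e ε) δ) =
      mink δ δ * ι.lin (e δ) γ + mink γ γ * ι.lin (e γ) δ := by
    intro γ δ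
    rw [Finset.sum_add_distrib]
    congr 1
    · rw [Finset.sum_eq_single δ (fun ε _ hε => ?_) (by simp), mUp_eq]
      rw [mUp_eq, mink, Matrix.diagonal_apply_ne _ hε, zero_mul]
    · rw [Finset.sum_eq_single γ (fun ε _ hε => ?_) (by simp), mUp_eq]
      rw [mUp_eq, mink, Matrix.diagonal_apply_ne _ (Ne.symm hε), zero_mul]
  simp only [hsum]
  cases ι with
  | d α => exact ⟨0, fun γ δ => by simp [VField.lin]⟩
  | Om α β =>
    have hlow : ∀ δ α : Fin 4, mink δ δ * lower (e δ) α = if α = δ then 1 else 0 := by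
      intro δ α
      rw [lower_eq]
      fin_cases δ <;> fin_cases α <;> simp [mink, e]
    have hlin : ∀ δ γ, mink δ δ * (VField.Om α β).lin (e δ) γ =
        -((if α = δ then 1 else 0) * (if γ = β then 1 else 0))
          + (if β = δ then 1 else 0) * (if γ = α then 1 else 0) := by
      intro δ γ
      rw [← hlow δ α, ← hlow δ β]
      simp [VField.lin, lowerCLM_apply, e]
      split_ifs <;> ring
    refine ⟨0, fun γ δ => ?_⟩
    rw [hlin, hlin]
    simp only [eq_comm (a := γ), eq_comm (a := δ)]
    ring
  | S =>
    refine ⟨2, fun γ δ => ?_⟩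
    rw [mUp_eq]
    by_cases h : γ = δ
    · subst h; simp [VField.lin, e]; ring
    · simp [VField.lin, e, h, Ne.symm h, mink]

/-- Commuting a conformal Killing field with a null form gives another null form. -/
theorem IsNullSymbol.comm {c : Fin 4 → Fin 4 → ℝ} (hc : IsNullSymbol c) (ι : VField) :
    IsNullSymbol (commSymbol ι c) := by
  obtain ⟨t, ht⟩ := hc
  obtain ⟨s, hs⟩ := exists_lin_conformal ι
  refine ⟨t * s, fun γ δ => ?_⟩
  rw [mul_assoc, ← hs γ δ, commSymbol, commSymbol, ← Finset.sum_add_distrib, Finset.mul_sum]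
  refine Finset.sum_congr rfl fun ε _ => ?_
  have h1 := ht ε δ
  have h2 := ht γ ε
  linear_combination ι.lin (e ε) γ * h1 + ι.lin (e ε) δ * h2

theorem abs_commSymbol_le {c : Fin 4 → Fin 4 → ℝ} {M : ℝ} (hM : ∀ γ δ, |c γ δ| ≤ M) (ι : VField)
    (γ δ : Fin 4) : |commSymbol ι c γ δ| ≤ 8 * (M * ‖ι.lin‖) := by
  have h1 : ∀ ε γ, |ι.lin (e ε) γ| ≤ ‖ι.lin‖ := fun ε γ =>
    (PiLp.norm_apply_le _ γ).trans ((ι.lin.le_opNorm _).trans (by rw [norm_e, mul_one]))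
  refine (Finset.abs_sum_le_sum_abs _ _).trans ((Finset.sum_le_card_nsmul _ _
    (M * ‖ι.lin‖ + M * ‖ι.lin‖) fun ε _ => (abs_add_le _ _).trans
      (add_le_add ?_ ?_)).trans (le_of_eq (by simp; ring)))
  · rw [abs_mul]
    exact mul_le_mul (hM _ _) (h1 _ _) (abs_nonneg _) ((abs_nonneg _).trans (hM 0 0))
  · rw [abs_mul]
    exact mul_le_mul (hM _ _) (h1 _ _) (abs_nonneg _) ((abs_nonneg _).trans (hM 0 0))

theorem differentiableWithinAt_fderivWithin_apply (hD : UniqueDiffOn ℝ D) {φ : Spacetime → ℝ}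
    (hφ : ContDiffOn ℝ 2 φ D) {y : Spacetime} (hy : y ∈ D) (v : Spacetime) :
    DifferentiableWithinAt ℝ (fun y => fderivWithin ℝ φ D y v) D y :=
  (((hφ.fderivWithin hD (m := 1) (by norm_num)).differentiableOn (by simp)) y hy).clm_apply
    (differentiableWithinAt_const v)

theorem contDiffOn_nullForm (hD : UniqueDiffOn ℝ D) {k : ℕ} (c : Fin 4 → Fin 4 → ℝ)
    {φ ψ : Spacetime → ℝ} (hφ : ContDiffOn ℝ (k + 1 : ℕ) φ D)
    (hψ : ContDiffOn ℝ (k + 1 : ℕ) ψ D) : ContDiffOn ℝ k (nullForm c D φ ψ) D := by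
  have h : ∀ {χ : Spacetime → ℝ}, ContDiffOn ℝ (k + 1 : ℕ) χ D → ∀ v,
      ContDiffOn ℝ k (fun y => fderivWithin ℝ χ D y v) D := fun hχ v =>
    (hχ.fderivWithin hD (by push_cast; rfl)).clm_apply contDiffOn_const
  exact ContDiffOn.sum fun γ _ => ContDiffOn.sum fun δ _ =>
    contDiffOn_const.mul ((h hφ _).mul (h hψ _))

theorem clm_lin_e (l : Spacetime →L[ℝ] ℝ) (ι : VField) (γ : Fin 4) :
    l (ι.lin (e γ)) = ∑ ε, ι.lin (e γ) ε * l (e ε) := by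
  conv_lhs => rw [← sum_smul_e (ι.lin (e γ)), map_sum]
  simp

/-- The product rule for null forms; the last term is the commutator of the coordinate derivatives
with the vector field. -/
theorem Z1_nullForm (hD : UniqueDiffOn ℝ D) (hD' : D ⊆ closure (interior D)) (ι : VField)
    (c : Fin 4 → Fin 4 → ℝ) {φ ψ : Spacetime → ℝ} (hφ : ContDiffOn ℝ 2 φ D)
    (hψ : ContDiffOn ℝ 2 ψ D) :
    Set.EqOn (Z1 D ι (nullForm c D φ ψ)) (fun y => nullForm c D (Z1 D ι φ) ψ y
      + nullForm c D φ (Z1 D ι ψ) y + nullForm (fun γ δ => -commSymbol ι c γ δ) D φ ψ y) D := by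
  intro y hy
  have hdφ := fun v => differentiableWithinAt_fderivWithin_apply hD hφ hy v
  have hdψ := fun v => differentiableWithinAt_fderivWithin_apply hD hψ hy v
  have hZφ := fun v => Z1_fderivWithin hD hD' ι hφ v hy
  have hZψ := fun v => Z1_fderivWithin hD hD' ι hψ v hy
  simp only [Z1] at hZφ hZψ
  have h1 : Z1 D ι (nullForm c D φ ψ) y = ∑ γ, ∑ δ, c γ δ *
      ((fderivWithin ℝ (Z1 D ι φ) D y (e γ) - fderivWithin ℝ φ D y (ι.lin (e γ)))
        * fderivWithin ℝ ψ D y (e δ) + fderivWithin ℝ φ D y (e γ) *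
        (fderivWithin ℝ (Z1 D ι ψ) D y (e δ) - fderivWithin ℝ ψ D y (ι.lin (e δ)))) := by
    have h2 : ∀ γ δ, DifferentiableWithinAt ℝ (fun y => c γ δ *
        (fderivWithin ℝ φ D y (e γ) * fderivWithin ℝ ψ D y (e δ))) D y := fun γ δ =>
      ((hdφ _).mul (hdψ _)).const_mul _
    have hdef : nullForm c D φ ψ = fun y => ∑ γ, ∑ δ, c γ δ *
        (fderivWithin ℝ φ D y (e γ) * fderivWithin ℝ ψ D y (e δ)) := rfl
    rw [Z1, hdef, fderivWithin_fun_sum (hD y hy) fun γ _ =>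
      DifferentiableWithinAt.fun_sum fun δ _ => h2 γ δ, sum_apply]
    refine Finset.sum_congr rfl fun γ _ => ?_
    rw [fderivWithin_fun_sum (hD y hy) fun δ _ => h2 γ δ, sum_apply]
    refine Finset.sum_congr rfl fun δ _ => ?_
    rw [fderivWithin_const_mul (hD y hy) ((hdφ _).fun_mul (hdψ _)),
      fderivWithin_fun_mul (hD y hy) (hdφ _) (hdψ _)]
    simp only [smul_apply, add_apply, smul_eq_mul, hZφ, hZψ]
    ring
  have h3 : ∑ γ, ∑ δ, c γ δ * (fderivWithin ℝ φ D y (ι.lin (e γ)) * fderivWithin ℝ ψ D y (e δ)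
      + fderivWithin ℝ φ D y (e γ) * fderivWithin ℝ ψ D y (ι.lin (e δ))) =
      nullForm (commSymbol ι c) D φ ψ y := by
    simp only [nullForm, commSymbol, Finset.sum_add_distrib, add_mul, mul_add, clm_lin_e,
      Finset.sum_mul, Finset.mul_sum]
    congr 1
    · exact (Finset.sum_congr rfl fun γ _ => Finset.sum_comm).trans (Finset.sum_comm.trans
        (Finset.sum_congr rfl fun ε _ => Finset.sum_comm.trans (Finset.sum_congr rfl fun δ _ =>
          Finset.sum_congr rfl fun γ _ => by ring)))
    · refine Finset.sum_congr rfl fun γ _ => ?_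
      rw [Finset.sum_comm]
      exact Finset.sum_congr rfl fun δ _ => Finset.sum_congr rfl fun ε _ => by ring
  have h4 : nullForm (fun γ δ => -commSymbol ι c γ δ) D φ ψ y
      = -nullForm (commSymbol ι c) D φ ψ y := by
    simp only [nullForm, neg_mul, Finset.sum_neg_distrib]
  simp only
  rw [h1, h4, ← h3]
  simp only [nullForm, ← Finset.sum_add_distrib, ← Finset.sum_neg_distrib]
  exact Finset.sum_congr rfl fun γ _ => Finset.sum_congr rfl fun δ _ => by ring

/-- Null forms keep their structure under products of vector fields, up to terms of lower order:
in each product at least one of the two derivatives is tangential. The constant is uniform in the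
domain, the point and the two functions. -/
theorem abs_ZI_nullForm_le (k : ℕ) : ∃ C : ℝ, 0 ≤ C ∧ ∀ {D : Set Spacetime} {x S₁ S₂ : Spacetime},
    UniqueDiffOn ℝ D → D ⊆ closure (interior D) → x ∈ D → rad x ≠ 0 → IsSphereFrame x S₁ S₂ →
    ∀ {φ ψ : Spacetime → ℝ}, ContDiffOn ℝ (k + 1 : ℕ) φ D → ContDiffOn ℝ (k + 1 : ℕ) ψ D →
    ∀ (a a' b b' : ℝ≥0⟦X⟧),
    (∀ J : MultiIndex, J.length ≤ k → ∀ γ,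
      |fderivWithin ℝ (ZI D J φ) D x (e γ)| ≤ PowerSeries.coeff J.length a) →
    (∀ J : MultiIndex, J.length ≤ k → ∀ β,
      |fderivWithin ℝ (ZI D J φ) D x (dbarVec x β)| ≤ PowerSeries.coeff J.length a') →
    (∀ J : MultiIndex, J.length ≤ k → ∀ γ,
      |fderivWithin ℝ (ZI D J ψ) D x (e γ)| ≤ PowerSeries.coeff J.length b) →
    (∀ J : MultiIndex, J.length ≤ k → ∀ β,
      |fderivWithin ℝ (ZI D J ψ) D x (dbarVec x β)| ≤ PowerSeries.coeff J.length b') →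
    ∀ {c : Fin 4 → Fin 4 → ℝ}, IsNullSymbol c → ∀ {M : ℝ}, (∀ γ δ, |c γ δ| ≤ M) →
    ∀ I : MultiIndex, I.length = k → |ZI D I (nullForm c D φ ψ) x| ≤
      C * M * PowerSeries.coeff k ((geom : Unit → ℝ≥0⟦X⟧) () * (a' * b + a * b')) := by
  induction k with
  | zero =>
    refine ⟨40000, by norm_num, ?_⟩
    intro D x S₁ S₂ hD hD' hx hr hS φ ψ hφ hψ a a' b b' ha ha' hb hb' c hc M hM I hI
    obtain rfl : I = [] := List.length_eq_zero_iff.mp hI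
    refine (abs_nullSymbol_le hr hS hc hM (fderivWithin ℝ φ D x).toLinearMap
      (fderivWithin ℝ ψ D x).toLinearMap (ha [] le_rfl) (ha' [] le_rfl) (hb [] le_rfl)
      (hb' [] le_rfl)).trans (le_of_eq ?_)
    simp [geom, PowerSeries.coeff_mul]
  | succ k ih =>
    obtain ⟨C, hC0, hC⟩ := ih
    refine ⟨2 * C + C * (8 * ∑ ι : VField, ‖ι.lin‖), by positivity, ?_⟩
    intro D x S₁ S₂ hD hD' hx hr hS φ ψ hφ hψ a a' b b' ha ha' hb hb' c hc M hM I hI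
    have hM0 : 0 ≤ M := (abs_nonneg _).trans (hM 0 0)
    obtain ⟨K, ι, rfl⟩ : ∃ K ι, I = K ++ [ι] := by
      rcases List.eq_nil_or_concat I with rfl | ⟨K, ι, rfl⟩
      · simp at hI
      · exact ⟨K, ι, by simp⟩
    have hK : K.length = k := by simpa using hI
    have hφ1 : ContDiffOn ℝ (k + 1 : ℕ) φ D := hφ.of_le (by exact_mod_cast Nat.le_succ _)
    have hψ1 : ContDiffOn ℝ (k + 1 : ℕ) ψ D := hψ.of_le (by exact_mod_cast Nat.le_succ _)
    have h2 : ((2 : ℕ) : WithTop ℕ∞) ≤ ((k + 1 + 1 : ℕ) : WithTop ℕ∞) := by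
      exact_mod_cast (by omega)
    have hZφ := contDiffOn_Z1 hD hφ ι
    have hZψ := contDiffOn_Z1 hD hψ ι
    have hshift : ∀ {χ : Spacetime → ℝ} {s : ℝ≥0⟦X⟧} {v : Spacetime},
        (∀ J : MultiIndex, J.length ≤ k + 1 →
          |fderivWithin ℝ (ZI D J χ) D x v| ≤ PowerSeries.coeff J.length s) →
        ∀ J : MultiIndex, J.length ≤ k →
          |fderivWithin ℝ (ZI D J (Z1 D ι χ)) D x v| ≤ PowerSeries.coeff J.length (shift s) := by
      intro χ s v hs J hJ
      rw [← ZI_append_singleton]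
      simpa [shift] using hs (J ++ [ι]) (by simpa using hJ)
    have e1 := hC hD hD' hx hr hS hZφ hψ1 (shift a) (shift a') b b'
      (fun J hJ γ => hshift (fun J hJ => ha J hJ γ) J hJ)
      (fun J hJ β => hshift (fun J hJ => ha' J hJ β) J hJ)
      (fun J hJ => hb J (by omega)) (fun J hJ => hb' J (by omega)) hc hM K hK
    have e2 := hC hD hD' hx hr hS hφ1 hZψ a a' (shift b) (shift b')
      (fun J hJ => ha J (by omega)) (fun J hJ => ha' J (by omega))
      (fun J hJ γ => hshift (fun J hJ => hb J hJ γ) J hJ)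
      (fun J hJ β => hshift (fun J hJ => hb' J hJ β) J hJ) hc hM K hK
    have hneg : IsNullSymbol fun γ δ => -commSymbol ι c γ δ := by
      obtain ⟨t, ht⟩ := hc.comm ι
      exact ⟨-t, fun γ δ => by linear_combination -(ht γ δ)⟩
    have e3 := hC hD hD' hx hr hS hφ1 hψ1 a a' b b'
      (fun J hJ => ha J (by omega)) (fun J hJ => ha' J (by omega))
      (fun J hJ => hb J (by omega)) (fun J hJ => hb' J (by omega)) hneg
      (M := 8 * (M * ‖ι.lin‖)) (fun γ δ => by rw [abs_neg]; exact abs_commSymbol_le hM ι γ δ) K hK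
    have r1 := contDiffOn_nullForm hD c hZφ hψ1
    have r2 := contDiffOn_nullForm hD c hφ1 hZψ
    have r3 := contDiffOn_nullForm hD (fun γ δ => -commSymbol ι c γ δ) hφ1 hψ1
    rw [ZI_append_singleton, ZI_congr (Z1_nullForm hD hD' ι c (by exact_mod_cast hφ.of_le h2)
      (by exact_mod_cast hψ.of_le h2)) K hx]
    subst hK
    rw [(ZI_add hD K (r1.add r2) r3 hx).trans (congrArg (· + _) (ZI_add hD K r1 r2 hx))]
    set Γ := (geom : Unit → ℝ≥0⟦X⟧) () with hΓ
    have hX : ∀ s s' : ℝ≥0⟦X⟧, (∀ j, PowerSeries.coeff j s ≤ PowerSeries.coeff (j + 1) s') →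
        ((PowerSeries.coeff K.length (Γ * s) : ℝ≥0) : ℝ) ≤
          PowerSeries.coeff (K.length + 1) (Γ * s') := by
      intro s s' hs
      have g1 := coeff_geom_mul (a := fun _ => s) () K.length
      have g2 := coeff_geom_mul (a := fun _ => s') () (K.length + 1)
      rw [Pi.mul_apply] at g1 g2
      rw [g1, g2, Finset.sum_range_succ' (n := K.length + 1)]
      exact_mod_cast (Finset.sum_le_sum fun j _ => hs j).trans le_self_add
    have b1 := hX (shift a' * b + shift a * b') (a' * b + a * b') fun j => by
      rw [map_add, map_add]
      exact add_le_add (coeff_shift_mul_le _ _ _) (coeff_shift_mul_le _ _ _)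
    have b2 := hX (a' * shift b + a * shift b') (a' * b + a * b') fun j => by
      rw [map_add, map_add]
      exact add_le_add (coeff_mul_shift_le _ _ _) (coeff_mul_shift_le _ _ _)
    have b3 : ((PowerSeries.coeff K.length (Γ * (a' * b + a * b')) : ℝ≥0) : ℝ) ≤
          PowerSeries.coeff (K.length + 1) (Γ * (a' * b + a * b')) := by
      have g1 := coeff_geom_mul (a := fun _ => a' * b + a * b') () K.length
      have g2 := coeff_geom_mul (a := fun _ => a' * b + a * b') () (K.length + 1)
      rw [Pi.mul_apply] at g1 g2
      rw [g1, g2, Finset.sum_range_succ (n := K.length + 1)]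
      exact_mod_cast le_self_add
    have hι : ‖ι.lin‖ ≤ ∑ ι : VField, ‖ι.lin‖ :=
      Finset.single_le_sum (f := fun ι : VField => ‖ι.lin‖) (fun _ _ => norm_nonneg _)
        (Finset.mem_univ ι)
    set G : ℝ := ((PowerSeries.coeff (K.length + 1) (Γ * (a' * b + a * b')) : ℝ≥0) : ℝ) with hG
    have hG0 : 0 ≤ G := NNReal.coe_nonneg _
    calc _ ≤ C * M * G + C * M * G + C * (8 * (M * ‖ι.lin‖)) * G := by
          refine (abs_add_le _ _).trans (add_le_add ((abs_add_le _ _).trans (add_le_add ?_ ?_)) ?_)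
          · exact e1.trans (by gcongr)
          · exact e2.trans (by gcongr)
          · exact e3.trans (by gcongr)
      _ ≤ C * M * G + C * M * G + C * (8 * (M * ∑ ι : VField, ‖ι.lin‖)) * G := by gcongr
      _ = _ := by ring

variable {κ : Type*} {P : PointFamily κ} {n : ℕ} {a a' b b' : κ → ℝ≥0⟦X⟧}
  {F₁ F₂ : κ → Spacetime}

/-- `DbarMaj P n f a`: as `DMaj`, for the tangential derivatives `∂̄ Z^J f i`. -/
def DbarMaj (P : PointFamily κ) (n : ℕ) (f : κ → Spacetime → ℝ) (a : κ → ℝ≥0⟦X⟧) : Prop :=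
  ∃ C : ℝ≥0, ∀ i (J : MultiIndex), J.length ≤ n → ∀ β,
    ‖fderivWithin ℝ (ZI (P.dom i) J (f i)) (P.dom i) (P.pt i) (dbarVec (P.pt i) β)‖₊ ≤
      C * PowerSeries.coeff J.length (a i)

theorem maj_nullForm (hr : ∀ i, rad (P.pt i) ≠ 0) (hF : ∀ i, IsSphereFrame (P.pt i) (F₁ i) (F₂ i))
    {c : Fin 4 → Fin 4 → ℝ} (hc : IsNullSymbol c) {φ ψ : κ → Spacetime → ℝ}
    (hφ : DMaj P n φ a) (hφ' : DbarMaj P n φ a') (hψ : DMaj P n ψ b) (hψ' : DbarMaj P n ψ b') :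
    Maj P n (fun i => nullForm c (P.dom i) (φ i) (ψ i)) (geom * (a' * b + a * b')) := by
  obtain ⟨hφ1, A, hA⟩ := hφ
  obtain ⟨hψ1, B, hB⟩ := hψ
  obtain ⟨A', hA'⟩ := hφ'
  obtain ⟨B', hB'⟩ := hψ'
  choose K hK0 hK using abs_ZI_nullForm_le
  let M : ℝ := ∑ γ, ∑ δ, |c γ δ|
  have hM : ∀ γ δ, |c γ δ| ≤ M := fun γ δ =>
    (Finset.single_le_sum (f := fun δ => |c γ δ|) (fun _ _ => abs_nonneg _)
      (Finset.mem_univ δ)).trans (Finset.single_le_sum (f := fun γ => ∑ δ, |c γ δ|)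
        (fun _ _ => Finset.sum_nonneg fun _ _ => abs_nonneg _) (Finset.mem_univ γ))
  have hM0 : 0 ≤ M := (abs_nonneg _).trans (hM 0 0)
  let N : ℝ≥0 := A' * B + A * B'
  refine ⟨fun i => contDiffOn_nullForm (P.uniqueDiff i) c (hφ1 i) (hψ1 i),
    (∑ k ∈ Finset.range (n + 1), (K k).toNNReal) * M.toNNReal * N, fun i J hJ => ?_⟩
  have hle : ((J.length + 1 : ℕ) : WithTop ℕ∞) ≤ ((n + 1 : ℕ) : WithTop ℕ∞) := by
    exact_mod_cast Nat.succ_le_succ hJ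
  have h1 := hK J.length (P.uniqueDiff i) (P.subset_closure i) (P.mem i) (hr i) (hF i)
    ((hφ1 i).of_le hle) ((hψ1 i).of_le hle) (PowerSeries.C A * a i) (PowerSeries.C A' * a' i)
    (PowerSeries.C B * b i) (PowerSeries.C B' * b' i)
    (fun L hL γ => by rw [PowerSeries.coeff_C_mul]; exact_mod_cast hA i L (hL.trans hJ) γ)
    (fun L hL γ => by rw [PowerSeries.coeff_C_mul]; exact_mod_cast hA' i L (hL.trans hJ) γ)
    (fun L hL γ => by rw [PowerSeries.coeff_C_mul]; exact_mod_cast hB i L (hL.trans hJ) γ)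
    (fun L hL γ => by rw [PowerSeries.coeff_C_mul]; exact_mod_cast hB' i L (hL.trans hJ) γ)
    hc hM J rfl
  have h2 : PowerSeries.coeff J.length ((geom : Unit → ℝ≥0⟦X⟧) () *
      (PowerSeries.C A' * a' i * (PowerSeries.C B * b i)
        + PowerSeries.C A * a i * (PowerSeries.C B' * b' i))) ≤
      N * PowerSeries.coeff J.length ((geom * (a' * b + a * b') : κ → ℝ≥0⟦X⟧) i) := by
    have h3 : (geom : Unit → ℝ≥0⟦X⟧) () * (PowerSeries.C A' * a' i * (PowerSeries.C B * b i)
        + PowerSeries.C A * a i * (PowerSeries.C B' * b' i)) =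
        PowerSeries.C (A' * B) * (geom i * (a' i * b i))
          + PowerSeries.C (A * B') * (geom i * (a i * b' i)) := by
      rw [map_mul, map_mul]
      simp only [geom]
      ring
    rw [h3, map_add, PowerSeries.coeff_C_mul, PowerSeries.coeff_C_mul]
    simp only [Pi.mul_apply, Pi.add_apply, mul_add, map_add, N, add_mul]
    exact add_le_add le_self_add le_add_self
  rw [← NNReal.coe_le_coe, coe_nnnorm, Real.norm_eq_abs]
  refine h1.trans ?_
  have h4 : K J.length ≤ ((∑ k ∈ Finset.range (n + 1), (K k).toNNReal : ℝ≥0) : ℝ) := by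
    rw [← Real.coe_toNNReal _ (hK0 J.length)]
    exact_mod_cast Finset.single_le_sum (f := fun k => (K k).toNNReal) (fun _ _ => zero_le)
      (Finset.mem_range.mpr (by omega))
  rw [mul_assoc (_ * _) N]
  simp only [NNReal.coe_mul, Real.coe_toNNReal M hM0]
  have h5 : ((PowerSeries.coeff J.length ((geom : Unit → ℝ≥0⟦X⟧) () *
      (PowerSeries.C A' * a' i * (PowerSeries.C B * b i)
        + PowerSeries.C A * a i * (PowerSeries.C B' * b' i))) : ℝ≥0) : ℝ) ≤
      (N : ℝ) * (PowerSeries.coeff J.length ((geom * (a' * b + a * b') : κ → ℝ≥0⟦X⟧) i) : ℝ≥0) := by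
    exact_mod_cast h2
  exact mul_le_mul (mul_le_mul_of_nonneg_right h4 hM0) h5 (NNReal.coe_nonneg _)
    (mul_nonneg (NNReal.coe_nonneg _) hM0)

end nullforms

/-! ### Frame components of 2-tensors and the wave coordinates condition -/

section tensors

/-- The 2-tensors at a point, as arrays of components. -/
abbrev Tensor := Fin 4 → Fin 4 → ℝ

/-- The component `k(V, W) = V^α W^β k_{αβ}`. -/
def con (k : Tensor) (V W : Spacetime) : ℝ := ∑ α, ∑ β, V α * W β * k α β

theorem con_add (k k' : Tensor) (V W : Spacetime) : con (k + k') V W = con k V W + con k' V W := by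
  simp only [con, Pi.add_apply, mul_add, Finset.sum_add_distrib]

theorem con_smul (c : ℝ) (k : Tensor) (V W : Spacetime) : con (c • k) V W = c * con k V W := by
  simp only [con, Pi.smul_apply, smul_eq_mul, Finset.mul_sum]
  exact Finset.sum_congr rfl fun _ _ => Finset.sum_congr rfl fun _ _ => by ring

theorem con_symm {k : Tensor} (hk : ∀ α β, k α β = k β α) (V W : Spacetime) :
    con k V W = con k W V := by
  rw [con, Finset.sum_comm]
  exact Finset.sum_congr rfl fun β _ => Finset.sum_congr rfl fun α _ => by rw [hk α β]; ring

theorem con_e (k : Tensor) (α β : Fin 4) : con k (e α) (e β) = k α β := by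
  simp [con, e]

/-- `con` as a bilinear form of the two vectors. -/
def conBilin (k : Tensor) : Spacetime →ₗ[ℝ] Spacetime →ₗ[ℝ] ℝ :=
  LinearMap.mk₂ ℝ (con k)
    (fun V V' W => by simp only [con, PiLp.add_apply, add_mul, Finset.sum_add_distrib])
    (fun c V W => by
      simp only [con, PiLp.smul_apply, smul_eq_mul, Finset.mul_sum]
      exact Finset.sum_congr rfl fun _ _ => Finset.sum_congr rfl fun _ _ => by ring)
    (fun V W W' => by simp only [con, PiLp.add_apply, mul_add, add_mul, Finset.sum_add_distrib])
    (fun c V W => by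
      simp only [con, PiLp.smul_apply, smul_eq_mul, Finset.mul_sum]
      exact Finset.sum_congr rfl fun _ _ => Finset.sum_congr rfl fun _ _ => by ring)

theorem conBilin_apply (k : Tensor) (V W : Spacetime) : conBilin k V W = con k V W := rfl

/-- `con` as a continuous linear functional of the tensor. -/
def conCLM (V W : Spacetime) : Tensor →L[ℝ] ℝ :=
  LinearMap.toContinuousLinearMap
    { toFun := fun k => con k V W
      map_add' := fun k k' => con_add k k' V W
      map_smul' := fun c k => con_smul c k V W }

theorem conCLM_apply (V W : Spacetime) (k : Tensor) : conCLM V W k = con k V W := rfl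

/-- The contraction of the linearized wave coordinates condition with `v`, for the derivative `l`
of a tensor precomposed with `N`. -/
def waveForm (v : Spacetime) (N : Spacetime →L[ℝ] Spacetime) (l : Spacetime →L[ℝ] Tensor) : ℝ :=
  2 * ∑ α, ∑ β, mUp α β * con (l (N (e α))) (e β) v
    - ∑ α, ∑ β, mUp α β * con (l (N v)) (e α) (e β)

/-- `waveForm` with `N = 1` as a functional of the derivative. -/
def waveCLM (v : Spacetime) : (Spacetime →L[ℝ] Tensor) →L[ℝ] ℝ :=
  LinearMap.toContinuousLinearMap
    { toFun := waveForm v (ContinuousLinearMap.id ℝ Spacetime)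
      map_add' := fun l l' => by
        simp only [waveForm, add_apply, con_add, mul_add, Finset.sum_add_distrib]
        ring
      map_smul' := fun c l => by
        simp only [waveForm, smul_apply, con_smul, mul_left_comm _ c, ← Finset.mul_sum,
          RingHom.id_apply, smul_eq_mul, mul_sub] }

variable {x S₁ S₂ : Spacetime}

theorem sum_mUp_bilin (hr : rad x ≠ 0) (hS : IsSphereFrame x S₁ S₂)
    (b : Spacetime →ₗ[ℝ] Spacetime →ₗ[ℝ] ℝ) : ∑ α, ∑ β, mUp α β * b (e α) (e β) =
      ∑ a, frameCoeff a * b (frameVec x S₁ S₂ (frameX a)) (frameVec x S₁ S₂ (frameY a)) := by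
  rw [sum_mUp_mul hr hS]
  refine Finset.sum_congr rfl fun a _ => congrArg _ ?_
  have h : ∀ V W : Spacetime, ∑ α, ∑ β, V α * W β * b (e α) (e β) = b V W := by
    intro V W
    conv_rhs => rw [← sum_smul_e V, ← sum_smul_e W]
    simp only [map_sum, LinearMap.sum_apply, map_smul, LinearMap.smul_apply, smul_eq_mul,
      Finset.mul_sum]
    exact Finset.sum_comm.trans (Finset.sum_congr rfl fun _ _ =>
      Finset.sum_congr rfl fun _ _ => by ring)
  exact h _ _

theorem waveForm_eq_frame (hr : rad x ≠ 0) (hS : IsSphereFrame x S₁ S₂) (v : Spacetime)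
    (N : Spacetime →L[ℝ] Spacetime) (l : Spacetime →L[ℝ] Tensor) :
    waveForm v N l = 2 * ∑ a, frameCoeff a *
        con (l (N (frameVec x S₁ S₂ (frameX a)))) (frameVec x S₁ S₂ (frameY a)) v
      - ∑ a, frameCoeff a *
        con (l (N v)) (frameVec x S₁ S₂ (frameX a)) (frameVec x S₁ S₂ (frameY a)) := by
  rw [waveForm]
  congr 1
  · congr 1
    exact sum_mUp_bilin hr hS (LinearMap.mk₂ ℝ (fun w w' => con (l (N w)) w' v)
      (fun a b w => by rw [map_add, map_add, con_add])
      (fun c a w => by rw [map_smul, map_smul, con_smul]; rfl)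
      (fun a b b' => by simp only [← conBilin_apply, map_add, LinearMap.add_apply])
      (fun c a b => by simp only [← conBilin_apply, map_smul, LinearMap.smul_apply]))
  · exact sum_mUp_bilin hr hS (conBilin (l (N v)))

/-- The linear functional `w ↦ l(w)(V, W)`. -/
def conLin (l : Spacetime →L[ℝ] Tensor) (V W : Spacetime) : Spacetime →ₗ[ℝ] ℝ :=
  ((conCLM V W) ∘L l).toLinearMap

theorem conLin_apply (l : Spacetime →L[ℝ] Tensor) (V W v : Spacetime) :
    conLin l V W v = con (l v) V W := rfl

/-- In the wave coordinates condition contracted with `L`, the only derivative along `L̲` is the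
one of the component `LL`. -/
theorem abs_con_Lbar_le (hr : rad x ≠ 0) (hS : IsSphereFrame x S₁ S₂)
    (l : Spacetime →L[ℝ] Tensor) {q : ℝ}
    (hq : ∀ V W β, |con (l (dbarVec x β)) (frameVec x S₁ S₂ V) (frameVec x S₁ S₂ W)| ≤ q) :
    |con (l (frameVec x S₁ S₂ .Lbar)) (frameVec x S₁ S₂ .L) (frameVec x S₁ S₂ .L)| ≤
      |waveForm (frameVec x S₁ S₂ .L) (ContinuousLinearMap.id ℝ Spacetime) l| + 24 * q := by
  have h : ∀ U V W, U ≠ FrameLabel.Lbar → |con (l (frameVec x S₁ S₂ U)) (frameVec x S₁ S₂ V)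
      (frameVec x S₁ S₂ W)| ≤ 3 * q := fun U V W hU =>
    abs_apply_tangent_le hS (conLin l _ _) (hq V W) hU
  rw [waveForm_eq_frame hr hS]
  simp only [Fin.sum_univ_four, frameCoeff, frameX, frameY, Matrix.cons_val_zero,
    Matrix.cons_val_one, Matrix.cons_val, ContinuousLinearMap.id_apply]
  have a1 := abs_le.mp (h .L .Lbar .L (by simp))
  have a2 := abs_le.mp (h .S1 .S1 .L (by simp))
  have a3 := abs_le.mp (h .S2 .S2 .L (by simp))
  have a4 := abs_le.mp (h .L .L .Lbar (by simp))
  have a5 := abs_le.mp (h .L .S1 .S1 (by simp))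
  have a6 := abs_le.mp (h .L .S2 .S2 (by simp))
  set w := 2 * (-(1 / 2) * con (l (frameVec x S₁ S₂ .L)) (frameVec x S₁ S₂ .Lbar)
    (frameVec x S₁ S₂ .L) + -(1 / 2) * con (l (frameVec x S₁ S₂ .Lbar)) (frameVec x S₁ S₂ .L)
    (frameVec x S₁ S₂ .L) + 1 * con (l (frameVec x S₁ S₂ .S1)) (frameVec x S₁ S₂ .S1)
    (frameVec x S₁ S₂ .L) + 1 * con (l (frameVec x S₁ S₂ .S2)) (frameVec x S₁ S₂ .S2)
    (frameVec x S₁ S₂ .L)) - (-(1 / 2) * con (l (frameVec x S₁ S₂ .L)) (frameVec x S₁ S₂ .L)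
    (frameVec x S₁ S₂ .Lbar) + -(1 / 2) * con (l (frameVec x S₁ S₂ .L)) (frameVec x S₁ S₂ .Lbar)
    (frameVec x S₁ S₂ .L) + 1 * con (l (frameVec x S₁ S₂ .L)) (frameVec x S₁ S₂ .S1)
    (frameVec x S₁ S₂ .S1) + 1 * con (l (frameVec x S₁ S₂ .L)) (frameVec x S₁ S₂ .S2)
    (frameVec x S₁ S₂ .S2)) with hw
  have a7 := neg_abs_le w
  have a8 := le_abs_self w
  rw [abs_le]
  constructor <;> linarith

theorem norm_N_frameVec_le (hr : rad x ≠ 0) (hS : IsSphereFrame x S₁ S₂)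
    (N : Spacetime →L[ℝ] Spacetime) (V : FrameLabel) :
    ‖N (frameVec x S₁ S₂ V)‖ ≤ 2 * ‖N‖ := by
  refine (N.le_opNorm _).trans ?_
  rw [mul_comm]
  exact mul_le_mul_of_nonneg_right (norm_frameVec_le hr hS V) (norm_nonneg _)

/-- A commutator with a conformal vector field maps `L` to a vector without `L̲` component, so it
produces only tangential derivatives and components of type `LT` in the wave coordinates
condition. -/
theorem abs_waveForm_le (hr : rad x ≠ 0) (hS : IsSphereFrame x S₁ S₂)
    (l : Spacetime →L[ℝ] Tensor) (N : Spacetime →L[ℝ] Spacetime)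
    (hN : theta x (N (frameVec x S₁ S₂ .L)) = 0) {q q' : ℝ}
    (hsymm : ∀ v V W, con (l v) V W = con (l v) W V)
    (hq : ∀ V W β, |con (l (dbarVec x β)) (frameVec x S₁ S₂ V) (frameVec x S₁ S₂ W)| ≤ q)
    (hq' : ∀ W, W ≠ FrameLabel.Lbar → |con (l (frameVec x S₁ S₂ .Lbar)) (frameVec x S₁ S₂ .L)
      (frameVec x S₁ S₂ W)| ≤ q') :
    |waveForm (frameVec x S₁ S₂ .L) N l| ≤ 2000 * ‖N‖ * (q + q') := by
  have hq0 : 0 ≤ q := (abs_nonneg _).trans (hq .L .L 0)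
  have hq0' : 0 ≤ q' := (abs_nonneg _).trans (hq' .L (by simp))
  have h1 : ∀ U V W, |con (l (N (frameVec x S₁ S₂ U))) (frameVec x S₁ S₂ V)
      (frameVec x S₁ S₂ W) - theta x (N (frameVec x S₁ S₂ U)) * con (l (frameVec x S₁ S₂ .Lbar))
        (frameVec x S₁ S₂ V) (frameVec x S₁ S₂ W)| ≤ 144 * (‖N‖ * q) := by
    intro U V W
    refine (abs_sub_theta_le hr hS (conLin l _ _) (hq V W) _).trans ?_
    have := mul_le_mul_of_nonneg_right (norm_N_frameVec_le hr hS N U) hq0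
    linarith
  have h2 : ∀ U V, V ≠ FrameLabel.Lbar → |theta x (N (frameVec x S₁ S₂ U)) *
      con (l (frameVec x S₁ S₂ .Lbar)) (frameVec x S₁ S₂ V) (frameVec x S₁ S₂ .L)| ≤
        8 * (‖N‖ * q') := by
    intro U V hV
    rw [abs_mul, hsymm]
    have h3 : |theta x (N (frameVec x S₁ S₂ U))| ≤ 8 * ‖N‖ := by
      refine (abs_theta_le hr _).trans ?_
      linarith [norm_N_frameVec_le hr hS N U]
    calc _ ≤ (8 * ‖N‖) * q' := mul_le_mul h3 (hq' V hV) (abs_nonneg _) (by positivity)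
      _ = _ := by ring
  rw [waveForm_eq_frame hr hS]
  simp only [Fin.sum_univ_four, frameCoeff, frameX, frameY, Matrix.cons_val_zero,
    Matrix.cons_val_one, Matrix.cons_val]
  have hNq : 0 ≤ ‖N‖ * q := by positivity
  have hNq' : 0 ≤ ‖N‖ * q' := by positivity
  have b1 := abs_le.mp (h1 .L .Lbar .L)
  have b2 := abs_le.mp (h1 .Lbar .L .L)
  have b3 := abs_le.mp (h1 .S1 .S1 .L)
  have b4 := abs_le.mp (h1 .S2 .S2 .L)
  have b5 := abs_le.mp (h1 .L .L .Lbar)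
  have b7 := abs_le.mp (h1 .L .S1 .S1)
  have b8 := abs_le.mp (h1 .L .S2 .S2)
  rw [hN, zero_mul, sub_zero] at b1 b5 b7 b8
  have c2 := abs_le.mp (h2 .Lbar .L (by simp))
  have c3 := abs_le.mp (h2 .S1 .S1 (by simp))
  have c4 := abs_le.mp (h2 .S2 .S2 (by simp))
  rw [mul_assoc, mul_add, abs_le]
  constructor <;> linarith

theorem abs_waveForm_le_full (hr : rad x ≠ 0) (hS : IsSphereFrame x S₁ S₂)
    (l : Spacetime →L[ℝ] Tensor) (N : Spacetime →L[ℝ] Spacetime) {q : ℝ}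
    (hq : ∀ V W γ, |con (l (e γ)) (frameVec x S₁ S₂ V) (frameVec x S₁ S₂ W)| ≤ q) :
    |waveForm (frameVec x S₁ S₂ .L) N l| ≤ 100 * ‖N‖ * q := by
  have hq0 : 0 ≤ q := (abs_nonneg _).trans (hq .L .L 0)
  have h1 : ∀ U V W, |con (l (N (frameVec x S₁ S₂ U))) (frameVec x S₁ S₂ V)
      (frameVec x S₁ S₂ W)| ≤ 8 * (‖N‖ * q) := by
    intro U V W
    have h2 := nnnorm_clm_apply_le (l := (conCLM (frameVec x S₁ S₂ V) (frameVec x S₁ S₂ W)) ∘L l)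
      (C := ⟨q, hq0⟩) (fun γ => hq V W γ) (N (frameVec x S₁ S₂ U))
    have h3 : |con (l (N (frameVec x S₁ S₂ U))) (frameVec x S₁ S₂ V) (frameVec x S₁ S₂ W)| ≤
        4 * ‖N (frameVec x S₁ S₂ U)‖ * q := h2
    have := mul_le_mul_of_nonneg_right (norm_N_frameVec_le hr hS N U) hq0
    linarith
  rw [waveForm_eq_frame hr hS]
  simp only [Fin.sum_univ_four, frameCoeff, frameX, frameY, Matrix.cons_val_zero,
    Matrix.cons_val_one, Matrix.cons_val]
  have hNq : 0 ≤ ‖N‖ * q := by positivity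
  have b1 := abs_le.mp (h1 .L .Lbar .L)
  have b2 := abs_le.mp (h1 .Lbar .L .L)
  have b3 := abs_le.mp (h1 .S1 .S1 .L)
  have b4 := abs_le.mp (h1 .S2 .S2 .L)
  have b5 := abs_le.mp (h1 .L .L .Lbar)
  have b7 := abs_le.mp (h1 .L .S1 .S1)
  have b8 := abs_le.mp (h1 .L .S2 .S2)
  rw [mul_assoc, abs_le]
  constructor <;> linarith

variable {E : Type*} [NormedAddCommGroup E] [NormedSpace ℝ E] {D : Set Spacetime}

/-- Products of vector fields applied to a total derivative. -/
theorem ZI_fderivWithin_op (hD : UniqueDiffOn ℝ D) (hD' : D ⊆ closure (interior D))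
    (I : MultiIndex) {f : Spacetime → E} (hf : ContDiffOn ℝ (I.length + 1 : ℕ) f D) {x : Spacetime}
    (hx : x ∈ D) : ZI D I (fderivWithin ℝ f D) x = fderivWithin ℝ (ZI D I f) D x
      + ((commTerms I).map fun p => fderivWithin ℝ (ZI D p.2 f) D x ∘L p.1).sum := by
  ext1 v
  have h1 := ZI_clm hD (ContinuousLinearMap.apply ℝ E v) I (f := fderivWithin ℝ f D)
    (hf.fderivWithin hD (by push_cast; rfl)) hx
  have h2 := ZI_fderivWithin hD hD' I hf v hx
  have h3 : ∀ l : List ((Spacetime →L[ℝ] Spacetime) × MultiIndex),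
      (l.map fun p => fderivWithin ℝ (ZI D p.2 f) D x ∘L p.1).sum v =
        (l.map fun p => fderivWithin ℝ (ZI D p.2 f) D x (p.1 v)).sum := by
    intro l
    induction l with
    | nil => simp
    | cons p l ih => simp [ih]
  rw [add_apply, h3]
  exact h1.symm.trans h2

theorem fderivWithin_ZI_clm {F : Type*} [NormedAddCommGroup F] [NormedSpace ℝ F]
    (hD : UniqueDiffOn ℝ D) (l : E →L[ℝ] F) (I : MultiIndex) {f : Spacetime → E}
    (hf : ContDiffOn ℝ (I.length + 1 : ℕ) f D) {x : Spacetime} (hx : x ∈ D) (v : Spacetime) :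
    fderivWithin ℝ (ZI D I fun y => l (f y)) D x v = l (fderivWithin ℝ (ZI D I f) D x v) := by
  have h1 := ZI_clm hD l I (hf.of_le (by exact_mod_cast Nat.le_succ _))
  rw [fderivWithin_congr h1 (h1 hx)]
  have h2 : ContDiffOn ℝ (1 : ℕ) (ZI D I f) D := contDiffOn_ZI hD I (by rwa [add_comm])
  have h3 := (l.hasFDerivAt.comp_hasFDerivWithinAt x
    ((h2.differentiableOn (by simp)) x hx).hasFDerivWithinAt).fderivWithin (hD x hx)
  simp only [Function.comp_def] at h3
  rw [h3]
  rfl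

theorem con_fderivWithin_ZI_symm (hD : UniqueDiffOn ℝ D) (I : MultiIndex) {K : Spacetime → Tensor}
    (hK : ContDiffOn ℝ (I.length + 1 : ℕ) K D) (hsymm : ∀ y ∈ D, ∀ α β, K y α β = K y β α)
    {x : Spacetime} (hx : x ∈ D) (v V W : Spacetime) :
    con (fderivWithin ℝ (ZI D I K) D x v) V W = con (fderivWithin ℝ (ZI D I K) D x v) W V := by
  have h1 : Set.EqOn (ZI D I fun y => conCLM V W (K y)) (ZI D I fun y => conCLM W V (K y)) D :=
    ZI_congr (fun y hy => con_symm (hsymm y hy) V W) I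
  rw [← conCLM_apply, ← conCLM_apply, ← fderivWithin_ZI_clm hD _ I hK hx,
    ← fderivWithin_ZI_clm hD _ I hK hx, fderivWithin_congr h1 (h1 hx)]

variable {κ : Type*} {P : PointFamily κ} {n : ℕ} {F₁ F₂ : κ → Spacetime}
  {K : κ → Spacetime → Tensor} {Hb LT dH W₀ : κ → ℝ≥0⟦X⟧}

theorem theta_neg_lin (hr : rad x ≠ 0) (ι : VField) :
    theta x ((-ι.lin) (frameVec x S₁ S₂ .L)) = 0 := by
  have h1 := mform_lin_self ι (mform_L_self (S₁ := S₁) (S₂ := S₂) hr)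
  have h2 : ∀ v w, mform v (-w) = -mform w v := fun v w => by
    rw [mform_eq, mform_eq]; simp; ring
  rw [theta, neg_apply, h2]
  have h3 : mform (ι.lin (frameVec x S₁ S₂ .L)) (e 0 + dr x) = 0 := h1
  rw [h3]; simp

/-- The components of the derivatives of a family of tensors in a family of null frames. The frame
vectors are those at the point of the family, extended as constant vectors, so that they commute
with `Z^J`. -/
def dcon (P : PointFamily κ) (F₁ F₂ : κ → Spacetime) (K : κ → Spacetime → Tensor) (i : κ)
    (J : MultiIndex) (v : Spacetime) (V W : FrameLabel) : ℝ :=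
  con (fderivWithin ℝ (ZI (P.dom i) J (K i)) (P.dom i) (P.pt i) v)
    (frameVec (P.pt i) (F₁ i) (F₂ i) V) (frameVec (P.pt i) (F₁ i) (F₂ i) W)

/-- The derivative of the component `h_{LL}` is controlled by the wave coordinates condition:
by tangential derivatives, by components `h_{LT}` with one vector field less, by general
derivatives with two vector fields less, and by the nonlinear terms `W₀`. -/
theorem dmaj_LL (hr : ∀ i, rad (P.pt i) ≠ 0) (hF : ∀ i, IsSphereFrame (P.pt i) (F₁ i) (F₂ i))
    (hK : ∀ i, ContDiffOn ℝ (n + 1 : ℕ) (K i) (P.dom i))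
    (hsymm : ∀ i, ∀ y ∈ P.dom i, ∀ α β, K i y α β = K i y β α)
    (hbar : ∃ C : ℝ≥0, ∀ i (J : MultiIndex), J.length ≤ n → ∀ V W β,
      |dcon P F₁ F₂ K i J (dbarVec (P.pt i) β) V W| ≤ C * PowerSeries.coeff J.length (Hb i))
    (hLT : ∃ C : ℝ≥0, ∀ i (J : MultiIndex), J.length ≤ n → ∀ W, W ≠ FrameLabel.Lbar → ∀ γ,
      |dcon P F₁ F₂ K i J (e γ) .L W| ≤ C * PowerSeries.coeff J.length (LT i))
    (hfull : ∃ C : ℝ≥0, ∀ i (J : MultiIndex), J.length ≤ n → ∀ V W γ,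
      |dcon P F₁ F₂ K i J (e γ) V W| ≤ C * PowerSeries.coeff J.length (dH i))
    (hwave : Maj P n (fun i y => waveForm (frameVec (P.pt i) (F₁ i) (F₂ i) .L)
      (ContinuousLinearMap.id ℝ Spacetime) (fderivWithin ℝ (K i) (P.dom i) y)) W₀) :
    DMaj P n (fun i y => con (K i y) (frameVec (P.pt i) (F₁ i) (F₂ i) .L)
        (frameVec (P.pt i) (F₁ i) (F₂ i) .L))
      (geom * Hb + serX * (geom * LT) + serX ^ 2 * (geom * dH) + W₀) := by
  obtain ⟨C₁, hC₁⟩ := hbar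
  obtain ⟨C₂, hC₂⟩ := hLT
  obtain ⟨C₃, hC₃⟩ := hfull
  obtain ⟨-, C₄, hC₄⟩ := hwave
  set R : κ → ℝ≥0⟦X⟧ := geom * Hb + serX * (geom * LT) + serX ^ 2 * (geom * dH) + W₀ with hR
  have hRb : ∀ i {j k : ℕ}, j ≤ k →
      PowerSeries.coeff j (Hb i) ≤ PowerSeries.coeff k (R i) := by
    intro i j k hjk
    refine (coeff_le_coeff_geom_mul (a := Hb) i hjk).trans ?_
    simp only [hR, Pi.add_apply, map_add, add_assoc]
    exact le_self_add
  have hRl : ∀ i {j k : ℕ}, j + 1 ≤ k →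
      PowerSeries.coeff j (LT i) ≤ PowerSeries.coeff k (R i) := by
    intro i j k hjk
    obtain ⟨m, rfl⟩ : ∃ m, k = m + 1 := ⟨k - 1, by omega⟩
    refine (coeff_le_coeff_geom_mul (a := LT) i (Nat.le_of_succ_le_succ hjk)).trans ?_
    have h1 : PowerSeries.coeff m ((geom * LT : κ → ℝ≥0⟦X⟧) i) =
        PowerSeries.coeff (m + 1) ((serX * (geom * LT) : κ → ℝ≥0⟦X⟧) i) := by
      rw [Pi.mul_apply serX]; exact (PowerSeries.coeff_succ_X_mul _ _).symm
    rw [h1]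
    simp only [hR, Pi.add_apply, map_add]
    exact le_add_self.trans (le_self_add.trans le_self_add)
  have hRd : ∀ i {j k : ℕ}, j + 2 ≤ k →
      PowerSeries.coeff j (dH i) ≤ PowerSeries.coeff k (R i) := by
    intro i j k hjk
    obtain ⟨m, rfl⟩ : ∃ m, k = m + 2 := ⟨k - 2, by omega⟩
    refine (coeff_le_coeff_geom_mul (a := dH) i (show j ≤ m by omega)).trans ?_
    have h1 : PowerSeries.coeff m ((geom * dH : κ → ℝ≥0⟦X⟧) i) =
        PowerSeries.coeff (m + 2) ((serX ^ 2 * (geom * dH) : κ → ℝ≥0⟦X⟧) i) := by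
      rw [Pi.mul_apply (serX ^ 2)]; exact (PowerSeries.coeff_X_pow_mul _ 2 m).symm
    rw [h1]
    simp only [hR, Pi.add_apply, map_add]
    exact le_add_self.trans le_self_add
  have hRw : ∀ i {k : ℕ}, PowerSeries.coeff k (W₀ i) ≤ PowerSeries.coeff k (R i) := by
    intro i k
    simp only [hR, Pi.add_apply, map_add]
    exact le_add_self
  -- the terms of lower order in the commuted wave coordinates condition
  have hterm : ∀ i (J : MultiIndex), J.length ≤ n → ∀ p ∈ commTerms J,
      |waveForm (frameVec (P.pt i) (F₁ i) (F₂ i) .L) p.1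
        (fderivWithin ℝ (ZI (P.dom i) p.2 (K i)) (P.dom i) (P.pt i))| ≤
      (2000 * ‖p.1‖ * (C₁ + 8 * C₂) + 100 * ‖p.1‖ * C₃) *
        (PowerSeries.coeff J.length (R i) : ℝ≥0) := by
    intro i J hJ p hp
    rw [add_mul]
    rcases mem_commTerms hp with ⟨⟨ι, hι⟩, hlen⟩ | hlen
    · have hLbar : ∀ W, W ≠ FrameLabel.Lbar →
          |dcon P F₁ F₂ K i p.2 (frameVec (P.pt i) (F₁ i) (F₂ i) .Lbar) .L W| ≤
            8 * (C₂ * PowerSeries.coeff p.2.length (LT i)) := by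
        intro W hW
        have h2 := nnnorm_clm_apply_le (l := (conCLM (frameVec (P.pt i) (F₁ i) (F₂ i) .L)
          (frameVec (P.pt i) (F₁ i) (F₂ i) W)) ∘L
            fderivWithin ℝ (ZI (P.dom i) p.2 (K i)) (P.dom i) (P.pt i))
          (C := C₂ * PowerSeries.coeff p.2.length (LT i))
          (fun γ => hC₂ i p.2 (by omega) W hW γ) (frameVec (P.pt i) (F₁ i) (F₂ i) .Lbar)
        have h3 : |dcon P F₁ F₂ K i p.2 (frameVec (P.pt i) (F₁ i) (F₂ i) .Lbar) .L W| ≤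
            4 * ‖frameVec (P.pt i) (F₁ i) (F₂ i) .Lbar‖ *
              (C₂ * PowerSeries.coeff p.2.length (LT i) : ℝ≥0) := h2
        refine h3.trans ?_
        push_cast
        have h4 := norm_frameVec_le (hr i) (hF i) .Lbar
        have h5 : (0 : ℝ) ≤ C₂ * (PowerSeries.coeff p.2.length (LT i) : ℝ≥0) := by positivity
        nlinarith
      have h1 := abs_waveForm_le (hr i) (hF i)
        (fderivWithin ℝ (ZI (P.dom i) p.2 (K i)) (P.dom i) (P.pt i)) p.1
        (by rw [hι]; exact theta_neg_lin (hr i) ι)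
        (fun v V W => con_fderivWithin_ZI_symm (P.uniqueDiff i) p.2
          ((hK i).of_le (by exact_mod_cast (by omega))) (hsymm i) (P.mem i) v V W)
        (fun V W β => hC₁ i p.2 (by omega) V W β) hLbar
      refine (h1.trans ?_).trans (le_add_of_nonneg_right (by positivity))
      have g1 : ((PowerSeries.coeff p.2.length (Hb i) : ℝ≥0) : ℝ) ≤
        (PowerSeries.coeff J.length (R i) : ℝ≥0) := by exact_mod_cast hRb i (by omega)
      have g2 : ((PowerSeries.coeff p.2.length (LT i) : ℝ≥0) : ℝ) ≤
        (PowerSeries.coeff J.length (R i) : ℝ≥0) := by exact_mod_cast hRl i (by omega)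
      calc _ ≤ 2000 * ‖p.1‖ * (C₁ * (PowerSeries.coeff J.length (R i) : ℝ≥0)
            + 8 * (C₂ * (PowerSeries.coeff J.length (R i) : ℝ≥0))) := by gcongr
        _ = _ := by ring
    · have h1 := abs_waveForm_le_full (hr i) (hF i)
        (fderivWithin ℝ (ZI (P.dom i) p.2 (K i)) (P.dom i) (P.pt i)) p.1
        (fun V W γ => hC₃ i p.2 (by omega) V W γ)
      refine (h1.trans ?_).trans (le_add_of_nonneg_left (by positivity))
      have g1 : ((PowerSeries.coeff p.2.length (dH i) : ℝ≥0) : ℝ) ≤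
        (PowerSeries.coeff J.length (R i) : ℝ≥0) := by exact_mod_cast hRd i (by omega)
      calc _ ≤ 100 * ‖p.1‖ * (C₃ * (PowerSeries.coeff J.length (R i) : ℝ≥0)) := by gcongr
        _ = _ := by ring
  let κJ : MultiIndex → ℝ := fun J =>
    ((commTerms J).map fun p => 2000 * ‖p.1‖ * (C₁ + 8 * C₂) + 100 * ‖p.1‖ * C₃).sum
  have hκ0 : ∀ J, 0 ≤ κJ J := fun J => List.sum_nonneg fun c hc => by
    obtain ⟨p, -, rfl⟩ := List.mem_map.mp hc
    positivity
  have hwaveJ : ∀ i (J : MultiIndex), J.length ≤ n →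
      |waveForm (frameVec (P.pt i) (F₁ i) (F₂ i) .L) (ContinuousLinearMap.id ℝ Spacetime)
        (fderivWithin ℝ (ZI (P.dom i) J (K i)) (P.dom i) (P.pt i))| ≤
      (C₄ + κJ J) * (PowerSeries.coeff J.length (R i) : ℝ≥0) := by
    intro i J hJ
    have hKJ : ContDiffOn ℝ (J.length + 1 : ℕ) (K i) (P.dom i) :=
      (hK i).of_le (by exact_mod_cast (by omega))
    have h1 := ZI_clm (P.uniqueDiff i) (waveCLM (frameVec (P.pt i) (F₁ i) (F₂ i) .L)) J
      (f := fderivWithin ℝ (K i) (P.dom i))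
      (hKJ.fderivWithin (P.uniqueDiff i) (by push_cast; rfl)) (P.mem i)
    simp only at h1
    rw [ZI_fderivWithin_op (P.uniqueDiff i) (P.subset_closure i) J hKJ (P.mem i), map_add] at h1
    have h2 := hC₄ i J hJ
    have h3 : |waveCLM (frameVec (P.pt i) (F₁ i) (F₂ i) .L) ((commTerms J).map fun p =>
        fderivWithin ℝ (ZI (P.dom i) p.2 (K i)) (P.dom i) (P.pt i) ∘L p.1).sum| ≤
        κJ J * (PowerSeries.coeff J.length (R i) : ℝ≥0) := by
      have h4 : ∀ l : List ((Spacetime →L[ℝ] Spacetime) × MultiIndex), (∀ p ∈ l,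
          p ∈ commTerms J) → |waveCLM (frameVec (P.pt i) (F₁ i) (F₂ i) .L) (l.map fun p =>
            fderivWithin ℝ (ZI (P.dom i) p.2 (K i)) (P.dom i) (P.pt i) ∘L p.1).sum| ≤
          (l.map fun p => 2000 * ‖p.1‖ * (C₁ + 8 * C₂) + 100 * ‖p.1‖ * C₃).sum *
            (PowerSeries.coeff J.length (R i) : ℝ≥0) := by
        intro l
        induction l with
        | nil => simp
        | cons p l ih =>
          intro hl
          simp only [List.map_cons, List.sum_cons, map_add, add_mul]
          refine (abs_add_le _ _).trans (add_le_add ?_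
            ((ih fun q hq => hl q (List.mem_cons_of_mem _ hq)).trans_eq ?_))
          · rw [← add_mul]
            exact hterm i J hJ p (hl p List.mem_cons_self)
          · rfl
      exact h4 _ fun p hp => hp
    have h5 : |ZI (P.dom i) J (fun y => waveCLM (frameVec (P.pt i) (F₁ i) (F₂ i) .L)
        (fderivWithin ℝ (K i) (P.dom i) y)) (P.pt i)| ≤
        C₄ * (PowerSeries.coeff J.length (R i) : ℝ≥0) := by
      refine le_trans (b := (C₄ : ℝ) * (PowerSeries.coeff J.length (W₀ i) : ℝ≥0))
        (by exact_mod_cast h2) ?_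
      gcongr
      exact hRw i
    rw [h1] at h5
    have h7 := abs_le.mp h5
    have h8 := abs_le.mp h3
    have h9 : waveForm (frameVec (P.pt i) (F₁ i) (F₂ i) .L) (ContinuousLinearMap.id ℝ Spacetime)
        (fderivWithin ℝ (ZI (P.dom i) J (K i)) (P.dom i) (P.pt i)) =
      waveCLM (frameVec (P.pt i) (F₁ i) (F₂ i) .L)
        (fderivWithin ℝ (ZI (P.dom i) J (K i)) (P.dom i) (P.pt i)) := rfl
    rw [h9, abs_le, add_mul]
    constructor <;> linarith
  refine ⟨fun i => (conCLM _ _).contDiff.comp_contDiffOn (hK i),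
    ∑ J ∈ multiIndices n, (4 * (C₄ + κJ J + 24 * C₁) + 72 * C₁).toNNReal, fun i J hJ γ => ?_⟩
  have hKJ : ContDiffOn ℝ (J.length + 1 : ℕ) (K i) (P.dom i) :=
    (hK i).of_le (by exact_mod_cast (by omega))
  have e1 := fderivWithin_ZI_clm (P.uniqueDiff i) (conCLM (frameVec (P.pt i) (F₁ i) (F₂ i) .L)
    (frameVec (P.pt i) (F₁ i) (F₂ i) .L)) J hKJ (P.mem i) (e γ)
  simp only [conCLM_apply] at e1
  rw [e1]
  have hb : ∀ V W β, |dcon P F₁ F₂ K i J (dbarVec (P.pt i) β) V W| ≤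
      C₁ * (PowerSeries.coeff J.length (R i) : ℝ≥0) := fun V W β => by
    refine (hC₁ i J hJ V W β).trans ?_
    gcongr
    exact hRb i le_rfl
  have e2 := abs_con_Lbar_le (hr i) (hF i)
    (fderivWithin ℝ (ZI (P.dom i) J (K i)) (P.dom i) (P.pt i)) hb
  have e3 := abs_sub_theta_le (hr i) (hF i)
    (conLin (fderivWithin ℝ (ZI (P.dom i) J (K i)) (P.dom i) (P.pt i))
      (frameVec (P.pt i) (F₁ i) (F₂ i) .L) (frameVec (P.pt i) (F₁ i) (F₂ i) .L)) (hb .L .L) (e γ)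
  have e4 := abs_theta_le (hr i) (e γ)
  have e5 := hwaveJ i J hJ
  rw [norm_e] at e3 e4
  simp only [conLin_apply] at e3
  rw [← NNReal.coe_le_coe, coe_nnnorm, Real.norm_eq_abs, NNReal.coe_mul]
  set ρ : ℝ := ((PowerSeries.coeff J.length (R i) : ℝ≥0) : ℝ) with hρ
  have hρ0 : 0 ≤ ρ := NNReal.coe_nonneg _
  set X₁ := con (fderivWithin ℝ (ZI (P.dom i) J (K i)) (P.dom i) (P.pt i) (e γ))
    (frameVec (P.pt i) (F₁ i) (F₂ i) .L) (frameVec (P.pt i) (F₁ i) (F₂ i) .L)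
  set X₂ := con (fderivWithin ℝ (ZI (P.dom i) J (K i)) (P.dom i) (P.pt i)
    (frameVec (P.pt i) (F₁ i) (F₂ i) .Lbar))
    (frameVec (P.pt i) (F₁ i) (F₂ i) .L) (frameVec (P.pt i) (F₁ i) (F₂ i) .L)
  have e6 : |theta (P.pt i) (e γ) * X₂| ≤ 4 * ((C₄ + κJ J + 24 * C₁) * ρ) := by
    rw [abs_mul]
    refine mul_le_mul (by linarith) (e2.trans ?_) (abs_nonneg _) (by norm_num)
    linarith
  have e7 : |X₁| ≤ (4 * (C₄ + κJ J + 24 * C₁) + 72 * C₁) * ρ := by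
    have := abs_le.mp e3
    have := abs_le.mp e6
    rw [abs_le]
    constructor <;> linarith
  refine e7.trans (mul_le_mul_of_nonneg_right ?_ hρ0)
  refine (Real.le_coe_toNNReal _).trans ?_
  exact_mod_cast Finset.single_le_sum (f := fun J =>
    (4 * ((C₄ : ℝ) + κJ J + 24 * C₁) + 72 * C₁).toNNReal) (fun _ _ => zero_le)
    (mem_multiIndices.mpr hJ)

end tensors

/-! ### The quadratic forms `P` and `Q` -/

section quadratic

variable {x S₁ S₂ : Spacetime}

theorem sum_sum_outer (u w : Fin 4 → ℝ) (V W : Spacetime) :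
    ∑ α, ∑ β, V α * W β * (u α * w β) = (∑ α, V α * u α) * ∑ β, W β * w β := by
  rw [Finset.sum_mul_sum]
  exact Finset.sum_congr rfl fun _ _ => Finset.sum_congr rfl fun _ _ => by ring

/-- The full contraction of two tensors in the null frame. -/
theorem sum_contraction_eq_frame (hr : rad x ≠ 0) (hS : IsSphereFrame x S₁ S₂) (k l : Tensor) :
    ∑ α, ∑ α', mUp α α' * ∑ β, ∑ β', mUp β β' * (k α β * l α' β') =
      ∑ a, ∑ b, frameCoeff a * frameCoeff b *
        (con k (frameVec x S₁ S₂ (frameX a)) (frameVec x S₁ S₂ (frameX b)) *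
          con l (frameVec x S₁ S₂ (frameY a)) (frameVec x S₁ S₂ (frameY b))) := by
  have h1 : ∀ α α', ∑ β, ∑ β', mUp β β' * (k α β * l α' β') = ∑ b, frameCoeff b *
      ((∑ β, frameVec x S₁ S₂ (frameX b) β * k α β) *
        ∑ β', frameVec x S₁ S₂ (frameY b) β' * l α' β') := by
    intro α α'
    rw [sum_mUp_mul hr hS]
    exact Finset.sum_congr rfl fun b _ => by rw [sum_sum_outer]
  simp only [h1]
  rw [sum_mUp_mul hr hS]
  refine Finset.sum_congr rfl fun a _ => ?_
  have h2 : ∀ (k : Tensor) (V W : Spacetime), con k V W = ∑ α, V α * ∑ β, W β * k α β := by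
    intro k V W
    simp only [con, Finset.mul_sum, mul_assoc]
  simp only [h2, mul_assoc, ← Finset.mul_sum]
  congr 1
  have h3 := fun b => sum_sum_outer (fun α => ∑ β, frameVec x S₁ S₂ (frameX b) β * k α β)
    (fun α' => ∑ β', frameVec x S₁ S₂ (frameY b) β' * l α' β') (frameVec x S₁ S₂ (frameX a))
    (frameVec x S₁ S₂ (frameY a))
  simp only [← h3]
  simp only [Finset.mul_sum]
  rw [Finset.sum_congr rfl fun α _ => Finset.sum_comm, Finset.sum_comm]
  refine Finset.sum_congr rfl fun b _ => Finset.sum_congr rfl fun α _ =>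
    Finset.sum_congr rfl fun α' _ => ?_
  simp only [← Finset.mul_sum]
  ring

theorem Pform_eq_frame (hr : rad x ≠ 0) (hS : IsSphereFrame x S₁ S₂)
    (p : Fin 4 → Tensor) (μ ν : Fin 4) : Pform mUp p μ ν =
      (1 / 4) * ((∑ b, frameCoeff b *
          con (p μ) (frameVec x S₁ S₂ (frameX b)) (frameVec x S₁ S₂ (frameY b))) *
        ∑ a, frameCoeff a *
          con (p ν) (frameVec x S₁ S₂ (frameX a)) (frameVec x S₁ S₂ (frameY a)))
      - (1 / 2) * ∑ a, ∑ b, frameCoeff a * frameCoeff b *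
        (con (p ν) (frameVec x S₁ S₂ (frameX a)) (frameVec x S₁ S₂ (frameX b)) *
          con (p μ) (frameVec x S₁ S₂ (frameY a)) (frameVec x S₁ S₂ (frameY b))) := by
  rw [← sum_contraction_eq_frame hr hS]
  have h1 := sum_mUp_mul hr hS (p μ)
  have h2 := sum_mUp_mul hr hS (p ν)
  simp only [con]
  have e1 : (∑ α, ∑ β, mUp α β * p μ α β) * (∑ α, ∑ β, mUp α β * p ν α β) =
      ∑ α, ∑ α', ∑ β, ∑ β', mUp α α' * mUp β β' * (p μ β β' * p ν α α') := by
    rw [mul_comm]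
    simp only [Finset.sum_mul]
    simp only [Finset.mul_sum]
    exact Finset.sum_congr rfl fun _ _ => Finset.sum_congr rfl fun _ _ =>
      Finset.sum_congr rfl fun _ _ => Finset.sum_congr rfl fun _ _ => by ring
  rw [← h1, ← h2, e1]
  simp only [Pform, Finset.mul_sum, ← Finset.sum_sub_distrib]
  exact Finset.sum_congr rfl fun _ _ => Finset.sum_congr rfl fun _ _ =>
    Finset.sum_congr rfl fun _ _ => Finset.sum_congr rfl fun _ _ => by ring

variable {κ : Type*} {P : PointFamily κ} {n : ℕ} {F₁ F₂ : κ → Spacetime}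
  {K : κ → Spacetime → Tensor} {Hb dH R TU H : κ → ℝ≥0⟦X⟧}

theorem con_fderivWithin {D : Set Spacetime} (hD : UniqueDiffOn ℝ D) {k : Spacetime → Tensor}
    (hk : ContDiffOn ℝ (1 : ℕ) k D) (v V W : Spacetime) :
    Set.EqOn (fun y => con (fderivWithin ℝ k D y v) V W)
      (fun y => fderivWithin ℝ (fun y => con (k y) V W) D y v) D := fun y hy =>
  (fderivWithin_ZI_clm hD (conCLM V W) [] (by simpa using hk) hy v).symm

/-- In the pairings of the expansion of `m⁻¹ ⊗ m⁻¹`, a component `L̲L̲` of one factor is paired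
with the component `LL` of the other one. -/
theorem frameLabel_cases (a b : Fin 4) :
    ((frameX a ≠ .Lbar ∨ frameX b ≠ .Lbar) ∧ (frameY a ≠ .Lbar ∨ frameY b ≠ .Lbar)) ∨
    (frameX a = .L ∧ frameX b = .L) ∨ (frameY a = .L ∧ frameY b = .L) := by
  fin_cases a <;> fin_cases b <;> simp [frameX, frameY]

/-- The weak null structure of `P`: the component `L̲L̲` of one factor only meets the component
`LL` of the other one. -/
theorem maj_Pform (hr : ∀ i, rad (P.pt i) ≠ 0) (hF : ∀ i, IsSphereFrame (P.pt i) (F₁ i) (F₂ i))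
    (hK : ∀ i, ContDiffOn ℝ (n + 1 : ℕ) (K i) (P.dom i))
    (hTU : ∀ V W, V ≠ FrameLabel.Lbar ∨ W ≠ FrameLabel.Lbar →
      DMaj P n (fun i y => con (K i y) (frameVec (P.pt i) (F₁ i) (F₂ i) V)
        (frameVec (P.pt i) (F₁ i) (F₂ i) W)) TU)
    (hLL : DMaj P n (fun i y => con (K i y) (frameVec (P.pt i) (F₁ i) (F₂ i) .L)
        (frameVec (P.pt i) (F₁ i) (F₂ i) .L)) R)
    (hfull : ∀ V W, DMaj P n (fun i y => con (K i y) (frameVec (P.pt i) (F₁ i) (F₂ i) V)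
        (frameVec (P.pt i) (F₁ i) (F₂ i) W)) dH) (μ ν : Fin 4) :
    Maj P n (fun i y => Pform mUp (fun γ => fderivWithin ℝ (K i) (P.dom i) y (e γ)) μ ν)
      (geom * (TU * TU) + geom * (R * dH)) := by
  set S : κ → ℝ≥0⟦X⟧ := geom * (TU * TU) + geom * (R * dH) with hSdef
  have key : ∀ {V W a}, DMaj P n (fun i y => con (K i y) (frameVec (P.pt i) (F₁ i) (F₂ i) V)
      (frameVec (P.pt i) (F₁ i) (F₂ i) W)) a → ∀ γ,
      Maj P n (fun i y => con (fderivWithin ℝ (K i) (P.dom i) y (e γ))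
        (frameVec (P.pt i) (F₁ i) (F₂ i) V) (frameVec (P.pt i) (F₁ i) (F₂ i) W)) (geom * a) :=
    fun h γ => (h.pd γ).congr fun i => con_fderivWithin (P.uniqueDiff i)
      ((hK i).of_le (by exact_mod_cast Nat.le_add_left 1 n)) _ _ _
  have hsq : ∀ a b : κ → ℝ≥0⟦X⟧, Below n (geom * a * (geom * b)) (geom * (a * b)) := fun a b => by
    have := below_geom_pow_mul (n := n) 2 (a * b)
    rwa [show geom ^ 2 * (a * b) = geom * a * (geom * b) by ring] at this
  have hS1 : Below n (geom * TU * (geom * TU)) S :=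
    (hsq TU TU).trans (Below.of_add_eq (geom * (R * dH)) rfl)
  have hS2 : Below n (geom * R * (geom * dH)) S :=
    (hsq R dH).trans (Below.of_add_eq (geom * (TU * TU)) (by rw [hSdef, add_comm]))
  have hS3 : Below n (geom * dH * (geom * R)) S := by rw [mul_comm (geom * dH)]; exact hS2
  refine Maj.congr (f := fun i y => _) ?_ fun i y _ => Pform_eq_frame (hr i) (hF i) _ μ ν
  refine Maj.sub ?_ ?_
  · refine Maj.const_mul ?_ _
    refine (Maj.mul (Maj.sum _ fun b _ => (key (hTU _ _ ?_) μ).const_mul _)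
      (Maj.sum _ fun b _ => (key (hTU _ _ ?_) ν).const_mul _)).mono hS1
    all_goals fin_cases b <;> simp [frameX, frameY]
  · refine Maj.const_mul (Maj.sum _ fun a _ => Maj.sum _ fun b _ => Maj.const_mul ?_ _) _
    rcases frameLabel_cases a b with ⟨h1, h2⟩ | ⟨h1, h2⟩ | ⟨h1, h2⟩
    · exact ((key (hTU _ _ h1) ν).mul (key (hTU _ _ h2) μ)).mono hS1
    · rw [h1, h2]
      exact ((key hLL ν).mul (key (hfull _ _) μ)).mono hS2
    · rw [h1, h2]
      exact ((key (hfull _ _) ν).mul (key hLL μ)).mono hS3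

/-- The symbol of the null form `∂_a φ ∂_b ψ - ∂_b φ ∂_a ψ`. -/
def skewSymbol (a b : Fin 4) (γ δ : Fin 4) : ℝ :=
  (if γ = a then 1 else 0) * (if δ = b then 1 else 0)
    - (if γ = b then 1 else 0) * (if δ = a then 1 else 0)

theorem isNullSymbol_skewSymbol (a b : Fin 4) : IsNullSymbol (skewSymbol a b) :=
  ⟨0, fun γ δ => by simp only [skewSymbol]; ring⟩

theorem isNullSymbol_mUp : IsNullSymbol mUp :=
  ⟨2, fun γ δ => by rw [mUp_eq, mUp_eq, mink_symm δ γ]; ring⟩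

theorem nullForm_skewSymbol (a b : Fin 4) (D : Set Spacetime) (φ ψ : Spacetime → ℝ)
    (y : Spacetime) : nullForm (skewSymbol a b) D φ ψ y =
      pd D a φ y * pd D b ψ y - pd D b φ y * pd D a ψ y := by
  simp only [nullForm, skewSymbol, sub_mul, Finset.sum_sub_distrib, pd]
  congr 1
  · simp only [ite_mul, one_mul, zero_mul, Finset.sum_ite_eq', Finset.mem_univ, if_true,
      Finset.sum_ite_irrel, Finset.sum_const_zero]
  · simp only [ite_mul, one_mul, zero_mul, Finset.sum_ite_eq', Finset.mem_univ, if_true,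
      Finset.sum_ite_irrel, Finset.sum_const_zero]

/-- `Q` is a linear combination of null forms of the components of `h`. -/
theorem Qform_eq_nullForm (D : Set Spacetime) (h : Fin 4 → Fin 4 → Spacetime → ℝ) (y : Spacetime)
    (μ ν : Fin 4) : Qform mUp (dh D h y) μ ν =
      ∑ β, ∑ β', mUp β β' * nullForm mUp D (h β μ) (h β' ν) y
      + ∑ α, ∑ α', ∑ β, ∑ β', mUp α α' * mUp β β' *
        (-nullForm (skewSymbol α β') D (h β μ) (h α' ν) y
          + nullForm (skewSymbol μ α) D (h α' β') (h β ν) y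
          + nullForm (skewSymbol ν α) D (h α' β') (h β μ) y
          + (1 / 2) * nullForm (skewSymbol β' μ) D (h α α') (h β ν) y
          + (1 / 2) * nullForm (skewSymbol β' ν) D (h α α') (h β μ) y) := by
  have h1 : ∑ β, ∑ β', mUp β β' * nullForm mUp D (h β μ) (h β' ν) y =
      ∑ α, ∑ α', ∑ β, ∑ β', mUp α α' * mUp β β' * (pd D α (h β μ) y * pd D α' (h β' ν) y) := by
    simp only [nullForm, Finset.mul_sum]
    refine (Finset.sum_congr rfl fun β _ => Finset.sum_comm).trans (Finset.sum_comm.trans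
      (Finset.sum_congr rfl fun α _ => (Finset.sum_congr rfl fun β _ =>
        Finset.sum_comm).trans (Finset.sum_comm.trans (Finset.sum_congr rfl fun α' _ =>
          Finset.sum_congr rfl fun β _ => Finset.sum_congr rfl fun β' _ => ?_))))
    simp only [pd]
    ring
  rw [h1]
  simp only [Qform, dh, nullForm_skewSymbol, ← Finset.sum_add_distrib]
  exact Finset.sum_congr rfl fun α _ => Finset.sum_congr rfl fun α' _ =>
    Finset.sum_congr rfl fun β _ => Finset.sum_congr rfl fun β' _ => by ring

variable {h : κ → Fin 4 → Fin 4 → Spacetime → ℝ}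

theorem maj_Qform (hr : ∀ i, rad (P.pt i) ≠ 0) (hF : ∀ i, IsSphereFrame (P.pt i) (F₁ i) (F₂ i))
    (hh : ∀ α β, DMaj P n (fun i => h i α β) dH)
    (hbar : ∀ α β, DbarMaj P n (fun i => h i α β) Hb) (μ ν : Fin 4) :
    Maj P n (fun i y => Qform mUp (dh (P.dom i) (h i) y) μ ν) (geom * (Hb * dH)) := by
  have key : ∀ {c}, IsNullSymbol c → ∀ α β γ δ, Maj P n
      (fun i y => nullForm c (P.dom i) (h i α β) (h i γ δ) y) (geom * (Hb * dH)) := by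
    intro c hc α β γ δ
    refine (maj_nullForm hr hF hc (hh α β) (hbar α β) (hh γ δ) (hbar γ δ)).mono ?_
    refine Below.mul_left _ (Below.add (Below.refl _) ?_)
    rw [mul_comm]
    exact Below.refl _
  refine Maj.congr (f := fun i y => _) ?_ fun i y _ => Qform_eq_nullForm (P.dom i) (h i) y μ ν
  refine Maj.add (Maj.sum _ fun β _ => Maj.sum _ fun β' _ =>
    (key isNullSymbol_mUp _ _ _ _).const_mul _) ?_
  refine Maj.sum _ fun α _ => Maj.sum _ fun α' _ => Maj.sum _ fun β _ => Maj.sum _ fun β' _ => ?_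
  have k := fun a b => key (isNullSymbol_skewSymbol a b)
  exact ((((((k _ _ _ _ _ _).neg).add (k _ _ _ _ _ _)).add (k _ _ _ _ _ _)).add
    ((k _ _ _ _ _ _).const_mul _)).add ((k _ _ _ _ _ _).const_mul _)).const_mul _

/-! ### The wave coordinates condition -/

/-- The wave coordinates condition, freed of the outer inverse metric. -/
theorem WaveCoordinates.sum_eq_zero {D : Set Spacetime} {k : Fin 4 → Fin 4 → Spacetime → ℝ}
    (hw : WaveCoordinates D k) {y : Spacetime} (hy : y ∈ D) (hdet : IsUnit (gMat k y).det)
    (δ : Fin 4) : ∑ α, ∑ β, gUp k y α β *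
      (pd D α (k β δ) y + pd D β (k α δ) y - pd D δ (k α β) y) = 0 := by
  have hpd : ∀ γ α β, pd D γ (fun z => gMat k z α β) y = pd D γ (k α β) y := by
    intro γ α β
    simp only [pd, gMat, Matrix.of_apply]
    rw [fderivWithin_const_add]
  let w : Fin 4 → ℝ := fun δ => ∑ α, ∑ β, gUp k y α β *
      (pd D α (k β δ) y + pd D β (k α δ) y - pd D δ (k α β) y)
  have h1 : (gMat k y)⁻¹ *ᵥ w = 0 := by
    funext l
    have h2 := hw y hy l
    simp only [christoffel, hpd] at h2
    have h3 : ((gMat k y)⁻¹ *ᵥ w) l = 2 * ∑ α, ∑ β, gUp k y α β * ((1 / 2) * ∑ δ, gUp k y l δ *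
        (pd D α (k β δ) y + pd D β (k α δ) y - pd D δ (k α β) y)) := by
      simp only [Matrix.mulVec, dotProduct, w, Finset.mul_sum]
      rw [Finset.sum_comm]
      refine Finset.sum_congr rfl fun α _ => ?_
      rw [Finset.sum_comm]
      refine Finset.sum_congr rfl fun β _ => Finset.sum_congr rfl fun ε _ => ?_
      simp only [gUp]
      ring
    rw [h3, h2, mul_zero, Pi.zero_apply]
  have h4 : w = 0 := by
    rw [← Matrix.one_mulVec w, ← Matrix.mul_nonsing_inv _ hdet, ← Matrix.mulVec_mulVec, h1,
      Matrix.mulVec_zero]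
  exact congrFun h4 δ

theorem waveForm_id_eq (v : Spacetime) (l : Spacetime →L[ℝ] Tensor) :
    waveForm v (ContinuousLinearMap.id ℝ Spacetime) l = ∑ δ, v δ * ∑ α, ∑ β, mUp α β *
      (l (e α) β δ + l (e β) α δ - l (e δ) α β) := by
  have h1 : ∀ (k : Tensor) β, con k (e β) v = ∑ δ, v δ * k β δ := by
    intro k β
    simp [con, e]
  have h2 : ∀ α β, l v α β = ∑ δ, v δ * l (e δ) α β := by
    intro α β
    conv_lhs => rw [← sum_smul_e v, map_sum]
    simp
  have h3 : ∑ α, ∑ β, mUp α β * (∑ δ, v δ * l (e β) α δ)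
      = ∑ α, ∑ β, mUp α β * (∑ δ, v δ * l (e α) β δ) := by
    rw [Finset.sum_comm]
    refine Finset.sum_congr rfl fun β _ => Finset.sum_congr rfl fun α _ => ?_
    rw [mUp_eq, mUp_eq, mink_symm]
  have h4 : ∑ δ, v δ * ∑ α, ∑ β, mUp α β * (l (e α) β δ + l (e β) α δ - l (e δ) α β)
      = ∑ α, ∑ β, mUp α β * (∑ δ, v δ * l (e α) β δ)
        + ∑ α, ∑ β, mUp α β * (∑ δ, v δ * l (e β) α δ)
        - ∑ α, ∑ β, mUp α β * (∑ δ, v δ * l (e δ) α β) := by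
    simp only [← Finset.sum_add_distrib, ← Finset.sum_sub_distrib, Finset.mul_sum]
    rw [Finset.sum_comm]
    refine Finset.sum_congr rfl fun α _ => ?_
    rw [Finset.sum_comm]
    exact Finset.sum_congr rfl fun β _ => Finset.sum_congr rfl fun δ _ => by ring
  simp only [waveForm, ContinuousLinearMap.id_apply, con_e, h1, h2]
  rw [h4, h3]
  ring

theorem fderivWithin_tensor_apply {D : Set Spacetime} (hD : UniqueDiffOn ℝ D)
    {k : Fin 4 → Fin 4 → Spacetime → ℝ} (hk : ∀ α β, ContDiffOn ℝ (1 : ℕ) (k α β) D)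
    {y : Spacetime} (hy : y ∈ D) (v : Spacetime) (α β : Fin 4) :
    fderivWithin ℝ (fun y α β => k α β y) D y v α β = fderivWithin ℝ (k α β) D y v := by
  have h1 := con_fderivWithin hD (k := fun y α β => k α β y)
    (contDiffOn_pi.mpr fun α => contDiffOn_pi.mpr fun β => hk α β) v (e α) (e β) hy
  simpa only [con_e] using h1

/-- The wave coordinates condition with `m⁻¹` in place of `g⁻¹` holds up to terms quadratic in
`(h, ∂h)`. -/
theorem maj_waveForm (hr : ∀ i, rad (P.pt i) ≠ 0)
    (hF : ∀ i, IsSphereFrame (P.pt i) (F₁ i) (F₂ i))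
    (hh : ∀ α β, DMaj P n (fun i => h i α β) dH)
    (hg : ∀ α β, Maj P n (fun i y => gUp (h i) y α β - mUp α β) (geom * H))
    (hdet : ∀ i, ∀ y ∈ P.dom i, IsUnit (gMat (h i) y).det)
    (hw : ∀ i, WaveCoordinates (P.dom i) (h i)) :
    Maj P n (fun i y => waveForm (frameVec (P.pt i) (F₁ i) (F₂ i) .L)
      (ContinuousLinearMap.id ℝ Spacetime)
      (fderivWithin ℝ (fun y α β => h i α β y) (P.dom i) y)) (geom * (H * dH)) := by
  have heq : ∀ i, Set.EqOn (fun y => waveForm (frameVec (P.pt i) (F₁ i) (F₂ i) .L)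
      (ContinuousLinearMap.id ℝ Spacetime)
      (fderivWithin ℝ (fun y α β => h i α β y) (P.dom i) y))
      (fun y => ∑ δ, frameVec (P.pt i) (F₁ i) (F₂ i) .L δ * -∑ α, ∑ β,
        (gUp (h i) y α β - mUp α β) * (pd (P.dom i) α (h i β δ) y + pd (P.dom i) β (h i α δ) y
          - pd (P.dom i) δ (h i α β) y)) (P.dom i) := by
    intro i y hy
    simp only
    rw [waveForm_id_eq]
    refine Finset.sum_congr rfl fun δ _ => congrArg _ ?_
    have h1 := (hw i).sum_eq_zero hy (hdet i y hy) δ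
    simp only [sub_mul _ _ (_ - _), Finset.sum_sub_distrib, h1]
    rw [zero_sub, neg_neg]
    have hk : ∀ α β, ContDiffOn ℝ (1 : ℕ) (h i α β) (P.dom i) := fun α β =>
      ((hh α β).1 i).of_le (by exact_mod_cast Nat.le_add_left 1 n)
    simp only [fderivWithin_tensor_apply (P.uniqueDiff i) hk hy, pd]
  refine Maj.congr ?_ heq
  refine Maj.sum _ fun δ _ => Maj.family_mul (Maj.neg (Maj.sum _ fun α _ => Maj.sum _ fun β _ =>
    ((hg α β).mul ((((hh β δ).pd α).add ((hh α δ).pd β)).sub ((hh α β).pd δ))).mono ?_))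
    ⟨2, fun i => ?_⟩
  · have := below_geom_pow_mul (n := n) 2 (H * dH)
    rwa [show geom ^ 2 * (H * dH) = geom * H * (geom * dH) by ring] at this
  · exact (PiLp.norm_apply_le _ δ).trans (norm_frameVec_le (hr i) (hF i) .L)

end quadratic

/-! ### Families of solutions and the generating series of their norms -/

/-- A point of the slab, with fields defined on the slab that satisfy the hypotheses of the
estimates at that point. -/
structure Sol (n : ℕ) (Ct : ℝ) where
  T : ℝ
  h : Fin 4 → Fin 4 → Spacetime → ℝ
  A : Fin 4 → Spacetime → su2
  Φ : Spacetime → Doublet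
  V : ℝ → ℝ
  pt : Spacetime
  pos : 0 < T
  contDiffOn_h : ∀ μ ν, ContDiffOn ℝ ((n + 1 : ℕ) : WithTop ℕ∞) (h μ ν) (slab T)
  contDiffOn_A : ∀ α, ContDiffOn ℝ ((n + 1 : ℕ) : WithTop ℕ∞) (A α) (slab T)
  contDiffOn_Φ : ContDiffOn ℝ ((n + 1 : ℕ) : WithTop ℕ∞) Φ (slab T)
  contDiffOn_V : ContDiffOn ℝ ((n + 1 : ℕ) : WithTop ℕ∞) V (Set.Ici 0)
  lorentzian : ∀ x ∈ slab T, IsLorentzian (gMat h x)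
  wave : WaveCoordinates (slab T) h
  mem : pt ∈ slab T
  small : ∀ J : MultiIndex, J.length ≤ n → normT (ZT (slab T) J h) pt ≤ Ct

namespace Sol

variable {n : ℕ} {Ct : ℝ} (B : InvariantInner) (d : Sol n Ct)

/-- `|Z^J h|` at the point. -/
def hN (J : MultiIndex) : ℝ := normT (ZT (slab d.T) J d.h) d.pt

/-- `|∂ Z^J h|` at the point. -/
def dhN (J : MultiIndex) : ℝ := normDT (slab d.T) (ZT (slab d.T) J d.h) d.pt

/-- `|∂̄ Z^J h|` at the point. -/
def dbarhN (J : MultiIndex) : ℝ := normDbarT (slab d.T) (ZT (slab d.T) J d.h) d.pt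

/-- `|∂ Z^J h|_{𝒱𝒲}` at the point. -/
def frN (S₁ S₂ : Spacetime) (𝒱 𝒲 : Finset FrameLabel) (J : MultiIndex) : ℝ :=
  normDTframe (slab d.T) S₁ S₂ 𝒱 𝒲 (ZT (slab d.T) J d.h) d.pt

/-- `|Z^J A|` at the point. -/
def aN (J : MultiIndex) : ℝ := normA B (ZA (slab d.T) J d.A) d.pt

/-- `|∂ Z^J A|` at the point. -/
def daN (J : MultiIndex) : ℝ := normDA B (slab d.T) (ZA (slab d.T) J d.A) d.pt

/-- `|Z^J Φ|` at the point. -/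
def φN (J : MultiIndex) : ℝ := ‖ZI (slab d.T) J d.Φ d.pt‖

/-- `|∂ Z^J Φ|` at the point. -/
def dφN (J : MultiIndex) : ℝ := normDPhi (slab d.T) (ZI (slab d.T) J d.Φ) d.pt

variable {κ : Type*} (d : κ → Sol n Ct)

/-- The slabs of a family of solutions. -/
def family : PointFamily κ where
  dom i := slab (d i).T
  pt i := (d i).pt
  uniqueDiff i := uniqueDiffOn_slab (d i).pos
  subset_closure i := slab_subset_closure_interior (d i).pos
  mem i := (d i).mem

end Sol

section bounds

variable {n : ℕ} {Ct : ℝ} {κ : Type*} (d : κ → Sol n Ct) (B : InvariantInner)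

theorem nnnorm_le_mul_coeff_ser {E : Type*} [NormedAddCommGroup E] {φ : MultiIndex → ℝ}
    {J : MultiIndex} (hJ : J.length ≤ n) {C : ℝ≥0} {v : E} (h : ‖v‖ ≤ C * φ J) :
    ‖v‖₊ ≤ C * PowerSeries.coeff J.length (ser n φ) := by
  refine le_trans (b := C * (φ J).toNNReal) ?_ (mul_le_mul' le_rfl (le_coeff_ser hJ))
  rw [← NNReal.coe_le_coe]
  push_cast
  exact h.trans (mul_le_mul_of_nonneg_left (le_max_left _ _) C.2)

theorem abs_le_sqrt_sum₂ {f : Fin 4 → Fin 4 → ℝ} (μ ν : Fin 4) :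
    |f μ ν| ≤ Real.sqrt (∑ μ, ∑ ν, f μ ν ^ 2) := by
  refine Real.abs_le_sqrt ?_
  refine (Finset.single_le_sum (f := fun ν => f μ ν ^ 2) (fun _ _ => sq_nonneg _)
    (Finset.mem_univ ν)).trans ?_
  exact Finset.single_le_sum (f := fun μ => ∑ ν, f μ ν ^ 2)
    (fun _ _ => Finset.sum_nonneg fun _ _ => sq_nonneg _) (Finset.mem_univ μ)

theorem abs_le_sqrt_sum₃ {f : Fin 4 → Fin 4 → Fin 4 → ℝ} (μ ν β : Fin 4) :
    |f μ ν β| ≤ Real.sqrt (∑ μ, ∑ ν, ∑ β, f μ ν β ^ 2) := by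
  refine (abs_le_sqrt_sum₂ (f := f μ) ν β).trans (Real.sqrt_le_sqrt ?_)
  exact Finset.single_le_sum (f := fun μ => ∑ ν, ∑ β, f μ ν β ^ 2)
    (fun _ _ => Finset.sum_nonneg fun _ _ => Finset.sum_nonneg fun _ _ => sq_nonneg _)
    (Finset.mem_univ μ)

theorem maj_h (μ ν : Fin 4) : Maj (Sol.family d) n (fun i => (d i).h μ ν)
    fun i => ser n (d i).hN := by
  refine ⟨fun i => ((d i).contDiffOn_h μ ν).of_le (by exact_mod_cast Nat.le_succ n), 1,
    fun i J hJ => nnnorm_le_mul_coeff_ser hJ ?_⟩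
  rw [NNReal.coe_one, one_mul]
  exact abs_le_sqrt_sum₂ (f := fun μ ν => ZT (slab (d i).T) J (d i).h μ ν (d i).pt) μ ν

theorem dmaj_h (μ ν : Fin 4) : DMaj (Sol.family d) n (fun i => (d i).h μ ν)
    fun i => ser n (d i).dhN := by
  refine ⟨fun i => (d i).contDiffOn_h μ ν, 1, fun i J hJ γ => nnnorm_le_mul_coeff_ser hJ ?_⟩
  rw [NNReal.coe_one, one_mul]
  exact abs_le_sqrt_sum₃
    (f := fun μ ν β => pd (slab (d i).T) β (ZT (slab (d i).T) J (d i).h μ ν) (d i).pt) μ ν γ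

theorem dbarMaj_h (μ ν : Fin 4) : DbarMaj (Sol.family d) n (fun i => (d i).h μ ν)
    fun i => ser n (d i).dbarhN := by
  refine ⟨1, fun i J hJ β => nnnorm_le_mul_coeff_ser hJ ?_⟩
  rw [NNReal.coe_one, one_mul]
  exact abs_le_sqrt_sum₃ (f := fun μ ν β => fderivWithin ℝ (ZT (slab (d i).T) J (d i).h μ ν)
    (slab (d i).T) (d i).pt (dbarVec (d i).pt β)) μ ν β

theorem below_serH : Below n (fun i => ser n (d i).hN) geom := by
  refine ⟨(multiIndices n).card * Ct.toNNReal, fun i k hk => ?_⟩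
  refine (coeff_ser_le (C := Ct.toNNReal) (fun J hJ => ?_) k).trans (le_of_eq (by simp [geom]))
  exact ((d i).small J hJ).trans (le_max_left _ _)

theorem InvariantInner.exists_nnnorm_le : ∃ C : ℝ≥0, ∀ f : su2,
    ‖f‖ ≤ C * Real.sqrt (B.ip f f) := by
  obtain ⟨C, hC, h⟩ := B.exists_norm_le
  exact ⟨⟨C, hC.le⟩, h⟩

theorem maj_A (α : Fin 4) : Maj (Sol.family d) n (fun i => (d i).A α)
    fun i => ser n ((d i).aN B) := by
  obtain ⟨C, hC⟩ := B.exists_nnnorm_le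
  refine ⟨fun i => ((d i).contDiffOn_A α).of_le (by exact_mod_cast Nat.le_succ n), C,
    fun i J hJ => nnnorm_le_mul_coeff_ser hJ ((hC _).trans ?_)⟩
  refine mul_le_mul_of_nonneg_left (Real.sqrt_le_sqrt ?_) C.2
  exact Finset.single_le_sum (f := fun α => B.ip (ZA (slab (d i).T) J (d i).A α (d i).pt)
    (ZA (slab (d i).T) J (d i).A α (d i).pt)) (fun _ _ => B.nonneg _) (Finset.mem_univ α)

theorem dmaj_A (α : Fin 4) : DMaj (Sol.family d) n (fun i => (d i).A α)
    fun i => ser n ((d i).daN B) := by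
  obtain ⟨C, hC⟩ := B.exists_nnnorm_le
  refine ⟨fun i => (d i).contDiffOn_A α, C,
    fun i J hJ γ => nnnorm_le_mul_coeff_ser hJ ((hC _).trans ?_)⟩
  refine mul_le_mul_of_nonneg_left (Real.sqrt_le_sqrt ?_) C.2
  refine (Finset.single_le_sum (f := fun β =>
    B.ip (pd (slab (d i).T) β (ZA (slab (d i).T) J (d i).A α) (d i).pt)
    (pd (slab (d i).T) β (ZA (slab (d i).T) J (d i).A α) (d i).pt)) (fun _ _ => B.nonneg _)
    (Finset.mem_univ γ)).trans ?_
  exact Finset.single_le_sum (f := fun α => ∑ β,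
    B.ip (pd (slab (d i).T) β (ZA (slab (d i).T) J (d i).A α) (d i).pt)
    (pd (slab (d i).T) β (ZA (slab (d i).T) J (d i).A α) (d i).pt))
    (fun _ _ => Finset.sum_nonneg fun _ _ => B.nonneg _) (Finset.mem_univ α)

theorem maj_Φ : Maj (Sol.family d) n (fun i => (d i).Φ) fun i => ser n (d i).φN := by
  refine ⟨fun i => (d i).contDiffOn_Φ.of_le (by exact_mod_cast Nat.le_succ n), 1,
    fun i J hJ => nnnorm_le_mul_coeff_ser hJ ?_⟩
  rw [NNReal.coe_one, one_mul]
  exact le_rfl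

theorem dmaj_Φ : DMaj (Sol.family d) n (fun i => (d i).Φ) fun i => ser n (d i).dφN := by
  refine ⟨fun i => (d i).contDiffOn_Φ, 1, fun i J hJ γ => nnnorm_le_mul_coeff_ser hJ ?_⟩
  rw [NNReal.coe_one, one_mul]
  refine Real.le_sqrt_of_sq_le ?_
  exact Finset.single_le_sum
    (f := fun β => ‖pd (slab (d i).T) β (ZI (slab (d i).T) J (d i).Φ) (d i).pt‖ ^ 2)
    (fun _ _ => sq_nonneg _) (Finset.mem_univ γ)

theorem Maj.mul_geom {P : PointFamily κ} {f g : κ → Spacetime → ℝ} (hf : Maj P n f geom)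
    (hg : Maj P n g geom) : Maj P n (fun i y => f i y * g i y) geom :=
  (hf.mul hg).mono below_geom_sq

theorem maj_const_geom {P : PointFamily κ} {E : Type*} [NormedAddCommGroup E] [NormedSpace ℝ E]
    (c : E) : Maj P n (fun _ _ => c) geom :=
  (Maj.const c).mono below_one_geom

end bounds

/-! ### The coefficients, the curvature and the covariant derivative -/

section coefficients

variable {n : ℕ} {Ct : ℝ} {κ : Type*} (d : κ → Sol n Ct) (B : InvariantInner)

theorem Sol.isUnit_det (i : κ) : ∀ y ∈ (Sol.family d).dom i, IsUnit (gMat (d i).h y).det :=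
  fun y hy => ((d i).lorentzian y hy).isUnit_det

theorem maj_sol_gUp (hCt : Ct < 1) (α β : Fin 4) :
    Maj (Sol.family d) n (fun i y => gUp (d i).h y α β) geom := by
  refine maj_gUp (fun μ ν => (maj_h d μ ν).mono (below_serH d)) (Sol.isUnit_det d)
    ⟨(1 / (1 - Ct)).toNNReal, fun i α β => ?_⟩ α β
  rw [← NNReal.coe_le_coe]
  refine le_trans ?_ (le_max_left _ _)
  exact abs_gUp_le hCt ((d i).small [] (Nat.zero_le n)) (Sol.isUnit_det d i _ (d i).mem) α β

theorem maj_sol_gUp_sub (hCt : Ct < 1) (α β : Fin 4) :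
    Maj (Sol.family d) n (fun i y => gUp (d i).h y α β - mUp α β)
      (geom * fun i => ser n (d i).hN) :=
  maj_gUp_sub_mUp (maj_h d) (maj_sol_gUp d hCt) (Sol.isUnit_det d) α β

theorem maj_h_geom (μ ν : Fin 4) : Maj (Sol.family d) n (fun i => (d i).h μ ν) geom :=
  (maj_h d μ ν).mono (below_serH d)

theorem maj_gMat (μ ν : Fin 4) : Maj (Sol.family d) n (fun i y => gMat (d i).h y μ ν) geom :=
  (maj_const_geom (mink μ ν)).add (maj_h_geom d μ ν)

theorem maj_hUp (α β : Fin 4) : Maj (Sol.family d) n (fun i y => hUp (d i).h y α β) geom :=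
  Maj.sum _ fun _ _ => Maj.sum _ fun _ _ => (maj_h_geom d _ _).const_mul _

theorem maj_O2 (hCt : Ct < 1) (α β : Fin 4) :
    Maj (Sol.family d) n (fun i y => O2 (d i).h y α β) geom :=
  (maj_sol_gUp d hCt α β).sub ((maj_const_geom _).sub (maj_hUp d α β))

theorem maj_O4 (hCt : Ct < 1) (α β ρ σ : Fin 4) :
    Maj (Sol.family d) n (fun i y => O4 (d i).h y α β ρ σ) geom := by
  have hc := fun α β => maj_const_geom (P := Sol.family d) (n := n) (mUp α β)
  exact ((maj_sol_gUp d hCt α β).mul_geom (maj_sol_gUp d hCt ρ σ)).sub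
    ((((hc α β).mul_geom (maj_hUp d ρ σ)).neg.sub ((maj_hUp d α β).mul_geom (hc ρ σ))).add
      ((hc α β).mul_geom (hc ρ σ)))

/-- The coefficients `m m h + m m m - h m m - m h m`. -/
theorem maj_firstOrder (μ ν α ρ β σ : Fin 4) : Maj (Sol.family d) n (fun i y =>
    mUp α ρ * mUp β σ * (d i).h μ ν y + mUp α ρ * mUp β σ * mink μ ν
      - hUp (d i).h y α ρ * mUp β σ * mink μ ν - mUp α ρ * hUp (d i).h y β σ * mink μ ν) geom := by
  have hc := fun α β => maj_const_geom (P := Sol.family d) (n := n) (mUp α β)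
  have hm := maj_const_geom (P := Sol.family d) (n := n) (mink μ ν)
  exact ((((maj_h_geom d μ ν).const_mul _).add (maj_const_geom _)).sub
    (((maj_hUp d α ρ).mul_geom (hc β σ)).mul_geom hm)).sub
      (((hc α ρ).mul_geom (maj_hUp d β σ)).mul_geom hm)

theorem maj_O6 (hCt : Ct < 1) (μ ν α ρ β σ : Fin 4) :
    Maj (Sol.family d) n (fun i y => O6 (d i).h y μ ν α ρ β σ) geom :=
  (((maj_gMat d μ ν).mul_geom (maj_sol_gUp d hCt α ρ)).mul_geom (maj_sol_gUp d hCt β σ)).sub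
    (maj_firstOrder d μ ν α ρ β σ)

theorem maj_coeffO2 (hCt : Ct < 1) (α β : Fin 4) : Maj (Sol.family d) n
    (fun i y => mUp α β - hUp (d i).h y α β + O2 (d i).h y α β) geom :=
  ((maj_const_geom _).sub (maj_hUp d α β)).add (maj_O2 d hCt α β)

theorem maj_coeffO4 (hCt : Ct < 1) (α β ρ σ : Fin 4) : Maj (Sol.family d) n
    (fun i y => -(mUp α β * hUp (d i).h y ρ σ) - hUp (d i).h y α β * mUp ρ σ
      + mUp α β * mUp ρ σ + O4 (d i).h y α β ρ σ) geom :=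
  ((((maj_hUp d ρ σ).const_mul _).neg.sub ((maj_hUp d α β).mul_geom (maj_const_geom _))).add
    (maj_const_geom _)).add (maj_O4 d hCt α β ρ σ)

theorem Below.inl {a b : κ → ℝ≥0⟦X⟧} (c : κ → ℝ≥0⟦X⟧) (h : Below n a b) : Below n a (b + c) :=
  h.trans (Below.of_add_eq c rfl)

theorem Below.inr {a b : κ → ℝ≥0⟦X⟧} (c : κ → ℝ≥0⟦X⟧) (h : Below n a b) : Below n a (c + b) :=
  h.trans (Below.of_add_eq c (add_comm b c))

/-- The generating series of `|Z^J A|`. -/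
abbrev serA : κ → ℝ≥0⟦X⟧ := fun i => ser n ((d i).aN B)

/-- The generating series of `|∂ Z^J A|`. -/
abbrev serDA : κ → ℝ≥0⟦X⟧ := fun i => ser n ((d i).daN B)

/-- The generating series of `|Z^J Φ|`. -/
abbrev serΦ : κ → ℝ≥0⟦X⟧ := fun i => ser n (d i).φN

/-- The generating series of `|∂ Z^J Φ|`. -/
abbrev serDΦ : κ → ℝ≥0⟦X⟧ := fun i => ser n (d i).dφN

/-- The generating series of `|Z^J h|`. -/
abbrev serH : κ → ℝ≥0⟦X⟧ := fun i => ser n (d i).hN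

/-- The generating series of `|∂ Z^J h|`. -/
abbrev serDH : κ → ℝ≥0⟦X⟧ := fun i => ser n (d i).dhN

/-- The generating series of `|∂̄ Z^J h|`. -/
abbrev serDbarH : κ → ℝ≥0⟦X⟧ := fun i => ser n (d i).dbarhN

theorem maj_lie {P : PointFamily κ} {f g : κ → Spacetime → su2} {a b : κ → ℝ≥0⟦X⟧}
    (hf : Maj P n f a) (hg : Maj P n g b) : Maj P n (fun i y => ⁅f i y, g i y⁆) (a * b) :=
  hf.bilin lieCLM hg

theorem maj_ip {P : PointFamily κ} {f g : κ → Spacetime → su2} {a b : κ → ℝ≥0⟦X⟧}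
    (hf : Maj P n f a) (hg : Maj P n g b) : Maj P n (fun i y => B.ip (f i y) (g i y)) (a * b) :=
  hf.bilin B.clm hg

theorem maj_sigmaAct {P : PointFamily κ} {f : κ → Spacetime → su2} {g : κ → Spacetime → Doublet}
    {a b : κ → ℝ≥0⟦X⟧} (hf : Maj P n f a) (hg : Maj P n g b) :
    Maj P n (fun i y => sigmaAct (f i y) (g i y)) (a * b) :=
  hf.bilin sigmaCLM hg

theorem maj_re_inner {P : PointFamily κ} {f g : κ → Spacetime → Doublet}
    {a b : κ → ℝ≥0⟦X⟧} (hf : Maj P n f a) (hg : Maj P n g b) :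
    Maj P n (fun i y => (inner ℂ (f i y) (g i y)).re) (a * b) :=
  hf.bilin reInnerCLM hg

theorem maj_complex_smul {P : PointFamily κ} {f : κ → Spacetime → Doublet} {a : κ → ℝ≥0⟦X⟧}
    (hf : Maj P n f a) (z : ℂ) : Maj P n (fun i y => z • f i y) a :=
  hf.clm (l := fun _ => smulCLM z) ⟨_, fun _ => le_rfl⟩

theorem maj_act {P : PointFamily κ} {f : κ → Spacetime → Doublet} {a : κ → ℝ≥0⟦X⟧}
    (hf : Maj P n f a) (M : Matrix (Fin 2) (Fin 2) ℂ) : Maj P n (fun i y => act M (f i y)) a :=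
  hf.clm (l := fun _ => actCLM M) ⟨_, fun _ => le_rfl⟩

theorem maj_smul_const {P : PointFamily κ} {f : κ → Spacetime → ℝ} {a : κ → ℝ≥0⟦X⟧}
    (hf : Maj P n f a) (X : su2) : Maj P n (fun i y => f i y • X) a :=
  hf.clm (l := fun _ => (ContinuousLinearMap.id ℝ ℝ).smulRight X) ⟨_, fun _ => le_rfl⟩

theorem maj_curv (α β : Fin 4) : Maj (Sol.family d) n
    (fun i => curv ((Sol.family d).dom i) (d i).A α β)
    (geom * serDA d B + serA d B * serA d B) :=
  (((((dmaj_A d B β).pd α).sub ((dmaj_A d B α).pd β))).mono (Below.inl _ (Below.refl _))).add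
    ((maj_lie (maj_A d B α) (maj_A d B β)).mono (Below.inr _ (Below.refl _)))

theorem maj_covD (α : Fin 4) : Maj (Sol.family d) n
    (fun i => covD ((Sol.family d).dom i) (d i).A (d i).Φ α)
    (geom * serDΦ d + serA d B * serΦ d) :=
  (((dmaj_Φ d).pd α).mono (Below.inl _ (Below.refl _))).sub
    ((maj_complex_smul (maj_sigmaAct (maj_A d B α) (maj_Φ d)) _).mono (Below.inr _ (Below.refl _)))

theorem maj_current (β : Fin 4) : Maj (Sol.family d) n
    (fun i => current ((Sol.family d).dom i) (d i).A (d i).Φ β)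
    (serΦ d * (geom * serDΦ d + serA d B * serΦ d)) := by
  refine Maj.sum _ fun I _ => maj_smul_const ?_ _
  simp only [Complex.sub_re]
  refine (maj_re_inner (maj_Φ d) (maj_act (maj_covD d B β) _)).sub ?_
  rw [mul_comm]
  exact maj_re_inner (maj_covD d B β) (maj_act (maj_Φ d) _)

theorem norm_sq_eq_re_inner (v : Doublet) : ‖v‖ ^ 2 = (inner ℂ v v).re := by
  rw [← inner_self_eq_norm_sq (𝕜 := ℂ) v]
  rfl

/-- The generating series of the Leibniz and chain rules for `V^{(k)}(|Φ|²)`. -/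
def serV (k : ℕ) : κ → ℝ≥0⟦X⟧ := ∑ s ∈ Finset.range (n + 1),
  (fun i => PowerSeries.C ‖Vder (d i).V (k + s) (‖(d i).Φ (d i).pt‖ ^ 2)‖₊) *
    (serΦ d * serΦ d) ^ s

theorem maj_sol_Vder (k : ℕ) (hk : k ≤ 1) : Maj (Sol.family d) n
    (fun i y => Vder (d i).V k (‖(d i).Φ y‖ ^ 2)) (serV d k) := by
  refine maj_Vder (P := Sol.family d) (u := fun i y => ‖(d i).Φ y‖ ^ 2)
    (fun i => (d i).contDiffOn_V) ?_ (fun i y _ => sq_nonneg _) le_rfl (by omega)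
  simp only [norm_sq_eq_re_inner]
  exact maj_re_inner (maj_Φ d) (maj_Φ d)

end coefficients

/-! ### The terms `J` and `W` -/

section lowerTerms

variable {n : ℕ} {Ct : ℝ} {κ : Type*} (d : κ → Sol n Ct) (B : InvariantInner)

theorem below_of_eq_geom_pow {a b : κ → ℝ≥0⟦X⟧} (l : ℕ) (h : a = geom ^ l * b) :
    Below n a (geom * b) :=
  h ▸ below_geom_pow_mul l b

/-- The generating series that bounds `Z^I J`. -/
def serJ : κ → ℝ≥0⟦X⟧ :=
  geom * (serDH d * serDA d B) + geom * (serA d B * serDA d B)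
    + geom * (serA d B * serA d B * serA d B) + geom * (serΦ d * serDΦ d)
    + serΦ d * serΦ d * serA d B

/-- The generating series that bounds `Z^I W`. -/
def serW : κ → ℝ≥0⟦X⟧ :=
  geom * (serA d B * serDΦ d) + geom * (serA d B * serA d B * serΦ d) + serV d 1 * serΦ d

theorem maj_termJ (hCt : Ct < 1) (β : Fin 4) : Maj (Sol.family d) n
    (fun i => termJ ((Sol.family d).dom i) (d i).h (d i).A (d i).Φ β) (serJ d B) := by
  have b1 : Below n (geom * (geom * serDH d) * (geom * serDA d B)) (serJ d B) :=
    (((((below_of_eq_geom_pow 3 (b := serDH d * serDA d B) (by ring)).inl _).inl _).inl _).inl _)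
  have b2 : Below n (geom * (serA d B * (geom * serDA d B))) (serJ d B) :=
    (((((below_of_eq_geom_pow 2 (b := serA d B * serDA d B) (by ring)).inr _).inl _).inl _).inl _)
  have b3 : Below n (geom * (serA d B * (serA d B * serA d B))) (serJ d B) :=
    ((((below_of_eq_geom_pow 1 (b := serA d B * serA d B * serA d B) (by ring)).inr _).inl _).inl _)
  have b4 : Below n (serΦ d * (geom * serDΦ d)) (serJ d B) :=
    (((below_of_eq_geom_pow 1 (b := serΦ d * serDΦ d) (by ring)).inr _).inl _)
  have b5 : Below n (serΦ d * (serA d B * serΦ d)) (serJ d B) := by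
    rw [show serΦ d * (serA d B * serΦ d) = serΦ d * serΦ d * serA d B by ring]
    exact (Below.refl _).inr _
  have hh := fun μ ν γ => (dmaj_h d μ ν).pd γ
  have hA := fun α γ => (dmaj_A d B α).pd γ
  have hl := fun α γ δ => maj_lie (maj_A d B α) (hA γ δ)
  refine ((((Maj.sum _ fun α _ => Maj.sum _ fun θ _ => Maj.sum _ fun μ _ => Maj.sum _ fun l _ =>
    ?_).add (Maj.const_smul (Maj.sum _ fun α _ => Maj.sum _ fun l _ => Maj.sum _ fun θ _ =>
      Maj.sum _ fun μ _ => ?_) _)).sub (Maj.sum _ fun α _ => Maj.sum _ fun l _ => ?_)).add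
        (Maj.sum _ fun α _ => Maj.sum _ fun l _ => ?_)).add ?_
  · exact (((maj_coeffO4 d hCt α θ μ l).mul (hh θ μ β)).smul (hA α l)).mono b1
  · exact (((maj_coeffO4 d hCt α l θ μ).mul (((hh μ β l).add (hh μ l β)).sub (hh l β μ))).smul
      ((hA θ α).sub (hA α θ))).mono b1
  · exact ((maj_coeffO2 d hCt α l).smul (hl α β l)).mono b2
  · simp only [smul_sub]
    exact ((((maj_coeffO2 d hCt α l).smul (hl l α β)).mono b2).sub
      (((maj_coeffO2 d hCt α l).smul (hl l β α)).mono b2)).sub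
      (((maj_coeffO2 d hCt α l).smul (maj_lie (maj_A d B l)
        (maj_lie (maj_A d B α) (maj_A d B β)))).mono b3)
  · refine (maj_current d B β).mono ?_
    rw [mul_add]
    exact b4.add b5

theorem maj_termW (hCt : Ct < 1) : Maj (Sol.family d) n
    (fun i => termW (d i).V ((Sol.family d).dom i) (d i).h (d i).A (d i).Φ) (serW d B) := by
  have b1 : Below n (geom * (serA d B * (geom * serDΦ d))) (serW d B) :=
    (((below_of_eq_geom_pow 2 (b := serA d B * serDΦ d) (by ring)).inl _).inl _)
  have b2 : Below n (geom * (serA d B * (serA d B * serΦ d))) (serW d B) :=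
    (((below_of_eq_geom_pow 1 (b := serA d B * serA d B * serΦ d) (by ring)).inr _).inl _)
  have hΦ := fun γ => (dmaj_Φ d).pd γ
  refine (((maj_complex_smul (Maj.sum _ fun l _ => Maj.sum _ fun μ _ => ?_) _).add
    (maj_complex_smul (Maj.sum _ fun l _ => Maj.sum _ fun μ _ => ?_) _)).add
      (Maj.const_smul (Maj.sum _ fun l _ => Maj.sum _ fun μ _ => ?_) _)).add ?_
  · exact ((maj_coeffO2 d hCt l μ).smul (maj_sigmaAct (maj_A d B μ) (hΦ l))).mono b1
  · exact ((maj_coeffO2 d hCt l μ).smul (maj_sigmaAct (maj_A d B l) (hΦ μ))).mono b1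
  · exact ((maj_coeffO2 d hCt l μ).smul (maj_sigmaAct (maj_A d B l)
      (maj_sigmaAct (maj_A d B μ) (maj_Φ d)))).mono b2
  · exact ((maj_sol_Vder d 1 le_rfl).smul (maj_Φ d)).mono ((Below.refl _).inr _)

end lowerTerms

/-! ### The term `F` -/

section frames

variable {n : ℕ} {Ct : ℝ} {x S₁ S₂ : Spacetime}

theorem abs_con_le (hr : rad x ≠ 0) (hS : IsSphereFrame x S₁ S₂) {k : Tensor} {M : ℝ}
    (hk : ∀ α β, |k α β| ≤ M) (V W : FrameLabel) :
    |con k (frameVec x S₁ S₂ V) (frameVec x S₁ S₂ W)| ≤ 64 * M := by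
  have hM : 0 ≤ M := (abs_nonneg _).trans (hk 0 0)
  have hv : ∀ V α, |frameVec x S₁ S₂ V α| ≤ 2 := fun V α =>
    (PiLp.norm_apply_le (frameVec x S₁ S₂ V) α).trans (norm_frameVec_le hr hS V)
  have h : ∀ α β, |frameVec x S₁ S₂ V α * frameVec x S₁ S₂ W β * k α β| ≤ 2 * 2 * M := by
    intro α β
    rw [abs_mul, abs_mul]
    exact mul_le_mul (mul_le_mul (hv _ _) (hv _ _) (abs_nonneg _) (by norm_num)) (hk α β)
      (abs_nonneg _) (by norm_num)
  exact (abs_sum_sum_le h).trans (by linarith)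

theorem euInv_self_ge (V : FrameLabel) : 1 / 2 ≤ euInv V V := by
  rw [euInv, if_pos rfl]
  split_ifs <;> norm_num

/-- The components in the frame are bounded by the norm `|p|_{𝒱𝒲}`. -/
theorem abs_con_le_frameNorm {𝒱 𝒲 : Finset FrameLabel} {p : Fin 4 → Fin 4 → Fin 4 → ℝ}
    {V W : FrameLabel} (hV : V ∈ 𝒱) (hW : W ∈ 𝒲) (γ : Fin 4) :
    |con (fun α β => p α β γ) (frameVec x S₁ S₂ V) (frameVec x S₁ S₂ W)| ≤
      2 * frameNorm x S₁ S₂ 𝒱 𝒲 p := by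
  set q : FrameLabel → FrameLabel → Fin 4 → ℝ := fun V W γ =>
    con (fun α β => p α β γ) (frameVec x S₁ S₂ V) (frameVec x S₁ S₂ W) with hq
  have hsum : ∑ V ∈ 𝒱, ∑ V' ∈ 𝒱, ∑ W ∈ 𝒲, ∑ W' ∈ 𝒲, ∑ γ, euInv V V' * euInv W W' *
      (∑ α, ∑ β, frameVec x S₁ S₂ V α * frameVec x S₁ S₂ W β * p α β γ) *
      (∑ α, ∑ β, frameVec x S₁ S₂ V' α * frameVec x S₁ S₂ W' β * p α β γ) =
      ∑ V ∈ 𝒱, ∑ W ∈ 𝒲, ∑ γ, euInv V V * euInv W W * q V W γ ^ 2 := by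
    refine Finset.sum_congr rfl fun V hV => ?_
    rw [Finset.sum_eq_single_of_mem V hV]
    · refine Finset.sum_congr rfl fun W hW => ?_
      rw [Finset.sum_eq_single_of_mem W hW]
      · exact Finset.sum_congr rfl fun γ _ => by simp only [hq, con]; ring
      · intro W' _ hne
        simp [euInv, hne.symm]
    · intro V' _ hne
      simp [euInv, hne.symm]
  have hnn : ∀ V W γ, 0 ≤ euInv V V * euInv W W * q V W γ ^ 2 := fun V W γ =>
    mul_nonneg (mul_nonneg (by linarith [euInv_self_ge V]) (by linarith [euInv_self_ge W]))
      (sq_nonneg _)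
  have h1 : (|q V W γ| / 2) ^ 2 ≤ ∑ V ∈ 𝒱, ∑ W ∈ 𝒲, ∑ γ, euInv V V * euInv W W * q V W γ ^ 2 := by
    refine le_trans (b := euInv V V * euInv W W * q V W γ ^ 2) ?_ ?_
    · have := mul_le_mul (euInv_self_ge V) (euInv_self_ge W) (by norm_num)
        (by linarith [euInv_self_ge V])
      rw [div_pow, sq_abs]
      nlinarith [sq_nonneg (q V W γ)]
    · refine (Finset.single_le_sum (f := fun γ => euInv V V * euInv W W * q V W γ ^ 2)
        (fun γ _ => hnn V W γ) (Finset.mem_univ γ)).trans ?_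
      refine (Finset.single_le_sum (f := fun W => ∑ γ, euInv V V * euInv W W * q V W γ ^ 2)
        (fun W _ => Finset.sum_nonneg fun γ _ => hnn V W γ) hW).trans ?_
      exact Finset.single_le_sum (f := fun V => ∑ W ∈ 𝒲, ∑ γ, euInv V V * euInv W W * q V W γ ^ 2)
        (fun V _ => Finset.sum_nonneg fun W _ => Finset.sum_nonneg fun γ _ => hnn V W γ) hV
  have h2 := Real.le_sqrt_of_sq_le h1
  rw [frameNorm, hsum]
  change |q V W γ| ≤ _
  linarith

end frames

section upperTerm

variable {n : ℕ} {Ct : ℝ} {κ : Type*} (d : κ → Sol n Ct) (B : InvariantInner)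
  {F₁ F₂ : κ → Spacetime}

/-- The metric perturbation as a tensor field. -/
def Sol.tensor (s : Sol n Ct) : Spacetime → Tensor := fun y α β => s.h α β y

theorem Sol.contDiffOn_tensor (s : Sol n Ct) : ContDiffOn ℝ (n + 1 : ℕ) s.tensor (slab s.T) :=
  contDiffOn_pi.mpr fun α => contDiffOn_pi.mpr fun β => s.contDiffOn_h α β

theorem fderivWithin_ZI_tensor_apply (s : Sol n Ct) {J : MultiIndex} (hJ : J.length ≤ n)
    (v : Spacetime) (α β : Fin 4) :
    fderivWithin ℝ (ZI (slab s.T) J s.tensor) (slab s.T) s.pt v α β =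
      fderivWithin ℝ (ZT (slab s.T) J s.h α β) (slab s.T) s.pt v := by
  have h1 := fderivWithin_ZI_clm (uniqueDiffOn_slab s.pos) (conCLM (e α) (e β)) J
    (s.contDiffOn_tensor.of_le (by exact_mod_cast Nat.succ_le_succ hJ)) s.mem v
  simp only [conCLM_apply, con_e] at h1
  exact h1.symm

variable (F₁ F₂) in
/-- The generating series of `|∂ Z^J h|_{𝒱𝒲}` in a family of null frames. -/
abbrev serFr (𝒱 𝒲 : Finset FrameLabel) : κ → ℝ≥0⟦X⟧ :=
  fun i => ser n ((d i).frN (F₁ i) (F₂ i) 𝒱 𝒲)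

theorem dcon_frame_le {𝒱 𝒲 : Finset FrameLabel} {V W : FrameLabel} (hV : V ∈ 𝒱) (hW : W ∈ 𝒲)
    (i : κ) {J : MultiIndex} (hJ : J.length ≤ n) (γ : Fin 4) :
    ‖dcon (Sol.family d) F₁ F₂ (fun i => (d i).tensor) i J (e γ) V W‖₊ ≤
      2 * PowerSeries.coeff J.length (serFr d F₁ F₂ 𝒱 𝒲 i) := by
  refine nnnorm_le_mul_coeff_ser hJ ?_
  rw [dcon, show fderivWithin ℝ (ZI ((Sol.family d).dom i) J (d i).tensor) ((Sol.family d).dom i)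
    ((Sol.family d).pt i) (e γ) = fun α β => pd (slab (d i).T) γ (ZT (slab (d i).T) J (d i).h α β)
      (d i).pt from funext fun α => funext fun β => fderivWithin_ZI_tensor_apply (d i) hJ _ α β]
  exact abs_con_le_frameNorm (x := (d i).pt) (S₁ := F₁ i) (S₂ := F₂ i)
    (p := fun μ ν β => pd (slab (d i).T) β (ZT (slab (d i).T) J (d i).h μ ν) (d i).pt) hV hW γ

theorem dcon_symm (i : κ) {J : MultiIndex} (hJ : J.length ≤ n) (v : Spacetime)
    (V W : FrameLabel) : dcon (Sol.family d) F₁ F₂ (fun i => (d i).tensor) i J v V W =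
      dcon (Sol.family d) F₁ F₂ (fun i => (d i).tensor) i J v W V :=
  con_fderivWithin_ZI_symm ((Sol.family d).uniqueDiff i) J
    ((d i).contDiffOn_tensor.of_le (by exact_mod_cast Nat.succ_le_succ hJ))
    (fun y hy => ((d i).lorentzian y hy).symm) ((Sol.family d).mem i) _ _ _

theorem dmaj_con {V W : FrameLabel} {a : κ → ℝ≥0⟦X⟧} (h : ∃ C : ℝ≥0, ∀ i (J : MultiIndex),
    J.length ≤ n → ∀ γ, ‖dcon (Sol.family d) F₁ F₂ (fun i => (d i).tensor) i J (e γ) V W‖₊ ≤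
      C * PowerSeries.coeff J.length (a i)) :
    DMaj (Sol.family d) n (fun i y => con ((d i).tensor y) (frameVec (d i).pt (F₁ i) (F₂ i) V)
      (frameVec (d i).pt (F₁ i) (F₂ i) W)) a := by
  obtain ⟨C, hC⟩ := h
  refine ⟨fun i => (conCLM _ _).contDiff.comp_contDiffOn (d i).contDiffOn_tensor, C,
    fun i J hJ γ => ?_⟩
  have h1 := fderivWithin_ZI_clm ((Sol.family d).uniqueDiff i)
    (conCLM (frameVec (d i).pt (F₁ i) (F₂ i) V) (frameVec (d i).pt (F₁ i) (F₂ i) W)) J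
    ((d i).contDiffOn_tensor.of_le (by exact_mod_cast Nat.succ_le_succ hJ)) (d i).mem (e γ)
  simp only [conCLM_apply] at h1
  exact (congrArg _ h1).trans_le (hC i J hJ γ)

theorem exists_dcon_tangent_le : ∃ C : ℝ≥0, ∀ V W, V ≠ FrameLabel.Lbar ∨ W ≠ FrameLabel.Lbar →
    ∀ i (J : MultiIndex), J.length ≤ n → ∀ γ,
    ‖dcon (Sol.family d) F₁ F₂ (fun i => (d i).tensor) i J (e γ) V W‖₊ ≤
      C * PowerSeries.coeff J.length (serFr d F₁ F₂ famT famU i) := by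
  have hT : ∀ V, V ≠ FrameLabel.Lbar → V ∈ famT := by intro V; cases V <;> simp [famT]
  have hU : ∀ V, V ∈ famU := by intro V; cases V <;> simp [famU]
  refine ⟨2, fun V W hVW i J hJ γ => ?_⟩
  rcases hVW with h | h
  · exact dcon_frame_le d (hT V h) (hU W) i hJ γ
  · rw [dcon_symm d i hJ]
    exact dcon_frame_le d (hT W h) (hU V) i hJ γ

theorem dcon_full_le (hr : ∀ i, rad (d i).pt ≠ 0)
    (hF : ∀ i, IsSphereFrame (d i).pt (F₁ i) (F₂ i)) (V W : FrameLabel) (i : κ) {J : MultiIndex}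
    (hJ : J.length ≤ n) (γ : Fin 4) :
    ‖dcon (Sol.family d) F₁ F₂ (fun i => (d i).tensor) i J (e γ) V W‖₊ ≤
      64 * PowerSeries.coeff J.length (serDH d i) := by
  refine nnnorm_le_mul_coeff_ser hJ (abs_con_le (hr i) (hF i) (fun α β => ?_) V W)
  refine (congrArg _ (fderivWithin_ZI_tensor_apply (d i) hJ _ α β)).trans_le ?_
  exact abs_le_sqrt_sum₃
    (f := fun μ ν β => pd (slab (d i).T) β (ZT (slab (d i).T) J (d i).h μ ν) (d i).pt) α β γ

theorem dcon_dbar_le (hr : ∀ i, rad (d i).pt ≠ 0)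
    (hF : ∀ i, IsSphereFrame (d i).pt (F₁ i) (F₂ i)) (V W : FrameLabel) (i : κ) {J : MultiIndex}
    (hJ : J.length ≤ n) (γ : Fin 4) :
    ‖dcon (Sol.family d) F₁ F₂ (fun i => (d i).tensor) i J (dbarVec (d i).pt γ) V W‖₊ ≤
      64 * PowerSeries.coeff J.length (serDbarH d i) := by
  refine nnnorm_le_mul_coeff_ser hJ (abs_con_le (hr i) (hF i) (fun α β => ?_) V W)
  refine (congrArg _ (fderivWithin_ZI_tensor_apply (d i) hJ _ α β)).trans_le ?_
  exact abs_le_sqrt_sum₃ (f := fun μ ν β => fderivWithin ℝ (ZT (slab (d i).T) J (d i).h μ ν)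
    (slab (d i).T) (d i).pt (dbarVec (d i).pt β)) α β γ

end upperTerm

section upperTerm

variable {n : ℕ} {Ct : ℝ} {κ : Type*} (d : κ → Sol n Ct) (B : InvariantInner)
  {F₁ F₂ : κ → Spacetime}

/-- The generating series of the bounds of `∂ Z^J h_{LL}`. -/
def serLL (F₁ F₂ : κ → Spacetime) : κ → ℝ≥0⟦X⟧ :=
  geom * serDbarH d + serX * (geom * serFr d F₁ F₂ famL famT) + serX ^ 2 * (geom * serDH d)
    + geom * (serH d * serDH d)

theorem dmaj_LL_sol (hCt : Ct < 1) (hr : ∀ i, rad (d i).pt ≠ 0)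
    (hF : ∀ i, IsSphereFrame (d i).pt (F₁ i) (F₂ i)) :
    DMaj (Sol.family d) n (fun i y => con ((d i).tensor y) (frameVec (d i).pt (F₁ i) (F₂ i) .L)
      (frameVec (d i).pt (F₁ i) (F₂ i) .L)) (serLL d F₁ F₂) :=
  dmaj_LL (P := Sol.family d) hr hF (fun i => (d i).contDiffOn_tensor)
    (fun i y hy => ((d i).lorentzian y hy).symm)
    ⟨64, fun i _ hJ V W β => dcon_dbar_le d hr hF V W i hJ β⟩
    ⟨2, fun i _ hJ W hW γ => dcon_frame_le d (by simp [famL])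
      (by cases W <;> simp [famT] at hW ⊢) i hJ γ⟩
    ⟨64, fun i _ hJ V W γ => dcon_full_le d hr hF V W i hJ γ⟩
    (maj_waveForm (P := Sol.family d) hr hF (dmaj_h d) (maj_sol_gUp_sub d hCt)
      (Sol.isUnit_det d) fun i => (d i).wave)

theorem maj_Pform_sol (hCt : Ct < 1) (hr : ∀ i, rad (d i).pt ≠ 0)
    (hF : ∀ i, IsSphereFrame (d i).pt (F₁ i) (F₂ i)) (μ ν : Fin 4) : Maj (Sol.family d) n
    (fun i y => Pform mUp (dh ((Sol.family d).dom i) (d i).h y) μ ν)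
    (geom * (serFr d F₁ F₂ famT famU * serFr d F₁ F₂ famT famU)
      + geom * (serLL d F₁ F₂ * serDH d)) := by
  obtain ⟨C, hC⟩ := exists_dcon_tangent_le (F₁ := F₁) (F₂ := F₂) d
  refine (maj_Pform (P := Sol.family d) (K := fun i => (d i).tensor) hr hF
    (fun i => (d i).contDiffOn_tensor) (fun V W h => dmaj_con d ⟨C, hC V W h⟩)
    (dmaj_LL_sol d hCt hr hF)
    (fun V W => dmaj_con d ⟨64, fun i _ hJ γ => dcon_full_le d hr hF V W i hJ γ⟩) μ ν).congr ?_
  intro i y hy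
  refine congrArg (fun p => Pform mUp p μ ν) (funext fun γ => funext fun α => funext fun β => ?_)
  exact (fderivWithin_tensor_apply ((Sol.family d).uniqueDiff i) (fun α β =>
    ((d i).contDiffOn_h α β).of_le (by exact_mod_cast Nat.le_add_left 1 n)) hy _ α β).symm

theorem sum₄_sub_eq (u w : Fin 4 → Fin 4 → ℝ) (f : Fin 4 → Fin 4 → Fin 4 → Fin 4 → ℝ) :
    (∑ α, ∑ α', ∑ β, ∑ β', u α α' * u β β' * f α α' β β')
      - ∑ α, ∑ α', ∑ β, ∑ β', w α α' * w β β' * f α α' β β' =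
    ∑ α, ∑ α', ∑ β, ∑ β', ((u α α' - w α α') * u β β' + w α α' * (u β β' - w β β'))
      * f α α' β β' := by
  simp only [← Finset.sum_sub_distrib]
  exact Finset.sum_congr rfl fun _ _ => Finset.sum_congr rfl fun _ _ =>
    Finset.sum_congr rfl fun _ _ => Finset.sum_congr rfl fun _ _ => by ring

/-- Products of two inverse metrics differ from their Minkowski values by terms linear in `h`, up
to bounded factors. -/
theorem maj_Gform (hCt : Ct < 1) (μ ν : Fin 4) : Maj (Sol.family d) n
    (fun i => Gform ((Sol.family d).dom i) (d i).h μ ν)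
    (geom * (serH d * serDH d * serDH d)) := by
  have hp : ∀ a b c a' b' c', Maj (Sol.family d) n (fun i y =>
      dh ((Sol.family d).dom i) (d i).h y a b c * dh ((Sol.family d).dom i) (d i).h y a' b' c')
      (geom * serDH d * (geom * serDH d)) := fun a b c a' b' c' =>
    ((dmaj_h d b c).pd a).mul ((dmaj_h d b' c').pd a')
  have hm := fun α β => maj_const_geom (P := Sol.family d) (n := n) (mUp α β)
  have hg : ∀ α α' β β', Maj (Sol.family d) n (fun i y =>
      (gUp (d i).h y α α' - mUp α α') * gUp (d i).h y β β'
        + mUp α α' * (gUp (d i).h y β β' - mUp β β')) (geom * serH d * geom) := by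
    intro α α' β β'
    refine ((maj_sol_gUp_sub d hCt α α').mul (maj_sol_gUp d hCt β β')).add ?_
    rw [mul_comm _ geom]
    exact (hm α α').mul (maj_sol_gUp_sub d hCt β β')
  have hb : Below n (geom * serH d * geom * (geom * serDH d * (geom * serDH d)))
      (geom * (serH d * serDH d * serDH d)) := below_of_eq_geom_pow 4 (by ring)
  refine Maj.congr (f := fun i y => _ + _) (Maj.add
    (Maj.sum _ fun α _ => Maj.sum _ fun α' _ => Maj.sum _ fun β _ => Maj.sum _ fun β' _ =>
      ((hg α α' β β').mul ?_).mono hb)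
    (Maj.sum _ fun α _ => Maj.sum _ fun α' _ => Maj.sum _ fun β _ => Maj.sum _ fun β' _ =>
      ((hg α α' β β').mul ?_).mono hb)) fun i y _ => (add_sub_add_comm _ _ _ _).trans
        (congrArg₂ (· + ·) (sum₄_sub_eq _ _ _) (sum₄_sub_eq _ _ _))
  · exact ((hp _ _ _ _ _ _).const_mul _).sub ((hp _ _ _ _ _ _).const_mul _)
  · exact (((((hp _ _ _ _ _ _).sub ((hp _ _ _ _ _ _).sub (hp _ _ _ _ _ _))).add
      ((hp _ _ _ _ _ _).sub (hp _ _ _ _ _ _))).add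
      ((hp _ _ _ _ _ _).sub (hp _ _ _ _ _ _))).add
      (((hp _ _ _ _ _ _).sub (hp _ _ _ _ _ _)).const_mul _)).add
      (((hp _ _ _ _ _ _).sub (hp _ _ _ _ _ _)).const_mul _)

/-- The generating series that bounds `Z^I F`. -/
def serF (F₁ F₂ : κ → Spacetime) : κ → ℝ≥0⟦X⟧ :=
  (geom * (serFr d F₁ F₂ famT famU * serFr d F₁ F₂ famT famU) + geom * (serDbarH d * serDH d))
    + serX ^ 1 * (geom * (serFr d F₁ F₂ famL famT * serDH d))
    + serX ^ 2 * (geom * (serDH d * serDH d))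
    + geom * (serDH d * serDH d * serH d)
    + geom * (serDA d B * serDA d B)
    + geom * (serDA d B * serA d B * serA d B)
    + serV d 0
    + geom * (serA d B * serA d B * serA d B * serA d B)
    + serH d * serV d 0
    + geom * (serDΦ d * serDΦ d)
    + geom * (serA d B * serΦ d * serDΦ d)
    + serA d B * serA d B * serΦ d * serΦ d

theorem maj_termF (hCt : Ct < 1) (hr : ∀ i, rad (d i).pt ≠ 0)
    (hF : ∀ i, IsSphereFrame (d i).pt (F₁ i) (F₂ i)) (μ ν : Fin 4) : Maj (Sol.family d) n
    (fun i => termF B (d i).V ((Sol.family d).dom i) (d i).h (d i).A (d i).Φ μ ν)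
    (serF d B F₁ F₂) := by
  set S := serF d B F₁ F₂ with hS
  have b1 : Below n (geom * (serFr d F₁ F₂ famT famU * serFr d F₁ F₂ famT famU)) S :=
    ((((((((((((Below.refl _).inl _).inl _).inl _).inl _).inl _).inl _).inl _).inl _).inl _).inl
      _).inl _).inl _
  have b2 : Below n (geom * (serDbarH d * serDH d)) S :=
    ((((((((((((Below.refl _).inr _).inl _).inl _).inl _).inl _).inl _).inl _).inl _).inl _).inl
      _).inl _).inl _
  have b3 : Below n (serX * (geom * (serFr d F₁ F₂ famL famT * serDH d))) S := by
    rw [← pow_one serX]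
    exact (((((((((((Below.refl _).inr _).inl _).inl _).inl _).inl _).inl _).inl _).inl _).inl
      _).inl _).inl _
  have b4 : Below n (serX ^ 2 * (geom * (serDH d * serDH d))) S :=
    ((((((((((Below.refl _).inr _).inl _).inl _).inl _).inl _).inl _).inl _).inl _).inl _).inl _
  have b5 : Below n (geom * (serH d * serDH d * serDH d)) S := by
    rw [show serH d * serDH d * serDH d = serDH d * serDH d * serH d by ring]
    exact (((((((((Below.refl _).inr _).inl _).inl _).inl _).inl _).inl _).inl _).inl _).inl _
  have b6 : Below n (geom * (serDA d B * serDA d B)) S :=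
    ((((((((Below.refl _).inr _).inl _).inl _).inl _).inl _).inl _).inl _).inl _
  have b7 : Below n (geom * (serDA d B * serA d B * serA d B)) S :=
    (((((((Below.refl _).inr _).inl _).inl _).inl _).inl _).inl _).inl _
  have b8 : Below n (serV d 0) S :=
    ((((((Below.refl _).inr _).inl _).inl _).inl _).inl _).inl _
  have b9 : Below n (geom * (serA d B * serA d B * serA d B * serA d B)) S :=
    (((((Below.refl _).inr _).inl _).inl _).inl _).inl _
  have b10 : Below n (serH d * serV d 0) S :=
    ((((Below.refl _).inr _).inl _).inl _).inl _
  have b11 : Below n (geom * (serDΦ d * serDΦ d)) S := (((Below.refl _).inr _).inl _).inl _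
  have b12 : Below n (geom * (serA d B * serΦ d * serDΦ d)) S := ((Below.refl _).inr _).inl _
  have b13 : Below n (serA d B * serA d B * serΦ d * serΦ d) S := (Below.refl _).inr _
  have hLL : Below n (geom * (serLL d F₁ F₂ * serDH d)) S := by
    have h1 : geom * (serLL d F₁ F₂ * serDH d) = geom ^ 2 * (serDbarH d * serDH d)
        + serX * (geom ^ 2 * (serFr d F₁ F₂ famL famT * serDH d))
        + serX ^ 2 * (geom ^ 2 * (serDH d * serDH d))
        + geom ^ 2 * (serH d * serDH d * serDH d) := by
      simp only [serLL]
      ring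
    rw [h1]
    exact ((((below_geom_pow_mul 2 _).trans b2).add
      ((Below.mul_left _ (below_geom_pow_mul 2 _)).trans b3)).add
      ((Below.mul_left _ (below_geom_pow_mul 2 _)).trans b4)).add
      ((below_geom_pow_mul 2 _).trans b5)
  have hcurv : Below n (geom * ((geom * serDA d B + serA d B * serA d B)
      * (geom * serDA d B + serA d B * serA d B))) S := by
    have h1 : geom * ((geom * serDA d B + serA d B * serA d B)
        * (geom * serDA d B + serA d B * serA d B)) = geom ^ 3 * (serDA d B * serDA d B)
        + (geom ^ 2 * (serDA d B * serA d B * serA d B)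
          + geom ^ 2 * (serDA d B * serA d B * serA d B))
        + geom * (serA d B * serA d B * serA d B * serA d B) := by
      ring
    rw [h1]
    have h2 := (below_geom_pow_mul 2 _).trans b7
    exact (((below_geom_pow_mul 3 _).trans b6).add (h2.add h2)).add b9
  have hcov : Below n ((geom * serDΦ d + serA d B * serΦ d)
      * (geom * serDΦ d + serA d B * serΦ d)) S := by
    have h1 : (geom * serDΦ d + serA d B * serΦ d) * (geom * serDΦ d + serA d B * serΦ d) =
        geom ^ 2 * (serDΦ d * serDΦ d) + (geom * (serA d B * serΦ d * serDΦ d)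
          + geom * (serA d B * serΦ d * serDΦ d)) + serA d B * serA d B * serΦ d * serΦ d := by
      ring
    rw [h1]
    exact (((below_geom_pow_mul 2 _).trans b11).add (b12.add b12)).add b13
  have hV : Maj (Sol.family d) n (fun i y => (d i).V (‖(d i).Φ y‖ ^ 2)) (serV d 0) := by
    have := maj_sol_Vder d 0 zero_le_one
    simpa only [Vder, iteratedDerivWithin_zero] using this
  have hip := fun α β γ δ => maj_ip B (maj_curv d B α β) (maj_curv d B γ δ)
  have hinner := fun α β => (maj_re_inner (maj_covD d B α) (maj_covD d B β)).mono hcov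
  refine ((((((?_ : Maj _ _ _ S).sub ?_).add (Maj.const_mul (Maj.sum _ fun α _ =>
    Maj.sum _ fun β _ => ?_) _)).sub (Maj.const_mul (Maj.sum _ fun α _ =>
    Maj.sum _ fun β _ => ?_) _)).add (Maj.const_mul (Maj.sum _ fun α _ => Maj.sum _ fun ρ _ =>
    Maj.sum _ fun β _ => Maj.sum _ fun σ _ => ?_) _))).sub ?_
  · exact (((maj_Pform_sol d hCt hr hF μ ν).mono (b1.add hLL)).add
      ((maj_Qform (P := Sol.family d) hr hF (dmaj_h d) (dbarMaj_h d) μ ν).mono b2)).add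
      ((maj_Gform d hCt μ ν).mono b5)
  · simp only [add_mul]
    exact (((maj_h d μ ν).mul hV).mono b10).add ((hV.mono b8).const_mul _)
  · exact (((maj_hUp d α β).sub (maj_const_geom _)).mul (hip α μ β ν)).mono hcurv
  · exact ((maj_O2 d hCt α β).mul (hip α μ β ν)).mono hcurv
  · exact (((maj_firstOrder d μ ν α ρ β σ).add (maj_O6 d hCt μ ν α ρ β σ)).mul
      (hip α β ρ σ)).mono hcurv
  · simp only [Complex.add_re]
    exact (hinner μ ν).add (hinner ν μ)

end upperTerm

/-! ### From generating series to sums over multi-indices -/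

section extraction

variable {n : ℕ}

theorem coeff_geom_ser₂ (c : ℕ) {κ : Type*} (i : κ) {φ ψ : MultiIndex → ℝ} (hφ : ∀ J, 0 ≤ φ J)
    (hψ : ∀ J, 0 ≤ ψ J) :
    ((PowerSeries.coeff n (PowerSeries.X ^ c * (geom i * (ser n φ * ser n ψ))) : ℝ≥0) : ℝ) =
      ∑ K ∈ tuplesLE 2 n c, φ (K 0) * ψ (K 1) := by
  have h := coeff_X_pow_mul_geom_mul_prod_ser (n := n) c (φ := ![φ, ψ])
    (by intro j; fin_cases j <;> assumption) i
  simpa only [Fin.prod_univ_two, Matrix.cons_val_zero, Matrix.cons_val_one, Matrix.cons_val] using h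

theorem coeff_geom_ser₂' {κ : Type*} (i : κ) {φ ψ : MultiIndex → ℝ} (hφ : ∀ J, 0 ≤ φ J)
    (hψ : ∀ J, 0 ≤ ψ J) :
    ((PowerSeries.coeff n (geom i * (ser n φ * ser n ψ)) : ℝ≥0) : ℝ) =
      ∑ K ∈ tuplesLE 2 n 0, φ (K 0) * ψ (K 1) := by
  rw [← coeff_geom_ser₂ 0 i hφ hψ, pow_zero, one_mul]

theorem coeff_geom_ser₃ {κ : Type*} (i : κ) {φ ψ χ : MultiIndex → ℝ} (hφ : ∀ J, 0 ≤ φ J)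
    (hψ : ∀ J, 0 ≤ ψ J) (hχ : ∀ J, 0 ≤ χ J) :
    ((PowerSeries.coeff n (geom i * (ser n φ * ser n ψ * ser n χ)) : ℝ≥0) : ℝ) =
      ∑ K ∈ tuplesLE 3 n 0, φ (K 0) * ψ (K 1) * χ (K 2) := by
  have h := coeff_X_pow_mul_geom_mul_prod_ser (n := n) 0 (φ := ![φ, ψ, χ])
    (by intro j; fin_cases j <;> assumption) i
  simpa only [Fin.prod_univ_three, Matrix.cons_val_zero, Matrix.cons_val_one, Matrix.cons_val,
    pow_zero, one_mul] using h

theorem coeff_geom_ser₄ {κ : Type*} (i : κ) {φ ψ χ η : MultiIndex → ℝ} (hφ : ∀ J, 0 ≤ φ J)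
    (hψ : ∀ J, 0 ≤ ψ J) (hχ : ∀ J, 0 ≤ χ J) (hη : ∀ J, 0 ≤ η J) :
    ((PowerSeries.coeff n (geom i * (ser n φ * ser n ψ * ser n χ * ser n η)) : ℝ≥0) : ℝ) =
      ∑ K ∈ tuplesLE 4 n 0, φ (K 0) * ψ (K 1) * χ (K 2) * η (K 3) := by
  have h := coeff_X_pow_mul_geom_mul_prod_ser (n := n) 0 (φ := ![φ, ψ, χ, η])
    (by intro j; fin_cases j <;> assumption) i
  simpa only [Fin.prod_univ_four, Matrix.cons_val_zero, Matrix.cons_val_one, Matrix.cons_val,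
    pow_zero, one_mul] using h

theorem coeff_ser₃ {φ ψ χ : MultiIndex → ℝ} (hφ : ∀ J, 0 ≤ φ J)
    (hψ : ∀ J, 0 ≤ ψ J) (hχ : ∀ J, 0 ≤ χ J) :
    ((PowerSeries.coeff n (ser n φ * ser n ψ * ser n χ) : ℝ≥0) : ℝ) =
      ∑ K ∈ tuplesEq 3 n, φ (K 0) * ψ (K 1) * χ (K 2) := by
  have h := coeff_prod_ser (n := n) (φ := ![φ, ψ, χ]) (by intro j; fin_cases j <;> assumption)
  simpa only [Fin.prod_univ_three, Matrix.cons_val_zero, Matrix.cons_val_one,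
    Matrix.cons_val] using h

theorem coeff_ser₄ {φ ψ χ η : MultiIndex → ℝ} (hφ : ∀ J, 0 ≤ φ J)
    (hψ : ∀ J, 0 ≤ ψ J) (hχ : ∀ J, 0 ≤ χ J) (hη : ∀ J, 0 ≤ η J) :
    ((PowerSeries.coeff n (ser n φ * ser n ψ * ser n χ * ser n η) : ℝ≥0) : ℝ) =
      ∑ K ∈ tuplesEq 4 n, φ (K 0) * ψ (K 1) * χ (K 2) * η (K 3) := by
  have h := coeff_prod_ser (n := n) (φ := ![φ, ψ, χ, η]) (by intro j; fin_cases j <;> assumption)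
  simpa only [Fin.prod_univ_four, Matrix.cons_val_zero, Matrix.cons_val_one,
    Matrix.cons_val] using h

theorem coeff_C_mul_prod_ser (c : ℝ) {l : ℕ} {φ : Fin l → MultiIndex → ℝ}
    (hφ : ∀ j J, 0 ≤ φ j J) :
    ((PowerSeries.coeff n (PowerSeries.C ‖c‖₊ * ∏ j, ser n (φ j)) : ℝ≥0) : ℝ) =
      ∑ K ∈ tuplesEq l n, |c| * ∏ j, φ j (K j) := by
  rw [PowerSeries.coeff_C_mul, NNReal.coe_mul, coeff_prod_ser hφ, Finset.mul_sum]
  rfl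

variable {Ct : ℝ} {κ : Type*} (d : κ → Sol n Ct) (B : InvariantInner) (i : κ)

theorem coeff_serV (k : ℕ) : ((PowerSeries.coeff n (serV d k i) : ℝ≥0) : ℝ) =
    ∑ s ∈ Finset.range (n + 1), ∑ K ∈ tuplesEq (2 * s) n,
      |Vder (d i).V (k + s) (‖(d i).Φ (d i).pt‖ ^ 2)| * ∏ j, (d i).φN (K j) := by
  simp only [serV, Finset.sum_apply, Pi.mul_apply, Pi.pow_apply, map_sum, NNReal.coe_sum]
  refine Finset.sum_congr rfl fun s _ => ?_
  rw [← coeff_C_mul_prod_ser _ (φ := fun _ => (d i).φN) fun _ _ => norm_nonneg _, Fin.prod_const,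
    ← sq (serΦ d i), ← pow_mul]

theorem coeff_serV_mul_serΦ (k : ℕ) :
    ((PowerSeries.coeff n (serV d k i * serΦ d i) : ℝ≥0) : ℝ) =
    ∑ s ∈ Finset.range (n + 1), ∑ K ∈ tuplesEq (2 * s + 1) n,
      |Vder (d i).V (k + s) (‖(d i).Φ (d i).pt‖ ^ 2)| * ∏ j, (d i).φN (K j) := by
  simp only [serV, Finset.sum_apply, Pi.mul_apply, Pi.pow_apply, Finset.sum_mul, map_sum,
    NNReal.coe_sum]
  refine Finset.sum_congr rfl fun s _ => ?_
  rw [← coeff_C_mul_prod_ser _ (φ := fun _ => (d i).φN) fun _ _ => norm_nonneg _, Fin.prod_const,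
    ← sq (serΦ d i), ← pow_mul, mul_assoc, ← pow_succ]

theorem coeff_serH_mul_serV : ((PowerSeries.coeff n (serH d i * serV d 0 i) : ℝ≥0) : ℝ) =
    ∑ s ∈ Finset.range (n + 1), ∑ K ∈ tuplesEq (2 * s + 1) n,
      (d i).hN (K 0) * |Vder (d i).V s (‖(d i).Φ (d i).pt‖ ^ 2)|
        * ∏ j : Fin (2 * s), (d i).φN (K j.succ) := by
  simp only [serV, Finset.sum_apply, Pi.mul_apply, Pi.pow_apply, Finset.mul_sum, map_sum,
    NNReal.coe_sum]
  refine Finset.sum_congr rfl fun s _ => ?_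
  have h := coeff_C_mul_prod_ser (n := n) (Vder (d i).V s (‖(d i).Φ (d i).pt‖ ^ 2))
    (φ := (Fin.cons (d i).hN fun _ => (d i).φN : Fin (2 * s + 1) → MultiIndex → ℝ))
    (fun j J => by
      refine Fin.cases ?_ (fun j => ?_) j
      · exact Real.sqrt_nonneg _
      · exact norm_nonneg _)
  simp only [Fin.prod_univ_succ, Fin.cons_zero, Fin.cons_succ, Finset.prod_const,
    Finset.card_univ, Fintype.card_fin] at h
  rw [zero_add, ← sq, ← pow_mul, mul_left_comm, h]
  exact Finset.sum_congr rfl fun K _ => by ring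

theorem coeff_serJ : ((PowerSeries.coeff n (serJ d B i) : ℝ≥0) : ℝ) =
    (∑ K ∈ tuplesLE 2 n 0, (d i).dhN (K 0) * (d i).daN B (K 1))
      + (∑ K ∈ tuplesLE 2 n 0, (d i).aN B (K 0) * (d i).daN B (K 1))
      + (∑ K ∈ tuplesLE 3 n 0, (d i).aN B (K 0) * (d i).aN B (K 1) * (d i).aN B (K 2))
      + (∑ K ∈ tuplesLE 2 n 0, (d i).φN (K 0) * (d i).dφN (K 1))
      + (∑ K ∈ tuplesEq 3 n, (d i).φN (K 0) * (d i).φN (K 1) * (d i).aN B (K 2)) := by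
  have hdh : ∀ J, 0 ≤ (d i).dhN J := fun J => Real.sqrt_nonneg _
  have ha : ∀ J, 0 ≤ (d i).aN B J := fun J => Real.sqrt_nonneg _
  have hda : ∀ J, 0 ≤ (d i).daN B J := fun J => Real.sqrt_nonneg _
  have hφ : ∀ J, 0 ≤ (d i).φN J := fun J => norm_nonneg _
  have hdφ : ∀ J, 0 ≤ (d i).dφN J := fun J => Real.sqrt_nonneg _
  simp only [serJ, Pi.add_apply, Pi.mul_apply, map_add, NNReal.coe_add]
  rw [coeff_geom_ser₂' i hdh hda, coeff_geom_ser₂' i ha hda, coeff_geom_ser₃ i ha ha ha,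
    coeff_geom_ser₂' i hφ hdφ, coeff_ser₃ hφ hφ ha]

theorem coeff_serW : ((PowerSeries.coeff n (serW d B i) : ℝ≥0) : ℝ) =
    (∑ K ∈ tuplesLE 2 n 0, (d i).aN B (K 0) * (d i).dφN (K 1))
      + (∑ K ∈ tuplesLE 3 n 0, (d i).aN B (K 0) * (d i).aN B (K 1) * (d i).φN (K 2))
      + (∑ s ∈ Finset.range (n + 1), ∑ K ∈ tuplesEq (2 * s + 1) n,
        |Vder (d i).V (s + 1) (‖(d i).Φ (d i).pt‖ ^ 2)| * ∏ j, (d i).φN (K j)) := by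
  have ha : ∀ J, 0 ≤ (d i).aN B J := fun J => Real.sqrt_nonneg _
  have hφ : ∀ J, 0 ≤ (d i).φN J := fun J => norm_nonneg _
  have hdφ : ∀ J, 0 ≤ (d i).dφN J := fun J => Real.sqrt_nonneg _
  simp only [serW, Pi.add_apply, Pi.mul_apply, map_add, NNReal.coe_add]
  have hV := coeff_serV_mul_serΦ d i 1
  simp only [add_comm 1] at hV
  rw [coeff_geom_ser₂' i ha hdφ, coeff_geom_ser₃ i ha ha hφ, hV]

theorem coeff_serF (F₁ F₂ : κ → Spacetime) :
    ((PowerSeries.coeff n (serF d B F₁ F₂ i) : ℝ≥0) : ℝ) =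
    (∑ K ∈ tuplesLE 2 n 0, ((d i).frN (F₁ i) (F₂ i) famT famU (K 0)
          * (d i).frN (F₁ i) (F₂ i) famT famU (K 1) + (d i).dbarhN (K 0) * (d i).dhN (K 1)))
      + (∑ K ∈ tuplesLE 2 n 1, (d i).frN (F₁ i) (F₂ i) famL famT (K 0) * (d i).dhN (K 1))
      + (∑ K ∈ tuplesLE 2 n 2, (d i).dhN (K 0) * (d i).dhN (K 1))
      + (∑ K ∈ tuplesLE 3 n 0, (d i).hN (K 2) * (d i).dhN (K 1) * (d i).dhN (K 0))
      + (∑ K ∈ tuplesLE 2 n 0, (d i).daN B (K 0) * (d i).daN B (K 1))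
      + (∑ K ∈ tuplesLE 3 n 0, (d i).daN B (K 0) * (d i).aN B (K 1) * (d i).aN B (K 2))
      + (∑ s ∈ Finset.range (n + 1), ∑ K ∈ tuplesEq (2 * s) n,
        |Vder (d i).V s (‖(d i).Φ (d i).pt‖ ^ 2)| * ∏ j, (d i).φN (K j))
      + (∑ K ∈ tuplesLE 4 n 0, (d i).aN B (K 0) * (d i).aN B (K 1) * (d i).aN B (K 2)
        * (d i).aN B (K 3))
      + (∑ s ∈ Finset.range (n + 1), ∑ K ∈ tuplesEq (2 * s + 1) n,
        (d i).hN (K 0) * |Vder (d i).V s (‖(d i).Φ (d i).pt‖ ^ 2)|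
          * ∏ j : Fin (2 * s), (d i).φN (K j.succ))
      + (∑ K ∈ tuplesLE 2 n 0, (d i).dφN (K 0) * (d i).dφN (K 1))
      + (∑ K ∈ tuplesLE 3 n 0, (d i).aN B (K 0) * (d i).φN (K 1) * (d i).dφN (K 2))
      + (∑ K ∈ tuplesEq 4 n, (d i).aN B (K 0) * (d i).aN B (K 1) * (d i).φN (K 2)
        * (d i).φN (K 3)) := by
  have hh : ∀ J, 0 ≤ (d i).hN J := fun J => Real.sqrt_nonneg _
  have hdh : ∀ J, 0 ≤ (d i).dhN J := fun J => Real.sqrt_nonneg _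
  have hb : ∀ J, 0 ≤ (d i).dbarhN J := fun J => Real.sqrt_nonneg _
  have hfr : ∀ 𝒱 𝒲 J, 0 ≤ (d i).frN (F₁ i) (F₂ i) 𝒱 𝒲 J := fun _ _ J => Real.sqrt_nonneg _
  have ha : ∀ J, 0 ≤ (d i).aN B J := fun J => Real.sqrt_nonneg _
  have hda : ∀ J, 0 ≤ (d i).daN B J := fun J => Real.sqrt_nonneg _
  have hφ : ∀ J, 0 ≤ (d i).φN J := fun J => norm_nonneg _
  have hdφ : ∀ J, 0 ≤ (d i).dφN J := fun J => Real.sqrt_nonneg _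
  have hV := coeff_serV d i 0
  simp only [zero_add] at hV
  have hX : ∀ c, (serX ^ c : κ → ℝ≥0⟦X⟧) i = PowerSeries.X ^ c := fun c => rfl
  simp only [serF, Pi.add_apply, Pi.mul_apply, hX, map_add, NNReal.coe_add]
  rw [coeff_geom_ser₂' i (hfr _ _) (hfr _ _), coeff_geom_ser₂' i hb hdh,
    coeff_geom_ser₂ 1 i (hfr _ _) hdh, coeff_geom_ser₂ 2 i hdh hdh,
    coeff_geom_ser₃ i hdh hdh hh, coeff_geom_ser₂' i hda hda, coeff_geom_ser₃ i hda ha ha, hV,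
    coeff_geom_ser₄ i ha ha ha ha, coeff_serH_mul_serV, coeff_geom_ser₂' i hdφ hdφ,
    coeff_geom_ser₃ i ha hφ hdφ, coeff_ser₄ ha ha hφ hφ, ← Finset.sum_add_distrib]
  congr 9
  exact Finset.sum_congr rfl fun K _ => by ring

end extraction

/-! ### The estimates -/

section estimates

variable {n : ℕ} {Ct : ℝ}

theorem sqrt_add_le_add_sqrt (a b : ℝ) : Real.sqrt (a + b) ≤ Real.sqrt a + Real.sqrt b := by
  have h : ∀ c : ℝ, c ≤ Real.sqrt c ^ 2 := fun c => by
    rcases le_total 0 c with hc | hc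
    · exact (Real.sq_sqrt hc).ge
    · exact hc.trans (sq_nonneg _)
  refine Real.sqrt_le_iff.mpr ⟨by positivity, ?_⟩
  nlinarith [h a, h b, mul_nonneg (Real.sqrt_nonneg a) (Real.sqrt_nonneg b)]

theorem sqrt_sum_le_sum_sqrt {σ : Type*} (s : Finset σ) {f : σ → ℝ} :
    Real.sqrt (∑ j ∈ s, f j) ≤ ∑ j ∈ s, Real.sqrt (f j) := by
  classical
  induction s using Finset.induction_on with
  | empty => simp
  | insert j s hj ih =>
    rw [Finset.sum_insert hj, Finset.sum_insert hj]
    exact (sqrt_add_le_add_sqrt _ _).trans (by gcongr)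

/-- Solutions with a null frame at a point off the axis. -/
abbrev FramedSol (n : ℕ) (Ct : ℝ) : Type :=
  {q : Sol n Ct × Spacetime × Spacetime // rad q.1.pt ≠ 0 ∧ IsSphereFrame q.1.pt q.2.1 q.2.2}

theorem exists_termF_le (B : InvariantInner) (n : ℕ) {Ct : ℝ} (hCt : Ct < 1) : ∃ C : ℝ, 0 ≤ C ∧
    ∀ (q : FramedSol n Ct) (I : MultiIndex), I.length = n →
      normT (ZT (slab q.1.1.T) I (termF B q.1.1.V (slab q.1.1.T) q.1.1.h q.1.1.A q.1.1.Φ))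
        q.1.1.pt ≤ C * (PowerSeries.coeff n (serF (fun q : FramedSol n Ct => q.1.1) B
          (fun q => q.1.2.1) (fun q => q.1.2.2) q) : ℝ≥0) := by
  have h := fun μ ν => (maj_termF (fun q : FramedSol n Ct => q.1.1) B (F₁ := fun q => q.1.2.1)
    (F₂ := fun q => q.1.2.2) hCt (fun q => q.2.1) (fun q => q.2.2) μ ν).2
  choose C hC using h
  refine ⟨∑ μ, ∑ ν, (C μ ν : ℝ), by positivity, fun q I hI => ?_⟩
  rw [Finset.sum_mul]
  refine (sqrt_sum_le_sum_sqrt _).trans (Finset.sum_le_sum fun μ _ => ?_)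
  rw [Finset.sum_mul]
  refine (sqrt_sum_le_sum_sqrt _).trans (Finset.sum_le_sum fun ν _ => ?_)
  rw [Real.sqrt_sq_eq_abs]
  have h1 := hC μ ν q I hI.le
  rw [hI] at h1
  exact NNReal.coe_le_coe.mpr h1

theorem exists_termJ_le (B : InvariantInner) (n : ℕ) {Ct : ℝ} (hCt : Ct < 1) : ∃ C : ℝ, 0 ≤ C ∧
    ∀ (d : Sol n Ct) (I : MultiIndex), I.length = n →
      normA B (ZA (slab d.T) I (termJ (slab d.T) d.h d.A d.Φ)) d.pt ≤
        C * (PowerSeries.coeff n (serJ (fun d : Sol n Ct => d) B d) : ℝ≥0) := by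
  have h := fun β => (maj_termJ (fun d : Sol n Ct => d) B hCt β).2
  choose C hC using h
  obtain ⟨M, hM, hB⟩ := B.exists_sqrt_le
  refine ⟨∑ β, M * C β, by positivity, fun d I hI => ?_⟩
  rw [Finset.sum_mul]
  refine (sqrt_sum_le_sum_sqrt _).trans (Finset.sum_le_sum fun β _ => (hB _).trans ?_)
  rw [mul_assoc]
  have h1 := hC β d I hI.le
  rw [hI] at h1
  exact mul_le_mul_of_nonneg_left (NNReal.coe_le_coe.mpr h1) hM.le

theorem exists_termW_le (B : InvariantInner) (n : ℕ) {Ct : ℝ} (hCt : Ct < 1) : ∃ C : ℝ, 0 ≤ C ∧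
    ∀ (d : Sol n Ct) (I : MultiIndex), I.length = n →
      ‖ZI (slab d.T) I (termW d.V (slab d.T) d.h d.A d.Φ) d.pt‖ ≤
        C * (PowerSeries.coeff n (serW (fun d : Sol n Ct => d) B d) : ℝ≥0) := by
  obtain ⟨C, hC⟩ := (maj_termW (fun d : Sol n Ct => d) B hCt).2
  refine ⟨C, C.2, fun d I hI => ?_⟩
  have h1 := hC d I hI.le
  rw [hI] at h1
  exact NNReal.coe_le_coe.mpr h1

end estimates

end EYMH

end

open EYMH in
theorem proposition5p2 (B : InvariantInner) (n : ℕ) (Ct : ℝ) (hCt : Ct < 1) :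
    ∃ C : ℝ, 0 < C ∧
      ∀ (T : ℝ) (h : Fin 4 → Fin 4 → Spacetime → ℝ) (A : Fin 4 → Spacetime → su2)
        (Φ : Spacetime → Doublet) (V : ℝ → ℝ),
        0 < T →
        (∀ μ ν, ContDiffOn ℝ ((n + 1 : ℕ) : WithTop ℕ∞) (h μ ν) (slab T)) →
        (∀ α, ContDiffOn ℝ ((n + 1 : ℕ) : WithTop ℕ∞) (A α) (slab T)) →
        ContDiffOn ℝ ((n + 1 : ℕ) : WithTop ℕ∞) Φ (slab T) →
        ContDiffOn ℝ ((n + 1 : ℕ) : WithTop ℕ∞) V (Set.Ici 0) →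
        (∀ x ∈ slab T, IsLorentzian (gMat h x)) →
        WaveCoordinates (slab T) h →
        ∀ I : MultiIndex, I.length = n →
        ∀ x ∈ slab T,
          (∀ J : MultiIndex, J.length ≤ n → normT (ZT (slab T) J h) x ≤ Ct) →
          -- the estimate of `Z^I F`, off the axis `r = 0`, in any null frame
          (∀ S₁ S₂ : Spacetime, rad x ≠ 0 → IsSphereFrame x S₁ S₂ →
            normT (ZT (slab T) I (termF B V (slab T) h A Φ)) x ≤ C * (
              (∑ K ∈ tuplesLE 2 n 0,
                (normDTframe (slab T) S₁ S₂ famT famU (ZT (slab T) (K 0) h) x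
                    * normDTframe (slab T) S₁ S₂ famT famU (ZT (slab T) (K 1) h) x
                  + normDbarT (slab T) (ZT (slab T) (K 0) h) x
                    * normDT (slab T) (ZT (slab T) (K 1) h) x))
              + (∑ K ∈ tuplesLE 2 n 1,
                normDTframe (slab T) S₁ S₂ famL famT (ZT (slab T) (K 0) h) x
                  * normDT (slab T) (ZT (slab T) (K 1) h) x)
              + (∑ K ∈ tuplesLE 2 n 2,
                normDT (slab T) (ZT (slab T) (K 0) h) x
                  * normDT (slab T) (ZT (slab T) (K 1) h) x)
              + (∑ K ∈ tuplesLE 3 n 0,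
                normT (ZT (slab T) (K 2) h) x * normDT (slab T) (ZT (slab T) (K 1) h) x
                  * normDT (slab T) (ZT (slab T) (K 0) h) x)
              + (∑ K ∈ tuplesLE 2 n 0,
                normDA B (slab T) (ZA (slab T) (K 0) A) x
                  * normDA B (slab T) (ZA (slab T) (K 1) A) x)
              + (∑ K ∈ tuplesLE 3 n 0,
                normDA B (slab T) (ZA (slab T) (K 0) A) x
                  * normA B (ZA (slab T) (K 1) A) x * normA B (ZA (slab T) (K 2) A) x)
              + (∑ s ∈ Finset.range (n + 1), ∑ K ∈ tuplesEq (2 * s) n,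
                |Vder V s (‖Φ x‖ ^ 2)| * ∏ i, ‖ZI (slab T) (K i) Φ x‖)
              + (∑ K ∈ tuplesLE 4 n 0,
                normA B (ZA (slab T) (K 0) A) x * normA B (ZA (slab T) (K 1) A) x
                  * normA B (ZA (slab T) (K 2) A) x * normA B (ZA (slab T) (K 3) A) x)
              + (∑ s ∈ Finset.range (n + 1), ∑ K ∈ tuplesEq (2 * s + 1) n,
                normT (ZT (slab T) (K 0) h) x * |Vder V s (‖Φ x‖ ^ 2)|
                  * ∏ i : Fin (2 * s), ‖ZI (slab T) (K i.succ) Φ x‖)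
              + (∑ K ∈ tuplesLE 2 n 0,
                normDPhi (slab T) (ZI (slab T) (K 0) Φ) x
                  * normDPhi (slab T) (ZI (slab T) (K 1) Φ) x)
              + (∑ K ∈ tuplesLE 3 n 0,
                normA B (ZA (slab T) (K 0) A) x * ‖ZI (slab T) (K 1) Φ x‖
                  * normDPhi (slab T) (ZI (slab T) (K 2) Φ) x)
              + (∑ K ∈ tuplesEq 4 n,
                normA B (ZA (slab T) (K 0) A) x * normA B (ZA (slab T) (K 1) A) x
                  * ‖ZI (slab T) (K 2) Φ x‖ * ‖ZI (slab T) (K 3) Φ x‖))) ∧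
          -- the estimate of `Z^I J`
          normA B (ZA (slab T) I (termJ (slab T) h A Φ)) x ≤ C * (
              (∑ K ∈ tuplesLE 2 n 0,
                normDT (slab T) (ZT (slab T) (K 0) h) x
                  * normDA B (slab T) (ZA (slab T) (K 1) A) x)
              + (∑ K ∈ tuplesLE 2 n 0,
                normA B (ZA (slab T) (K 0) A) x * normDA B (slab T) (ZA (slab T) (K 1) A) x)
              + (∑ K ∈ tuplesLE 3 n 0,
                normA B (ZA (slab T) (K 0) A) x * normA B (ZA (slab T) (K 1) A) x
                  * normA B (ZA (slab T) (K 2) A) x)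
              + (∑ K ∈ tuplesLE 2 n 0,
                ‖ZI (slab T) (K 0) Φ x‖ * normDPhi (slab T) (ZI (slab T) (K 1) Φ) x)
              + (∑ K ∈ tuplesEq 3 n,
                ‖ZI (slab T) (K 0) Φ x‖ * ‖ZI (slab T) (K 1) Φ x‖
                  * normA B (ZA (slab T) (K 2) A) x)) ∧
          -- the estimate of `Z^I W`
          ‖ZI (slab T) I (termW V (slab T) h A Φ) x‖ ≤ C * (
              (∑ K ∈ tuplesLE 2 n 0,
                normA B (ZA (slab T) (K 0) A) x
                  * normDPhi (slab T) (ZI (slab T) (K 1) Φ) x)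
              + (∑ K ∈ tuplesLE 3 n 0,
                normA B (ZA (slab T) (K 0) A) x * normA B (ZA (slab T) (K 1) A) x
                  * ‖ZI (slab T) (K 2) Φ x‖)
              + (∑ s ∈ Finset.range (n + 1), ∑ K ∈ tuplesEq (2 * s + 1) n,
                |Vder V (s + 1) (‖Φ x‖ ^ 2)| * ∏ i, ‖ZI (slab T) (K i) Φ x‖)) := by
  obtain ⟨C₁, h₁, hF⟩ := exists_termF_le B n hCt
  obtain ⟨C₂, h₂, hJ⟩ := exists_termJ_le B n hCt
  obtain ⟨C₃, h₃, hW⟩ := exists_termW_le B n hCt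
  refine ⟨C₁ + C₂ + C₃ + 1, by positivity, ?_⟩
  have e₁ : C₁ ≤ C₁ + C₂ + C₃ + 1 := by linarith
  have e₂ : C₂ ≤ C₁ + C₂ + C₃ + 1 := by linarith
  have e₃ : C₃ ≤ C₁ + C₂ + C₃ + 1 := by linarith
  intro T h A Φ V hT hh hA hΦ hV hg hw I hI x hx hsmall
  let d : Sol n Ct := ⟨T, h, A, Φ, V, x, hT, hh, hA, hΦ, hV, hg, hw, hx, hsmall⟩
  refine ⟨fun S₁ S₂ hr hS => ?_, ?_, ?_⟩
  · let q : FramedSol n Ct := ⟨(d, S₁, S₂), hr, hS⟩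
    refine ((hF q I hI).trans (mul_le_mul_of_nonneg_right e₁ (NNReal.coe_nonneg _))).trans
      (le_of_eq ?_)
    rw [coeff_serF]
    rfl
  · refine ((hJ d I hI).trans (mul_le_mul_of_nonneg_right e₂ (NNReal.coe_nonneg _))).trans
      (le_of_eq ?_)
    rw [coeff_serJ]
    rfl
  · refine ((hW d I hI).trans (mul_le_mul_of_nonneg_right e₃ (NNReal.coe_nonneg _))).trans
      (le_of_eq ?_)
    rw [coeff_serW]
    rfl
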